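/- Let $k$ be a field, $S=k[x_1,\dots,x_n]$, $\mathfrak m=\langle x_1,\dots,x_n\rangle$, and let $I\subsetneq S$ be an ideal generated by monomials, with $\dim(S/I)=d$. Let $\Lambda_I\subseteq\mathbb N^n$ be the set of exponent vectors of the monomials of $S$ outside of $I$, let $V_I\subseteq\mathbb C^n$ be the Zariski closure of $\Lambda_I$ in $\mathbb C^n$ (the distracting arrangement, a finite union of translates of coordinate subspaces), and let $V_I(\mathbb R)=V_I\cap\mathbb R^n$ (the real distracting arrangement), with its Euclidean topology. Say that $V=V_I(\mathbb R)$ is Cohen–Macaulay over $k$ near $\alpha\in\mathbb R^n$ if $\alpha$ has a neighbourhood $U$ in $\mathbb R^n$ such that, for every $p\in V\cap U$, all but the top local cohomology of $V$ at $p$ vanishes: the relative singular cohomology satisfies $H^i(V,V\setminus\{p\};k)=0$ for all $i\ne\dim V$, where $\dim V$ is the (global) dimension of the arrangement $V$, i.e. the largest dimension of an affine subspace contained in it. For the $\mathbb Z^n$-graded local cohomology module $N=H^i_{\mathfrak m}(S/I)$, let $\operatorname{tdeg}(N)=\{a\in\mathbb Z^n : N_a\ne0\}$ be its set of true degrees,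 and let $\operatorname{qdeg}_{\mathbb R}(N)$ be the intersection with $\mathbb R^n$ of the Zariski closure of $\operatorname{tdeg}(N)$ in $\mathbb C^n$ (the real quasidegree set). Theorem. For every $\alpha\in\mathbb R^n$, the real distracting arrangement $V_I(\mathbb R)$ is not Cohen–Macaulay over $k$ near $\alpha$ if and only if $\alpha\in\operatorname{qdeg}_{\mathbb R}\big(H^i_{\mathfrak m}(S/I)\big)$ for some $i<d$. -/

import Mathlib

open MvPolynomial
open scoped Topology

noncomputable section

namespace MonomialArr

/-! ### Cohomology of a cochain complex -/

section Cohomology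

variable {R : Type*} [CommRing R] {C : ℕ → Type*} [∀ q, AddCommGroup (C q)] [∀ q, Module R (C q)]

/-- The coboundaries in cohomological degree `i` of a complex `C 0 → C 1 → ⋯`. -/
def coboundaries (d : ∀ q, C q →ₗ[R] C (q + 1)) : ∀ i, Submodule R (C i)
  | 0 => ⊥
  | q + 1 => LinearMap.range (d q)

/-- The `i`-th cohomology (cocycles modulo coboundaries) of a complex `C 0 → C 1 → ⋯`. -/
abbrev Cohomology (d : ∀ q, C q →ₗ[R] C (q + 1)) (i : ℕ) : Type _ :=
  LinearMap.ker (d i) ⧸ (coboundaries d i).submoduleOf (LinearMap.ker (d i))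

end Cohomology

/-! ### Relative singular cohomology -/

section Singular

variable (k : Type*) [Field k] {X : Type*} [TopologicalSpace X]

/-- The `j`-th face of a singular `(q+1)`-simplex. -/
def face {q : ℕ} (σ : C(stdSimplex ℝ (Fin (q + 2)), X)) (j : Fin (q + 2)) :
    C(stdSimplex ℝ (Fin (q + 1)), X) :=
  σ.comp ⟨stdSimplex.map j.succAbove, stdSimplex.continuous_map _⟩

/-- Singular `q`-cochains of the pair `(X, A)`: functions on the singular simplices of `X` that
vanish on those contained in `A`. -/
def relCochain (A : Set X) (q : ℕ) : Submodule k (C(stdSimplex ℝ (Fin (q + 1)), X) → k) where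
  carrier := {φ | ∀ σ : C(stdSimplex ℝ (Fin (q + 1)), X), Set.range σ ⊆ A → φ σ = 0}
  add_mem' hφ hψ σ hσ := by simp [hφ σ hσ, hψ σ hσ]
  zero_mem' _ _ := rfl
  smul_mem' c φ hφ σ hσ := by simp [hφ σ hσ]

/-- The singular coboundary map of the pair `(X, A)`. -/
def singularD (A : Set X) (q : ℕ) : relCochain k A q →ₗ[k] relCochain k A (q + 1) where
  toFun φ := ⟨fun σ => ∑ j : Fin (q + 2), (-1 : k) ^ (j : ℕ) * φ.1 (face σ j), by
    intro σ hσ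
    refine Finset.sum_eq_zero fun j _ => ?_
    rw [φ.2 (face σ j) ?_, mul_zero]
    rintro _ ⟨x, rfl⟩
    exact hσ ⟨_, rfl⟩⟩
  map_add' φ ψ := by
    ext σ
    simp [mul_add, Finset.sum_add_distrib]
  map_smul' c φ := by
    ext σ
    simp only [RingHom.id_apply, Submodule.coe_smul, Pi.smul_apply, smul_eq_mul, Finset.mul_sum]
    exact Finset.sum_congr rfl fun j _ => by ring

/-- The relative singular cohomology `H^i(X, A; k)`. -/
abbrev RelCohomology (A : Set X) (i : ℕ) : Type _ := Cohomology (singularD k A) i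

end Singular

/-! ### The topological Cohen–Macaulay property -/

/-- The dimension of a subspace arrangement `V ⊆ ℝⁿ`, that is, of a finite union of affine
subspaces: the largest dimension of a (nonempty) affine subspace contained in `V`. -/
def arrDim {n : ℕ} (V : Set (Fin n → ℝ)) : ℕ :=
  sSup {m | ∃ A : AffineSubspace ℝ (Fin n → ℝ), (A : Set (Fin n → ℝ)).Nonempty ∧
    (A : Set (Fin n → ℝ)) ⊆ V ∧ Module.finrank ℝ A.direction = m}

/-- A subspace arrangement `V ⊆ ℝⁿ` is Cohen–Macaulay over `k` near `α` if, for all points `p` of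
`V` in a neighbourhood of `α`, the local cohomology `H^i(V, V ∖ {p}; k)` at `p` vanishes in all
cohomological degrees `i` other than the top one, `i = dim V`. -/
def IsCohenMacaulayNear (k : Type*) [Field k] {n : ℕ} (V : Set (Fin n → ℝ))
    (α : Fin n → ℝ) : Prop :=
  ∃ U ∈ 𝓝 α, ∀ p : V, (p : Fin n → ℝ) ∈ U → ∀ i : ℕ, i ≠ arrDim V →
    Subsingleton (RelCohomology k ({p}ᶜ : Set V) i)

/-! ### Zariski closures, distracting arrangements, quasidegrees -/

/-- The Zariski closure in `ℂⁿ` of a set of lattice points. -/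
def zariskiClosure {n : ℕ} (T : Set (Fin n → ℤ)) : Set (Fin n → ℂ) :=
  zeroLocus ℂ (vanishingIdeal ℂ ((fun (a : Fin n → ℤ) (j : Fin n) => (a j : ℂ)) '' T))

/-- The real points `Z ∩ ℝⁿ` of a subset `Z ⊆ ℂⁿ`. -/
def realPoints {n : ℕ} (Z : Set (Fin n → ℂ)) : Set (Fin n → ℝ) :=
  {x | (fun j => (x j : ℂ)) ∈ Z}

section Monomial

variable {k : Type*} [Field k] {n : ℕ}

/-- Ideals generated by monomials. -/
def IsMonomialIdeal (I : Ideal (MvPolynomial (Fin n) k)) : Prop :=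
  ∃ G : Set (Fin n →₀ ℕ), I = Ideal.span ((fun u => monomial u (1 : k)) '' G)

/-- The exponent vectors of the standard monomials, i.e. of the monomials outside of `I`. -/
def standardExponents (I : Ideal (MvPolynomial (Fin n) k)) : Set (Fin n → ℤ) :=
  {a | ∃ u : Fin n →₀ ℕ, monomial u (1 : k) ∉ I ∧ ∀ j, a j = u j}

/-- The distracting arrangement `V_I ⊆ ℂⁿ`. -/
def distractingArrangement (I : Ideal (MvPolynomial (Fin n) k)) : Set (Fin n → ℂ) :=
  zariskiClosure (standardExponents I)

/-- The true degrees of a module whose graded pieces are `N a`, `a ∈ ℤⁿ`. -/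
def trueDegrees {H : Type*} [AddCommGroup H] [Module k H]
    (N : (Fin n → ℤ) → Submodule k H) : Set (Fin n → ℤ) :=
  {a | N a ≠ ⊥}

/-- The real quasidegree set of a module whose graded pieces are `N a`, `a ∈ ℤⁿ`. -/
def realQuasidegrees {H : Type*} [AddCommGroup H] [Module k H]
    (N : (Fin n → ℤ) → Submodule k H) : Set (Fin n → ℝ) :=
  realPoints (zariskiClosure (trueDegrees N))

/-! ### The ℤⁿ-graded local cohomology modules `H^i_𝔪(S/I)` through the Čech complex -/

/-- The multiplicative subset of `S/I` generated by the variables `x_j`, `j ∈ F`. -/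
def varMonoid (I : Ideal (MvPolynomial (Fin n) k)) (F : Finset (Fin n)) :
    Submonoid (MvPolynomial (Fin n) k ⧸ I) :=
  Submonoid.closure ((fun j => Ideal.Quotient.mk I (X j)) '' (F : Set (Fin n)))

/-- The monomial localization `S_F / I S_F = (S/I)[x_j⁻¹ : j ∈ F]`. -/
abbrev Loc (I : Ideal (MvPolynomial (Fin n) k)) (F : Finset (Fin n)) : Type _ :=
  Localization (varMonoid I F)

/-- The degree `a` piece of `S_F / I S_F`: the `k`-span of the Laurent monomials `x^u / x^v` with
`supp v ⊆ F` and `u - v = a`. -/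
def locDegree (I : Ideal (MvPolynomial (Fin n) k)) (F : Finset (Fin n)) (a : Fin n → ℤ) :
    Submodule k (Loc I F) :=
  Submodule.span k {z | ∃ u v : Fin n →₀ ℕ, v.support ⊆ F ∧ (∀ j, (u j : ℤ) - v j = a j) ∧
    z * algebraMap _ (Loc I F) (Ideal.Quotient.mk I (monomial v 1)) =
      algebraMap _ (Loc I F) (Ideal.Quotient.mk I (monomial u 1))}

theorem varMonoid_mono (I : Ideal (MvPolynomial (Fin n) k)) {F G : Finset (Fin n)} (h : F ⊆ G) :
    varMonoid I F ≤ (varMonoid I G).comap (RingHom.id _) := by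
  intro z hz
  exact Submonoid.closure_mono (Set.image_mono (Finset.coe_subset.2 h)) hz

/-- The natural localization map `S_F / I S_F → S_G / I S_G` for `F ⊆ G`. -/
def locMap (I : Ideal (MvPolynomial (Fin n) k)) {F G : Finset (Fin n)} (h : F ⊆ G) :
    Loc I F →ₗ[MvPolynomial (Fin n) k] Loc I G where
  toFun := IsLocalization.map (Loc I G) (RingHom.id _) (varMonoid_mono I h)
  map_add' x y := RingHom.map_add _ x y
  map_smul' f z := by
    have key : ∀ F : Finset (Fin n), ∀ w : Loc I F,
        f • w = algebraMap _ (Loc I F) (Ideal.Quotient.mk I f) * w := fun F w => by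
      rw [Algebra.smul_def]; rfl
    rw [key, RingHom.id_apply, key, RingHom.map_mul, IsLocalization.map_eq, RingHom.id_apply]

/-- The `i`-th term of the Čech complex `S/I ⊗ Č(x_1, …, x_n)`. -/
abbrev CechCochain (I : Ideal (MvPolynomial (Fin n) k)) (i : ℕ) : Type _ :=
  ∀ F : {F : Finset (Fin n) // F.card = i}, Loc I F.1

/-- The differential of the Čech complex, with the usual signs of the cochain complex of the
simplex on `{1, …, n}`. -/
def cechD (I : Ideal (MvPolynomial (Fin n) k)) (i : ℕ) :
    CechCochain I i →ₗ[MvPolynomial (Fin n) k] CechCochain I (i + 1) :=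
  LinearMap.pi fun G => ∑ j : G.1, (-1 : ℤ) ^ (G.1.filter (· < j.1)).card •
    (locMap I (G.1.erase_subset j.1) ∘ₗ
      LinearMap.proj (⟨G.1.erase j.1, by rw [Finset.card_erase_of_mem j.2, G.2]; rfl⟩ :
        {F : Finset (Fin n) // F.card = i}))

/-- The local cohomology module `H^i_𝔪(S/I)`, where `𝔪 = (x_1, …, x_n)`. -/
abbrev LocalCohomology (I : Ideal (MvPolynomial (Fin n) k)) (i : ℕ) : Type _ :=
  Cohomology (cechD I) i

/-- The degree `a` piece `H^i_𝔪(S/I)_a`: the classes of the cocycles that are homogeneous of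
degree `a`. -/
def localCohomologyDegree (I : Ideal (MvPolynomial (Fin n) k)) (i : ℕ) (a : Fin n → ℤ) :
    Submodule k (LocalCohomology I i) :=
  ((Submodule.pi Set.univ fun F : {F : Finset (Fin n) // F.card = i} =>
      locDegree I F.1 a).comap ((LinearMap.ker (cechD I i)).subtype.restrictScalars k)).map
    (((coboundaries (cechD I) i).submoduleOf (LinearMap.ker (cechD I i))).mkQ.restrictScalars k)

end Monomial

end MonomialArr

end

/-!
# The non-Cohen–Macaulay locus of a real distracting arrangement

Both sides are computed by the same simplicial complexes. For `p ∈ ℝⁿ`, let `standardFaces I p` be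
the family of those `A ⊆ {1, …, n}` for which `p + ℝ^A` lies in the arrangement `V = V_I(ℝ)`: the
coordinates of `p` outside of `A` are natural numbers, and they are the exponents of no monomial
of `I`. For `F ⊆ {1, …, n}`, the functions on the members `A ⊇ F` of a family of sets form a complex
under the simplicial coboundary; `SimplexExact k S F i` says that it is exact at the sets of
cardinality `i`.

*Algebra.* In degree `a ∈ ℤⁿ`, the Čech complex of `S/I` has the basis of the Laurent monomials
`x^a ∈ S_A / I S_A` for those `A ∈ standardFaces I a` that contain the set `F` of negative positions
of `a`. So `H^i_𝔪(S/I)_a = 0` exactly when `SimplexExact k (standardFaces I a) F i`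
(`localCohomologyDegree_eq_bot_iff_simplexExact`). A homogeneous coboundary bounds a homogeneous
cochain because `x^u ↦ x^u t^u` splits the localizations into homogeneous components
(`exists_component`). As `I` is finitely generated, these conditions are insensitive to the size of
large coordinates, and large nonnegative coordinates of `a` make the complex a cone; so the true
degrees form a finite union of lattice boxes, and `p` is a real quasidegree of `H^i_𝔪(S/I)` exactly
when some `F`, outside of which `p` has natural coordinates, makes the complex of
`standardFaces I p` and `F` inexact at `i` (`mem_realQuasidegrees_iff`).

*Topology.* Near `p`, the arrangement is `p` plus the union of the coordinate subspaces `ℝ^A` with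
`A` in the simplicial complex `S` generated by `standardFaces I p` (`exists_localModel`). The
orthants of these subspaces are indexed by the sign vectors with support in `S`. Relative singular
chains of `(V, V \ {p})` can be replaced by chains of simplices that each lie in one orthant
(`LocalModel.acyclicPair`): subdivide, and push simplices that avoid `p` along a map that rounds
relatively small coordinates to zero. Every orthant has one cell at `p`, a simplex with apex `p`;
evaluation on these cells compares the singular cochains with the functions on the sign vectors, by
Mayer–Vietoris induction over the faces of the orthants (`cellAcyclic`). Finally, by inclusion and
exclusion over the negative positions, the complex of functions on the sign vectors is the direct
sum over all `F` of the complexes above (`signExact_iff`). Hence `H^i(V, V \ {p}; k) = 0` exactly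
when `SimplexExact k S F i` for all `F`. If `F` misses a coordinate of `p` that is not a natural
number, then the complex at `F` is a cone, and for the other `F` the families `S` and
`standardFaces I p` agree on the sets containing `F`.

So the real quasidegrees of `H^i_𝔪(S/I)` are exactly the points of `V` with nonzero local cohomology
in degree `i` (`mem_realQuasidegrees_iff_relCohomology`). They form a closed set, which is empty for
`i > d` since standard faces have at most `d` elements, and `dim V = d` (`arrDim_eq`). The theorem
follows.
-/

noncomputable section

namespace MonomialArr

/-! ### Simplicial and signed coboundaries -/

section Combinatorics

variable {k : Type*} [Field k] {n : ℕ}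

/-- The sign `(-1)^r` of the element `j` of `A`, where `r` is the number of elements of `A`
below `j`. -/
def faceSign (k : Type*) [Field k] (A : Finset (Fin n)) (j : Fin n) : k :=
  (-1) ^ (A.filter (· < j)).card

theorem faceSign_mul_self (A : Finset (Fin n)) (j : Fin n) :
    faceSign k A j * faceSign k A j = 1 := by
  rw [faceSign, ← mul_pow]; simp

theorem faceSign_insert_self (A : Finset (Fin n)) (j : Fin n) :
    faceSign k (insert j A) j = faceSign k A j := by
  simp [faceSign, Finset.filter_insert]

theorem faceSign_erase_self (A : Finset (Fin n)) (j : Fin n) :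
    faceSign k (A.erase j) j = faceSign k A j := by
  simp [faceSign, Finset.filter_erase]

theorem faceSign_insert {A : Finset (Fin n)} {i j : Fin n} (hj : j ∉ A) :
    faceSign k (insert j A) i = (if j < i then -1 else 1) * faceSign k A i := by
  rw [faceSign, Finset.filter_insert, faceSign]
  split_ifs with h
  · rw [Finset.card_insert_of_notMem (by simp [hj]), pow_succ']
  · rw [one_mul]

/-- The signs of the two ways of passing from `A` to `(A ∪ {j}) ∖ {i}` are opposite. -/
theorem faceSign_swap {A : Finset (Fin n)} {i j : Fin n} (hi : i ∈ A) (hj : j ∉ A) :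
    faceSign k A i * faceSign k (A.erase i) j =
      -(faceSign k A j * faceSign k (insert j A) i) := by
  have hij : i ≠ j := fun h => hj (h ▸ hi)
  have h1 := faceSign_insert (k := k) (A := A.erase i) (i := j) (j := i) (by simp)
  rw [Finset.insert_erase hi] at h1
  rw [faceSign_insert hj, h1]
  rcases lt_or_gt_of_ne hij with h | h
  · simp [h, not_lt_of_gt h, mul_comm]
  · simp [h, not_lt_of_gt h, mul_comm]

/-- The coboundary of the full simplex on `Fin n`: functions on its faces, where all degrees (that
is, cardinalities) are treated at once. -/
def simplexD (f : Finset (Fin n) → k) (A : Finset (Fin n)) : k :=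
  ∑ j ∈ A, faceSign k A j * f (A.erase j)

/-- Exactness, in cardinality `i`, of the complex of functions on those sets of the family `S`
that contain `F`. Functions are extended by zero to the sets not containing `F`, and their values
outside of `S` are irrelevant. -/
def SimplexExact (k : Type*) [Field k] (S : Set (Finset (Fin n))) (F : Finset (Fin n)) (i : ℕ) :
    Prop :=
  ∀ f : Finset (Fin n) → k, (∀ A, ¬ F ⊆ A → f A = 0) →
    (∀ A ∈ S, A.card = i + 1 → simplexD f A = 0) →
    ∃ g : Finset (Fin n) → k, (∀ A, ¬ F ⊆ A → g A = 0) ∧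
      ∀ A ∈ S, A.card = i → simplexD g A = f A

theorem simplexD_eq_zero_of_not_subset {F : Finset (Fin n)} {f : Finset (Fin n) → k}
    (hf : ∀ A, ¬ F ⊆ A → f A = 0) {A : Finset (Fin n)} (hA : ¬ F ⊆ A) : simplexD f A = 0 := by
  refine Finset.sum_eq_zero fun j _ => ?_
  rw [hf _ fun h => hA (h.trans (A.erase_subset j)), mul_zero]

/-- Only the sets containing `F` matter for exactness. -/
theorem SimplexExact.congr {S T : Set (Finset (Fin n))} {F : Finset (Fin n)} {i : ℕ}
    (h : ∀ A, F ⊆ A → (A ∈ S ↔ A ∈ T)) (hS : SimplexExact k S F i) : SimplexExact k T F i := by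
  intro f hf hd
  obtain ⟨g, hg, hgd⟩ := hS f hf fun A hA hc => by
    by_cases hFA : F ⊆ A
    · exact hd A ((h A hFA).1 hA) hc
    · exact simplexD_eq_zero_of_not_subset hf hFA
  refine ⟨g, hg, fun A hA hc => ?_⟩
  by_cases hFA : F ⊆ A
  · exact hgd A ((h A hFA).2 hA) hc
  · rw [simplexD_eq_zero_of_not_subset hg hFA, hf A hFA]

theorem exists_card_of_not_simplexExact {S : Set (Finset (Fin n))} {F : Finset (Fin n)} {i : ℕ}
    (h : ¬ SimplexExact k S F i) : ∃ A ∈ S, F ⊆ A ∧ A.card = i := by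
  by_contra hne
  refine h fun f hf _ => ⟨0, fun _ _ => rfl, fun A hA hc => ?_⟩
  rw [hf A fun hF => hne ⟨A, hA, hF, hc⟩]
  exact simplexD_eq_zero_of_not_subset (F := F) (fun _ _ => rfl) fun hF => hne ⟨A, hA, hF, hc⟩

/-- A family that is a cone with apex `j` is acyclic. -/
theorem simplexExact_of_cone {S : Set (Finset (Fin n))} {F : Finset (Fin n)} {j : Fin n}
    (hj : j ∉ F) (hS : ∀ A ∈ S, F ⊆ A → insert j A ∈ S) (i : ℕ) : SimplexExact k S F i := by
  intro f hf hd
  refine ⟨fun B => if j ∈ B then 0 else faceSign k B j * f (insert j B), fun A hA => ?_,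
    fun A hA hc => ?_⟩
  · have : ¬ F ⊆ insert j A := fun h => hA fun x hx => by
      rcases Finset.mem_insert.1 (h hx) with rfl | h'
      · exact absurd hx hj
      · exact h'
    simp [hf _ this]
  by_cases hFA : F ⊆ A
  · by_cases hjA : j ∈ A
    · rw [simplexD, Finset.sum_eq_single_of_mem j hjA]
      · simp only [Finset.mem_erase, ne_eq, not_true_eq_false, false_and, if_false]
        rw [faceSign_erase_self, Finset.insert_erase hjA, ← mul_assoc, faceSign_mul_self, one_mul]
      · intro l _ hl
        simp [hjA, hl.symm]
    · have h1 := hd _ (hS A hA hFA) (by rw [Finset.card_insert_of_notMem hjA, hc])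
      rw [simplexD, Finset.sum_insert hjA, Finset.erase_insert hjA, faceSign_insert_self] at h1
      have h2 : simplexD (fun B => if j ∈ B then 0 else faceSign k B j * f (insert j B)) A =
          -(faceSign k A j * ∑ x ∈ A, faceSign k (insert j A) x * f ((insert j A).erase x)) := by
        rw [simplexD, Finset.mul_sum, ← Finset.sum_neg_distrib]
        refine Finset.sum_congr rfl fun x hx => ?_
        have hxj : x ≠ j := fun h => hjA (h ▸ hx)
        rw [if_neg (by simp [hjA]), ← mul_assoc, faceSign_swap hx hjA,
          Finset.erase_insert_of_ne hxj.symm]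
        ring
      rw [h2, eq_neg_of_add_eq_zero_right h1, mul_neg, neg_neg, ← mul_assoc, faceSign_mul_self,
        one_mul]
  · rw [hf A hFA]
    refine simplexD_eq_zero_of_not_subset (F := F) (fun B hB => ?_) hFA
    have : ¬ F ⊆ insert j B := fun h => hB fun x hx => by
      rcases Finset.mem_insert.1 (h hx) with rfl | h'
      · exact absurd hx hj
      · exact h'
    simp [hf _ this]

/-- The support of a sign vector. -/
def signSupp (t : Fin n → SignType) : Finset (Fin n) := Finset.univ.filter (t · ≠ 0)

@[simp] theorem mem_signSupp {t : Fin n → SignType} {j : Fin n} : j ∈ signSupp t ↔ t j ≠ 0 := by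
  simp [signSupp]

theorem signSupp_update_zero (t : Fin n → SignType) (j : Fin n) :
    signSupp (Function.update t j 0) = (signSupp t).erase j := by
  ext l
  by_cases h : l = j
  · subst h; simp
  · simp [h]

/-- The coboundary of the complex of functions on sign vectors: the cellular coboundary of `ℝⁿ`
cut into orthants, relative to the complement of the origin. -/
def signD (f : (Fin n → SignType) → k) (t : Fin n → SignType) : k :=
  ∑ j ∈ signSupp t, faceSign k (signSupp t) j * f (Function.update t j 0)

/-- Exactness, in degree `i`, of the complex of functions on a set of sign vectors. -/
def SignExact (k : Type*) [Field k] (Γ : Set (Fin n → SignType)) (i : ℕ) : Prop :=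
  ∀ f : (Fin n → SignType) → k, (∀ t ∈ Γ, (signSupp t).card = i + 1 → signD f t = 0) →
    ∃ g : (Fin n → SignType) → k, ∀ t ∈ Γ, (signSupp t).card = i → signD g t = f t

/-- The set of negative positions of a sign vector. -/
def negPart (t : Fin n → SignType) : Finset (Fin n) := Finset.univ.filter (t · = -1)

@[simp] theorem mem_negPart {t : Fin n → SignType} {j : Fin n} : j ∈ negPart t ↔ t j = -1 := by
  rw [negPart, Finset.mem_filter]
  simp

/-- The sign vector with support `A`, negative on `N` and positive elsewhere on `A`. -/
def signVec (A N : Finset (Fin n)) (j : Fin n) : SignType :=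
  if j ∈ A then (if j ∈ N then -1 else 1) else 0

theorem signVec_supp_neg (t : Fin n → SignType) : signVec (signSupp t) (negPart t) = t := by
  funext j
  simp only [signVec, mem_signSupp, mem_negPart]
  cases t j <;> decide

theorem signSupp_signVec (A N : Finset (Fin n)) : signSupp (signVec A N) = A := by
  ext j
  simp only [mem_signSupp, signVec]
  split_ifs <;> simp_all

theorem negPart_signVec {A N : Finset (Fin n)} (h : N ⊆ A) : negPart (signVec A N) = N := by
  ext j
  rw [mem_negPart, signVec]
  by_cases hA : j ∈ A
  · by_cases hN : j ∈ N <;> simp [hA, hN]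
  · have : j ∉ N := fun hN => hA (h hN)
    simp [hA, this]

theorem negPart_subset (t : Fin n → SignType) : negPart t ⊆ signSupp t := by
  intro j hj
  rw [mem_negPart] at hj
  simp [hj]

theorem negPart_update_zero (t : Fin n → SignType) (j : Fin n) :
    negPart (Function.update t j 0) = (negPart t).erase j := by
  ext l
  by_cases h : l = j
  · subst h; simp
  · simp [h]

/-- Möbius inversion on a Boolean lattice, in self-inverse form. -/
theorem sum_powerset_sum_powerset (N : Finset (Fin n)) (f : Finset (Fin n) → k) :
    ∑ F ∈ N.powerset, (-1 : k) ^ F.card * ∑ M ∈ F.powerset, (-1 : k) ^ M.card * f M = f N := by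
  induction N using Finset.induction_on generalizing f with
  | empty => simp
  | insert a N ha ih =>
    rw [Finset.sum_powerset_insert ha, ← Finset.sum_add_distrib]
    rw [← ih fun M => f (insert a M)]
    refine Finset.sum_congr rfl fun F hF => ?_
    have haF : a ∉ F := fun h => ha (Finset.mem_powerset.1 hF h)
    rw [Finset.sum_powerset_insert haF, Finset.card_insert_of_notMem haF]
    have : ∑ M ∈ F.powerset, (-1 : k) ^ (insert a M).card * f (insert a M) =
        -∑ M ∈ F.powerset, (-1 : k) ^ M.card * f (insert a M) := by
      rw [← Finset.sum_neg_distrib]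
      refine Finset.sum_congr rfl fun M hM => ?_
      rw [Finset.card_insert_of_notMem fun h => haF (Finset.mem_powerset.1 hM h)]
      ring
    rw [this]
    ring

/-- The function on sign vectors obtained from a family of functions `g F` on sets containing
`F`. -/
def signLift (g : Finset (Fin n) → Finset (Fin n) → k) (t : Fin n → SignType) : k :=
  ∑ F ∈ (negPart t).powerset, (-1) ^ F.card * g F (signSupp t)

theorem signD_signLift {g : Finset (Fin n) → Finset (Fin n) → k}
    (hg : ∀ F A, ¬ F ⊆ A → g F A = 0) (t : Fin n → SignType) :
    signD (signLift g) t = signLift (fun F => simplexD (g F)) t := by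
  have key : ∀ j ∈ signSupp t, signLift g (Function.update t j 0) =
      ∑ F ∈ (negPart t).powerset, (-1) ^ F.card * g F ((signSupp t).erase j) := by
    intro j _
    rw [signLift, negPart_update_zero, signSupp_update_zero]
    refine Finset.sum_subset (Finset.powerset_mono.2 (Finset.erase_subset _ _)) fun F hF hF' => ?_
    rw [hg F, mul_zero]
    intro h
    refine hF' (Finset.mem_powerset.2 fun x hx => ?_)
    exact Finset.mem_erase.2 ⟨(Finset.mem_erase.1 (h hx)).1, Finset.mem_powerset.1 hF hx⟩
  rw [signD, Finset.sum_congr rfl fun j hj => by rw [key j hj, Finset.mul_sum], Finset.sum_comm,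
    signLift]
  refine Finset.sum_congr rfl fun F _ => ?_
  rw [simplexD, Finset.mul_sum]
  exact Finset.sum_congr rfl fun j _ => by ring

theorem exists_signLift_eq (f : (Fin n → SignType) → k) :
    ∃ g : Finset (Fin n) → Finset (Fin n) → k, (∀ F A, ¬ F ⊆ A → g F A = 0) ∧ signLift g = f := by
  refine ⟨fun F A => if F ⊆ A then ∑ M ∈ F.powerset, (-1 : k) ^ M.card * f (signVec A M) else 0,
    fun F A h => if_neg h, ?_⟩
  funext t
  have := sum_powerset_sum_powerset (k := k) (negPart t) fun M => f (signVec (signSupp t) M)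
  rw [signVec_supp_neg] at this
  rw [← this, signLift]
  refine Finset.sum_congr rfl fun F hF => ?_
  rw [if_pos ((Finset.mem_powerset.1 hF).trans (negPart_subset t))]

theorem eq_of_signLift_eq {g h : Finset (Fin n) → Finset (Fin n) → k} {A : Finset (Fin n)}
    (hg : ∀ F, ¬ F ⊆ A → g F A = 0) (hh : ∀ F, ¬ F ⊆ A → h F A = 0)
    (heq : ∀ t, signSupp t = A → signLift g t = signLift h t) (F : Finset (Fin n)) :
    g F A = h F A := by
  induction F using Finset.strongInduction with
  | H F ih =>
    by_cases hF : F ⊆ A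
    · have h1 := heq (signVec A F) (signSupp_signVec A F)
      rw [signLift, signLift, negPart_signVec hF, signSupp_signVec,
        ← Finset.sum_erase_add _ _ (Finset.mem_powerset_self F),
        ← Finset.sum_erase_add _ _ (Finset.mem_powerset_self F)] at h1
      rw [Finset.sum_congr rfl (g := fun F' => (-1 : k) ^ F'.card * h F' A)] at h1
      · exact mul_left_cancel₀ (pow_ne_zero _ (neg_ne_zero.2 one_ne_zero)) (add_left_cancel h1)
      · intro F' hF'
        rw [Finset.mem_erase, Finset.mem_powerset] at hF'
        rw [ih F' (lt_of_le_of_ne hF'.2 hF'.1)]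
    · rw [hg F hF, hh F hF]

/-- The complex of functions on the sign vectors with support in `S` is the direct sum, over all
`F`, of the complexes of functions on the sets of `S` containing `F`. -/
theorem signExact_iff (S : Set (Finset (Fin n))) (i : ℕ) :
    SignExact k {t | signSupp t ∈ S} i ↔ ∀ F, SimplexExact k S F i := by
  constructor
  · intro hS F f hf hd
    obtain ⟨μ, hμ⟩ := hS (signLift fun F' => if F' = F then f else 0) fun t ht hc => by
      rw [signD_signLift (fun F' A h => by
        split_ifs with hFF
        · exact hf A (hFF ▸ h)
        · rfl)]
      refine Finset.sum_eq_zero fun F' _ => ?_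
      beta_reduce
      split_ifs with hFF
      · rw [hd _ ht hc, mul_zero]
      · simp [simplexD]
    obtain ⟨g, hg, rfl⟩ := exists_signLift_eq μ
    refine ⟨g F, hg F, fun A hA hc => ?_⟩
    have := eq_of_signLift_eq (g := fun F => simplexD (g F)) (A := A)
      (h := fun F' => if F' = F then f else 0)
      (fun F hF => simplexD_eq_zero_of_not_subset (hg F) hF)
      (fun F' h => by
        split_ifs with hFF
        · exact hf A (hFF ▸ h)
        · rfl)
      (fun t ht => by
        rw [← signD_signLift hg]
        exact hμ t (by simpa [ht] using hA) (by rw [ht, hc])) F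
    simpa using this
  · intro hS f hf
    obtain ⟨h, hh, rfl⟩ := exists_signLift_eq f
    have hd : ∀ F, ∀ A ∈ S, A.card = i + 1 → simplexD (h F) A = 0 := by
      intro F A hA hc
      refine eq_of_signLift_eq (g := fun F => simplexD (h F)) (A := A) (h := fun _ _ => 0)
        (fun F hF => simplexD_eq_zero_of_not_subset (hh F) hF) (fun _ _ => rfl) (fun t ht => ?_) F
      rw [← signD_signLift hh, hf t (by simpa [ht] using hA) (by rw [ht, hc])]
      simp [signLift]
    choose g hg hgd using fun F => hS F (h F) (hh F) (hd F)
    refine ⟨signLift g, fun t ht hc => ?_⟩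
    rw [signD_signLift hg]
    exact Finset.sum_congr rfl fun F _ => congrArg _ (hgd F _ ht hc)

end Combinatorics

/-! ### Ordered chains and their barycentric subdivision -/

section Tuples

variable {k : Type*} [Field k] {K K' L L' : Type*}

/-- Chains of ordered tuples with `m` entries; those with `m = 0` serve as an augmentation. -/
abbrev TupleChain (k : Type*) [Field k] (K : Type*) (m : ℕ) : Type _ := (Fin m → K) →₀ k

/-- The alternating sum of the faces of a tuple. -/
def tupleD (k : Type*) [Field k] (K : Type*) (m : ℕ) :
    TupleChain k K (m + 1) →ₗ[k] TupleChain k K m :=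
  Finsupp.linearCombination k fun w =>
    ∑ j : Fin (m + 1), Finsupp.single (w ∘ j.succAbove) ((-1 : k) ^ (j : ℕ))

theorem tupleD_single {m : ℕ} (w : Fin (m + 1) → K) :
    tupleD k K m (Finsupp.single w 1) =
      ∑ j : Fin (m + 1), Finsupp.single (w ∘ j.succAbove) ((-1 : k) ^ (j : ℕ)) := by
  simp [tupleD]

/-- The cone over a chain: a new first vertex is added to all tuples. -/
def tupleCone (k : Type*) [Field k] (b : K) (m : ℕ) :
    TupleChain k K m →ₗ[k] TupleChain k K (m + 1) :=
  Finsupp.lmapDomain k k fun w => (Fin.cons b w : Fin (m + 1) → K)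

/-- The chain map induced by a map. -/
def tupleMap (k : Type*) [Field k] (f : K → L) (m : ℕ) : TupleChain k K m →ₗ[k] TupleChain k L m :=
  Finsupp.lmapDomain k k fun w => f ∘ w

@[simp] theorem tupleCone_single (b : K) (m : ℕ) (w : Fin m → K) (a : k) :
    tupleCone k b m (Finsupp.single w a) = Finsupp.single (Fin.cons b w : Fin (m + 1) → K) a := by
  simp [tupleCone]

@[simp] theorem tupleMap_single (f : K → L) (m : ℕ) (w : Fin m → K) (a : k) :
    tupleMap k f m (Finsupp.single w a) = Finsupp.single (f ∘ w) a := by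
  simp [tupleMap]

theorem cons_comp_succ_succAbove {m : ℕ} (b : K) (w : Fin (m + 1) → K) (j : Fin (m + 1)) :
    (Fin.cons b w : Fin (m + 2) → K) ∘ j.succ.succAbove = Fin.cons b (w ∘ j.succAbove) := by
  funext i
  refine Fin.cases ?_ (fun i => ?_) i <;> simp

theorem tupleD_zero_tupleCone (b : K) (c : TupleChain k K 0) :
    tupleD k K 0 (tupleCone k b 0 c) = c := by
  induction c using Finsupp.induction_linear with
  | zero => simp
  | add c d hc hd => simp [hc, hd]
  | single w a =>
    rw [tupleCone_single, ← Finsupp.smul_single_one w a, ← Finsupp.smul_single_one _ a,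
      map_smul, tupleD_single]
    simp [Subsingleton.elim _ w]

theorem tupleD_tupleCone (b : K) (m : ℕ) (c : TupleChain k K (m + 1)) :
    tupleD k K (m + 1) (tupleCone k b (m + 1) c) = c - tupleCone k b m (tupleD k K m c) := by
  induction c using Finsupp.induction_linear with
  | zero => simp
  | add c d hc hd => simp only [map_add, hc, hd]; abel
  | single w a =>
    rw [tupleCone_single, ← Finsupp.smul_single_one w a, ← Finsupp.smul_single_one _ a,
      map_smul, map_smul, map_smul, ← smul_sub, tupleD_single, tupleD_single]
    rw [Fin.sum_univ_succ, map_sum, sub_eq_add_neg, ← Finset.sum_neg_distrib]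
    congr 2
    · simp only [Fin.val_zero, pow_zero]
      congr 1
    · refine Finset.sum_congr rfl fun j _ => ?_
      rw [cons_comp_succ_succAbove, tupleCone_single, ← Finsupp.single_neg, Fin.val_succ, pow_succ]
      simp

theorem tupleD_tupleMap (f : K → L) (m : ℕ) (c : TupleChain k K (m + 1)) :
    tupleD k L m (tupleMap k f (m + 1) c) = tupleMap k f m (tupleD k K m c) := by
  induction c using Finsupp.induction_linear with
  | zero => simp
  | add c d hc hd => simp only [map_add, hc, hd]
  | single w a =>
    rw [tupleMap_single, ← Finsupp.smul_single_one w a, ← Finsupp.smul_single_one _ a,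
      map_smul, map_smul, map_smul, tupleD_single, tupleD_single, map_sum]
    simp [Function.comp_assoc]

theorem tupleMap_tupleCone (f : K → L) (b : K) (m : ℕ) (c : TupleChain k K m) :
    tupleMap k f (m + 1) (tupleCone k b m c) = tupleCone k (f b) m (tupleMap k f m c) := by
  induction c using Finsupp.induction_linear with
  | zero => simp
  | add c d hc hd => simp only [map_add, hc, hd]
  | single w a =>
    rw [tupleMap_single, tupleCone_single, tupleCone_single, tupleMap_single]
    congr 1
    funext i
    refine Fin.cases ?_ (fun i => ?_) i <;> simp

theorem tupleMap_tupleMap (f : K → L) (g : L → L') (m : ℕ) (c : TupleChain k K m) :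
    tupleMap k g m (tupleMap k f m c) = tupleMap k (g ∘ f) m c := by
  induction c using Finsupp.induction_linear with
  | zero => simp
  | add c d hc hd => simp only [map_add, hc, hd]
  | single w a => simp [Function.comp_assoc]

theorem tupleMap_zero_eq (f g : K → L) (c : TupleChain k K 0) :
    tupleMap k f 0 c = tupleMap k g 0 c := by
  induction c using Finsupp.induction_linear with
  | zero => simp
  | add c d hc hd => simp only [map_add, hc, hd]
  | single w a => simp [Subsingleton.elim (f ∘ w) (g ∘ w)]

/-- Two linear maps on chains agree if they agree on tuples. -/
theorem tupleChain_induction {m : ℕ} {M : Type*} [AddCommGroup M] [Module k M]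
    (f g : TupleChain k K m →ₗ[k] M) (h : ∀ w, f (Finsupp.single w 1) = g (Finsupp.single w 1))
    (c : TupleChain k K m) : f c = g c := by
  have : f = g := Finsupp.lhom_ext' fun w => LinearMap.ext_ring (by simpa using h w)
  rw [this]

theorem single_eq_tupleCone {m : ℕ} (w : Fin (m + 1) → K) :
    (Finsupp.single w (1 : k)) = tupleCone k (w 0) m (Finsupp.single (Fin.tail w) 1) := by
  rw [tupleCone_single, Fin.cons_self_tail]

theorem tupleD_tupleD (m : ℕ) (c : TupleChain k K (m + 2)) :
    tupleD k K m (tupleD k K (m + 1) c) = 0 := by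
  induction m with
  | zero =>
    refine tupleChain_induction ((tupleD k K 0).comp (tupleD k K 1)) 0 (fun w => ?_) c
    simp only [LinearMap.comp_apply, LinearMap.zero_apply]
    rw [single_eq_tupleCone, tupleD_tupleCone, map_sub, tupleD_zero_tupleCone, sub_self]
  | succ m ih =>
    refine tupleChain_induction ((tupleD k K (m + 1)).comp (tupleD k K (m + 2))) 0 (fun w => ?_) c
    simp only [LinearMap.comp_apply, LinearMap.zero_apply]
    rw [single_eq_tupleCone, tupleD_tupleCone, map_sub, tupleD_tupleCone, ih, map_zero, sub_zero,
      sub_self]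

/-- The subdivision operator belonging to a choice `β` of centres of tuples. -/
def sd (k : Type*) [Field k] (β : ∀ m, (Fin (m + 1) → K) → K) :
    ∀ m, TupleChain k K m →ₗ[k] TupleChain k K m
  | 0 => LinearMap.id
  | m + 1 => Finsupp.linearCombination k fun w =>
      tupleCone k (β m w) m (sd k β m (tupleD k K m (Finsupp.single w 1)))

theorem sd_succ_single (β : ∀ m, (Fin (m + 1) → K) → K) (m : ℕ) (w : Fin (m + 1) → K) :
    sd k β (m + 1) (Finsupp.single w 1) =
      tupleCone k (β m w) m (sd k β m (tupleD k K m (Finsupp.single w 1))) := by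
  rw [sd, Finsupp.linearCombination_single, one_smul]

theorem tupleD_sd (β : ∀ m, (Fin (m + 1) → K) → K) (m : ℕ) (c : TupleChain k K (m + 1)) :
    tupleD k K m (sd k β (m + 1) c) = sd k β m (tupleD k K m c) := by
  induction m with
  | zero =>
    refine tupleChain_induction ((tupleD k K 0).comp (sd k β 1)) ((sd k β 0).comp (tupleD k K 0))
      (fun w => ?_) c
    simp only [LinearMap.comp_apply]
    rw [sd_succ_single, tupleD_zero_tupleCone]
  | succ m ih =>
    refine tupleChain_induction ((tupleD k K (m + 1)).comp (sd k β (m + 2)))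
      ((sd k β (m + 1)).comp (tupleD k K (m + 1))) (fun w => ?_) c
    simp only [LinearMap.comp_apply]
    rw [sd_succ_single, tupleD_tupleCone, ih, tupleD_tupleD, map_zero, map_zero, sub_zero]

theorem tupleD_sd_pow (β : ∀ m, (Fin (m + 1) → K) → K) (N m : ℕ) (c : TupleChain k K (m + 1)) :
    tupleD k K m ((sd k β (m + 1) ^ N) c) = (sd k β m ^ N) (tupleD k K m c) := by
  induction N generalizing c with
  | zero => rfl
  | succ N ih => rw [pow_succ, pow_succ, Module.End.mul_apply, Module.End.mul_apply, ih, tupleD_sd]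

theorem tupleMap_sd {β : ∀ m, (Fin (m + 1) → K) → K} {β' : ∀ m, (Fin (m + 1) → L) → L} {f : K → L}
    (hf : ∀ m w, f (β m w) = β' m (f ∘ w)) (m : ℕ) (c : TupleChain k K m) :
    tupleMap k f m (sd k β m c) = sd k β' m (tupleMap k f m c) := by
  induction m with
  | zero => rfl
  | succ m ih =>
    refine tupleChain_induction ((tupleMap k f (m + 1)).comp (sd k β (m + 1)))
      ((sd k β' (m + 1)).comp (tupleMap k f (m + 1))) (fun w => ?_) c
    simp only [LinearMap.comp_apply]
    rw [sd_succ_single, tupleMap_single, sd_succ_single, tupleMap_tupleCone, ih, hf,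
      ← tupleD_tupleMap, tupleMap_single]

theorem tupleMap_sd_pow {β : ∀ m, (Fin (m + 1) → K) → K} {β' : ∀ m, (Fin (m + 1) → L) → L}
    {f : K → L} (hf : ∀ m w, f (β m w) = β' m (f ∘ w)) (N m : ℕ) (c : TupleChain k K m) :
    tupleMap k f m ((sd k β m ^ N) c) = (sd k β' m ^ N) (tupleMap k f m c) := by
  induction N generalizing c with
  | zero => rfl
  | succ N ih =>
    rw [pow_succ, pow_succ, Module.End.mul_apply, Module.End.mul_apply, ih, tupleMap_sd hf]

/-- A chain homotopy between the chain map induced by `i₀` and the `N`-fold subdivision followed by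
the chain map induced by `i₁`. -/
def sdHomotopy (k : Type*) [Field k] (β : ∀ m, (Fin (m + 1) → K) → K) (i₀ i₁ : K → K') (N : ℕ) :
    ∀ m, TupleChain k K m →ₗ[k] TupleChain k K' (m + 1)
  | 0 => 0
  | m + 1 => Finsupp.linearCombination k fun w => tupleCone k (i₀ (w 0)) (m + 1)
      (tupleMap k i₀ (m + 1) (Finsupp.single w 1) -
        tupleMap k i₁ (m + 1) ((sd k β (m + 1) ^ N) (Finsupp.single w 1)) -
        sdHomotopy k β i₀ i₁ N m (tupleD k K m (Finsupp.single w 1)))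

theorem sdHomotopy_succ_single (β : ∀ m, (Fin (m + 1) → K) → K) (i₀ i₁ : K → K') (N m : ℕ)
    (w : Fin (m + 1) → K) : sdHomotopy k β i₀ i₁ N (m + 1) (Finsupp.single w 1) =
      tupleCone k (i₀ (w 0)) (m + 1)
      (tupleMap k i₀ (m + 1) (Finsupp.single w 1) -
        tupleMap k i₁ (m + 1) ((sd k β (m + 1) ^ N) (Finsupp.single w 1)) -
        sdHomotopy k β i₀ i₁ N m (tupleD k K m (Finsupp.single w 1))) := by
  rw [sdHomotopy, Finsupp.linearCombination_single, one_smul]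

theorem tupleD_sdHomotopy (β : ∀ m, (Fin (m + 1) → K) → K) (i₀ i₁ : K → K') (N m : ℕ)
    (c : TupleChain k K (m + 1)) :
    tupleD k K' (m + 1) (sdHomotopy k β i₀ i₁ N (m + 1) c) +
      sdHomotopy k β i₀ i₁ N m (tupleD k K m c) =
    tupleMap k i₀ (m + 1) c - tupleMap k i₁ (m + 1) ((sd k β (m + 1) ^ N) c) := by
  induction m with
  | zero =>
    refine tupleChain_induction ((tupleD k K' 1).comp (sdHomotopy k β i₀ i₁ N 1) +
      (sdHomotopy k β i₀ i₁ N 0).comp (tupleD k K 0)) (tupleMap k i₀ 1 -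
      (tupleMap k i₁ 1).comp (sd k β 1 ^ N)) (fun w => ?_) c
    simp only [LinearMap.comp_apply, LinearMap.add_apply, LinearMap.sub_apply]
    have h1 : (sd k β 0 ^ N) = LinearMap.id := one_pow N
    rw [sdHomotopy_succ_single, tupleD_tupleCone, map_sub (tupleD k K' 0),
      map_sub (tupleD k K' 0), tupleD_tupleMap, tupleD_tupleMap, tupleD_sd_pow,
      tupleMap_zero_eq i₁ i₀, h1]
    simp [sdHomotopy]
  | succ m ih =>
    refine tupleChain_induction ((tupleD k K' (m + 2)).comp (sdHomotopy k β i₀ i₁ N (m + 2)) +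
      (sdHomotopy k β i₀ i₁ N (m + 1)).comp (tupleD k K (m + 1))) (tupleMap k i₀ (m + 2) -
      (tupleMap k i₁ (m + 2)).comp (sd k β (m + 2) ^ N)) (fun w => ?_) c
    simp only [LinearMap.comp_apply, LinearMap.add_apply, LinearMap.sub_apply]
    have h := ih (tupleD k K (m + 1) (Finsupp.single w 1))
    rw [tupleD_tupleD, map_zero, add_zero] at h
    rw [sdHomotopy_succ_single, tupleD_tupleCone, map_sub (tupleD k K' (m + 1)),
      map_sub (tupleD k K' (m + 1)), tupleD_tupleMap, tupleD_tupleMap, tupleD_sd_pow, h, sub_self,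
      map_zero, sub_zero, sub_add_cancel]

theorem tupleMap_sdHomotopy {β : ∀ m, (Fin (m + 1) → K) → K} {β' : ∀ m, (Fin (m + 1) → L) → L}
    {i₀ i₁ : K → K'} {j₀ j₁ : L → L'} {f : K → L} {f' : K' → L'}
    (hf : ∀ m w, f (β m w) = β' m (f ∘ w)) (h₀ : f' ∘ i₀ = j₀ ∘ f) (h₁ : f' ∘ i₁ = j₁ ∘ f) (N m : ℕ)
    (c : TupleChain k K m) :
    tupleMap k f' (m + 1) (sdHomotopy k β i₀ i₁ N m c) =
      sdHomotopy k β' j₀ j₁ N m (tupleMap k f m c) := by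
  induction m with
  | zero => simp [sdHomotopy]
  | succ m ih =>
    refine tupleChain_induction ((tupleMap k f' (m + 2)).comp (sdHomotopy k β i₀ i₁ N (m + 1)))
      ((sdHomotopy k β' j₀ j₁ N (m + 1)).comp (tupleMap k f (m + 1))) (fun w => ?_) c
    simp only [LinearMap.comp_apply]
    rw [sdHomotopy_succ_single, tupleMap_single f, sdHomotopy_succ_single, tupleMap_tupleCone,
      map_sub (tupleMap k f' (m + 1)), map_sub (tupleMap k f' (m + 1)), ih, tupleMap_tupleMap,
      tupleMap_tupleMap, h₀, h₁, ← tupleMap_tupleMap,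
      ← tupleMap_tupleMap, tupleMap_sd_pow hf, ← tupleD_tupleMap, tupleMap_single]
    have : f' (i₀ (w 0)) = j₀ ((f ∘ w) 0) := congrFun h₀ (w 0)
    rw [this]

theorem tupleCone_mem_supported {m : ℕ} {S : Set (Fin m → K)} {T : Set (Fin (m + 1) → K)} {b : K}
    {c : TupleChain k K m} (hc : c ∈ Finsupp.supported k k S)
    (h : ∀ w ∈ S, (Fin.cons b w : Fin (m + 1) → K) ∈ T) :
    tupleCone k b m c ∈ Finsupp.supported k k T := by
  rw [Finsupp.mem_supported] at hc ⊢
  intro w hw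
  classical
  obtain ⟨v, hv, rfl⟩ := Finset.mem_image.1 (Finsupp.mapDomain_support hw)
  exact h v (hc hv)

end Tuples

section Mesh

variable {k : Type*} [Field k] {W : Type*} [NormedAddCommGroup W] [NormedSpace ℝ W] {s : Set W}

/-- The barycentre of a tuple of points of a convex set. -/
def bary (hs : Convex ℝ s) (m : ℕ) (w : Fin (m + 1) → s) : s :=
  ⟨∑ i, ((m : ℝ) + 1)⁻¹ • (w i : W), hs.sum_mem (fun _ _ => by positivity)
    (by simp [mul_inv_cancel₀ (Nat.cast_add_one_ne_zero (R := ℝ) m)]) fun i _ => (w i).2⟩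

theorem bary_mem_convexHull (hs : Convex ℝ s) (m : ℕ) (w : Fin (m + 1) → s) :
    (bary hs m w : W) ∈ convexHull ℝ (Set.range fun i => (w i : W)) :=
  (convex_convexHull ℝ (Set.range fun i => (w i : W))).sum_mem (t := Finset.univ)
    (w := fun _ => ((m : ℝ) + 1)⁻¹) (z := fun i => (w i : W)) (fun _ _ => by positivity)
    (by simp [mul_inv_cancel₀ (Nat.cast_add_one_ne_zero (R := ℝ) m)])
    fun i _ => subset_convexHull ℝ _ ⟨i, rfl⟩

theorem norm_bary_sub_le (hs : Convex ℝ s) (m : ℕ) (w : Fin (m + 1) → s) {D : ℝ}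
    (hD : ∀ i j, ‖(w i : W) - w j‖ ≤ D) {x : W}
    (hx : x ∈ convexHull ℝ (Set.range fun i => (w i : W))) :
    ‖(bary hs m w : W) - x‖ ≤ m / (m + 1) * D := by
  have key : convexHull ℝ (Set.range fun i => (w i : W)) ⊆
      Metric.closedBall (bary hs m w : W) (m / (m + 1) * D) := by
    refine convexHull_min ?_ (convex_closedBall _ _)
    rintro _ ⟨i, rfl⟩
    rw [Metric.mem_closedBall, dist_comm, dist_eq_norm]
    have h1 : (bary hs m w : W) - w i = ∑ j, ((m : ℝ) + 1)⁻¹ • ((w j : W) - w i) := by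
      simp only [smul_sub, Finset.sum_sub_distrib, bary]
      congr 1
      rw [← Finset.sum_smul, Finset.sum_const, Finset.card_univ, Fintype.card_fin, nsmul_eq_mul]
      push_cast
      rw [mul_inv_cancel₀ (by positivity), one_smul]
    rw [h1, ← Finset.sum_erase_add _ _ (Finset.mem_univ i), sub_self, smul_zero, add_zero]
    refine (norm_sum_le _ _).trans ((Finset.sum_le_card_nsmul _ _ (((m : ℝ) + 1)⁻¹ * D)
      fun j _ => ?_).trans ?_)
    · rw [norm_smul, Real.norm_of_nonneg (by positivity)]
      exact mul_le_mul_of_nonneg_left (hD j i) (by positivity)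
    · rw [Finset.card_erase_of_mem (Finset.mem_univ i), Finset.card_univ, Fintype.card_fin,
        Nat.add_sub_cancel, nsmul_eq_mul]
      apply le_of_eq
      field_simp
  have := key hx
  rwa [Metric.mem_closedBall, dist_comm, dist_eq_norm] at this

/-- The tuples in the subdivision of a tuple of diameter `D` with `m` entries have diameter at most
`m / (m + 1) * D`. -/
theorem sd_bary_mem_supported (hs : Convex ℝ s) (m : ℕ) (w : Fin m → s) {D : ℝ} (hD0 : 0 ≤ D)
    (hD : ∀ i j, ‖(w i : W) - w j‖ ≤ D) :
    sd k (bary hs) m (Finsupp.single w 1) ∈ Finsupp.supported k k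
      {v | (∀ i, (v i : W) ∈ convexHull ℝ (Set.range fun i => (w i : W))) ∧
        ∀ i j, ‖(v i : W) - v j‖ ≤ m / (m + 1) * D} := by
  induction m with
  | zero => exact Finsupp.single_mem_supported k _ ⟨fun i => i.elim0, fun i => i.elim0⟩
  | succ m ih =>
    rw [sd_succ_single]
    refine tupleCone_mem_supported (k := k) (S := {v : Fin m → s |
      (∀ i, (v i : W) ∈ convexHull ℝ (Set.range fun i => (w i : W))) ∧
        ∀ i j, ‖(v i : W) - v j‖ ≤ m / (m + 1) * D}) ?_ ?_
    · rw [tupleD_single, map_sum]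
      refine Submodule.sum_mem _ fun j _ => ?_
      rw [← Finsupp.smul_single_one, map_smul]
      refine Submodule.smul_mem _ _ ?_
      refine Finsupp.supported_mono ?_ (ih (w ∘ j.succAbove) fun _ _ => hD _ _)
      rintro v ⟨hv1, hv2⟩
      refine ⟨fun i => convexHull_mono ?_ (hv1 i), hv2⟩
      rintro _ ⟨l, rfl⟩
      exact ⟨_, rfl⟩
    · rintro v ⟨hv1, hv2⟩
      have hle : (m : ℝ) / (m + 1) * D ≤ (m + 1 : ℕ) / ((m + 1 : ℕ) + 1) * D := by
        refine mul_le_mul_of_nonneg_right ?_ hD0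
        push_cast
        rw [div_le_div_iff₀ (by positivity) (by positivity)]
        nlinarith
      have h0 : 0 ≤ ((m + 1 : ℕ) : ℝ) / ((m + 1 : ℕ) + 1) * D := by positivity
      refine ⟨fun i => ?_, fun i j => ?_⟩
      · refine Fin.cases ?_ (fun i => ?_) i
        · simpa using bary_mem_convexHull hs m w
        · simpa using hv1 i
      · refine Fin.cases ?_ (fun i => ?_) i <;> refine Fin.cases ?_ (fun j => ?_) j
        · simpa using h0
        · simpa using (norm_bary_sub_le hs m w hD (hv1 j)).trans hle
        · rw [norm_sub_rev]
          simpa using (norm_bary_sub_le hs m w hD (hv1 i)).trans hle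
        · simpa using (hv2 i j).trans hle

theorem sd_pow_mem_supported (hs : Convex ℝ s) (m : ℕ) (w : Fin m → s) {D : ℝ} (hD0 : 0 ≤ D)
    (hD : ∀ i j, ‖(w i : W) - w j‖ ≤ D) (N : ℕ) :
    (sd k (bary hs) m ^ N) (Finsupp.single w 1) ∈ Finsupp.supported k k
      {v | ∀ i j, ‖(v i : W) - v j‖ ≤ (m / (m + 1)) ^ N * D} := by
  induction N with
  | zero => exact Finsupp.single_mem_supported k _ (by simpa using hD)
  | succ N ih =>
    rw [pow_succ' (sd k (bary hs) m), Module.End.mul_apply]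
    set c := (sd k (bary hs) m ^ N) (Finsupp.single w 1)
    rw [← Finsupp.sum_single c, Finsupp.sum, map_sum]
    refine Submodule.sum_mem _ fun v hv => ?_
    rw [← Finsupp.smul_single_one, map_smul]
    refine Submodule.smul_mem _ _ (Finsupp.supported_mono ?_
      (sd_bary_mem_supported hs m v (D := (m / (m + 1)) ^ N * D) (by positivity)
        (((Finsupp.mem_supported _ _).1 ih) hv)))
    rintro u ⟨-, hu⟩ i j
    rw [pow_succ', mul_assoc]
    exact hu i j

end Mesh

/-! ### Singular chains of a normed space -/

section Affine

variable {W W' : Type*} [NormedAddCommGroup W] [NormedSpace ℝ W] [NormedAddCommGroup W']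
  [NormedSpace ℝ W'] {s : Set W} {s' : Set W'}

/-- The affine simplex with given vertices in a convex set. -/
def aff (hs : Convex ℝ s) {m : ℕ} (w : Fin m → s) : C(stdSimplex ℝ (Fin m), s) where
  toFun x := ⟨∑ i, x i • (w i : W), hs.sum_mem (fun i _ => x.2.1 i) x.2.2 fun i _ => (w i).2⟩
  continuous_toFun := by
    refine Continuous.subtype_mk (continuous_finsetSum _ fun i _ => ?_) _
    exact ((continuous_apply i).comp continuous_subtype_val).smul continuous_const

theorem coe_aff (hs : Convex ℝ s) {m : ℕ} (w : Fin m → s) (x : stdSimplex ℝ (Fin m)) :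
    (aff hs w x : W) = ∑ i, x i • (w i : W) := rfl

/-- The inclusion of the `j`-th facet into the standard simplex with `m + 1` vertices. -/
def facet (m : ℕ) (j : Fin (m + 1)) : C(stdSimplex ℝ (Fin m), stdSimplex ℝ (Fin (m + 1))) :=
  ⟨stdSimplex.map j.succAbove, stdSimplex.continuous_map _⟩

theorem sum_facet_smul {m : ℕ} (j : Fin (m + 1)) (x : stdSimplex ℝ (Fin m)) (w : Fin (m + 1) → W) :
    ∑ i, (facet m j x) i • w i = ∑ l, x l • w (j.succAbove l) := by
  rw [Fin.sum_univ_succAbove _ j]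
  have h1 : (facet m j x) j = 0 := by
    change FunOnFinite.linearMap ℝ ℝ j.succAbove x j = 0
    rw [FunOnFinite.linearMap_apply_apply]
    refine Finset.sum_eq_zero fun l hl => ?_
    exact absurd (Finset.mem_filter.1 hl).2 (Fin.succAbove_ne j l)
  have h2 : ∀ l, (facet m j x) (j.succAbove l) = x l := fun l => by
    change FunOnFinite.linearMap ℝ ℝ j.succAbove x (j.succAbove l) = x l
    rw [FunOnFinite.linearMap_apply_apply]
    rw [Finset.sum_eq_single l]
    · intro b hb hbl
      exact absurd (Fin.succAbove_right_injective (Finset.mem_filter.1 hb).2) hbl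
    · simp
  rw [h1, zero_smul, zero_add]
  exact Finset.sum_congr rfl fun l _ => by rw [h2]

theorem aff_comp_facet (hs : Convex ℝ s) {m : ℕ} (w : Fin (m + 1) → s) (j : Fin (m + 1)) :
    (aff hs w).comp (facet m j) = aff hs (w ∘ j.succAbove) := by
  ext x
  exact sum_facet_smul j x fun i => (w i : W)

/-- The vertices of the standard simplex. -/
def vert (m : ℕ) (i : Fin m) : stdSimplex ℝ (Fin m) := stdSimplex.vertex i

theorem coe_vert (m : ℕ) (i : Fin m) : (vert m i).1 = Pi.single i 1 := rfl

theorem aff_vert (m : ℕ) : aff (convex_stdSimplex ℝ (Fin m)) (vert m) = ContinuousMap.id _ := by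
  refine ContinuousMap.ext fun x => Subtype.ext ?_
  rw [coe_aff]
  funext i
  simp only [coe_vert, Finset.sum_apply, Pi.smul_apply, Pi.single_apply, smul_eq_mul]
  simp only [mul_ite, mul_one, mul_zero, Finset.sum_ite_eq, Finset.mem_univ, if_true]
  rfl

theorem vert_comp_succAbove {m : ℕ} (j : Fin (m + 1)) :
    vert (m + 1) ∘ j.succAbove = facet m j ∘ vert m := by
  funext i
  exact (stdSimplex.map_vertex j.succAbove i).symm

/-- A map between convex sets that respects affine combinations. -/
def IsAff (f : s → s') : Prop :=
  ∀ (m : ℕ) (a : Fin m → ℝ) (w : Fin m → s) (y : s), ∑ i, a i = 1 →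
    (y : W) = ∑ i, a i • (w i : W) → (f y : W') = ∑ i, a i • (f (w i) : W')

theorem IsAff.map_aff {f : C(s, s')} (hf : IsAff f) (hs : Convex ℝ s) (hs' : Convex ℝ s') {m : ℕ}
    (w : Fin m → s) : f.comp (aff hs w) = aff hs' (f ∘ w) :=
  ContinuousMap.ext fun x => Subtype.ext (hf m x w (aff hs w x) x.2.2 rfl)

theorem IsAff.map_bary {f : s → s'} (hf : IsAff f) (hs : Convex ℝ s) (hs' : Convex ℝ s') (m : ℕ)
    (w : Fin (m + 1) → s) : f (bary hs m w) = bary hs' m (f ∘ w) :=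
  Subtype.ext (hf (m + 1) _ w _
    (by simp [mul_inv_cancel₀ (Nat.cast_add_one_ne_zero (R := ℝ) m)]) rfl)

theorem isAff_facet {m : ℕ} (j : Fin (m + 1)) : IsAff (facet m j) := by
  intro q a w y _ hy
  have h : ∀ x : stdSimplex ℝ (Fin m),
      (facet m j x).1 = FunOnFinite.linearMap ℝ ℝ j.succAbove x.1 :=
    fun _ => rfl
  rw [h, hy, map_sum]
  exact Finset.sum_congr rfl fun i _ => by rw [h, map_smul]

/-- The cylinder over the standard simplex. -/
def cyl (m : ℕ) : Set ((Fin m → ℝ) × ℝ) := stdSimplex ℝ (Fin m) ×ˢ Set.Icc 0 1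

theorem convex_cyl (m : ℕ) : Convex ℝ (cyl m) :=
  (convex_stdSimplex ℝ (Fin m)).prod (convex_Icc 0 1)

/-- The inclusion of the standard simplex at height `t` of the cylinder. -/
def cylIncl (m : ℕ) (t : unitInterval) : C(stdSimplex ℝ (Fin m), cyl m) where
  toFun x := ⟨(x, t), x.2, t.2⟩
  continuous_toFun := Continuous.subtype_mk (by fun_prop) _

theorem isAff_cylIncl (m : ℕ) (t : unitInterval) : IsAff (cylIncl m t) := by
  intro q a w y ha hy
  refine Prod.ext ?_ ?_
  · rw [Prod.fst_sum]
    exact hy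
  · simp [cylIncl, Prod.snd_sum, ← Finset.sum_mul, ha]

/-- The inclusion of the cylinder over a facet. -/
def cylFacet (m : ℕ) (j : Fin (m + 1)) : C(cyl m, cyl (m + 1)) where
  toFun z := ⟨(facet m j ⟨z.1.1, z.2.1⟩, z.1.2), (facet m j ⟨z.1.1, z.2.1⟩).2, z.2.2⟩
  continuous_toFun := by
    refine Continuous.subtype_mk (Continuous.prodMk ?_ (by fun_prop)) _
    exact continuous_subtype_val.comp ((facet m j).continuous.comp
      (Continuous.subtype_mk (by fun_prop) _))

theorem isAff_cylFacet (m : ℕ) (j : Fin (m + 1)) : IsAff (cylFacet m j) := by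
  intro q a w y ha hy
  refine Prod.ext ?_ ?_
  · have := isAff_facet j q a (fun i => ⟨(w i).1.1, (w i).2.1⟩) ⟨y.1.1, y.2.1⟩ ha (by
      simpa [Prod.fst_sum] using congrArg Prod.fst hy)
    rw [Prod.fst_sum]
    exact this
  · simpa [cylFacet, Prod.snd_sum] using congrArg Prod.snd hy

end Affine

section SingularChains

variable {k : Type*} [Field k] {E : Type*} [NormedAddCommGroup E]
  {W W' : Type*} [NormedAddCommGroup W] [NormedSpace ℝ W] [NormedAddCommGroup W']
  [NormedSpace ℝ W'] {s : Set W} {s' : Set W'}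

/-- Singular simplices with `m` vertices, that is, of dimension `m - 1`; the one with `m = 0`
is the empty simplex and serves as an augmentation. -/
abbrev Simp (E : Type*) [NormedAddCommGroup E] (m : ℕ) : Type _ := C(stdSimplex ℝ (Fin m), E)

/-- Singular chains. -/
abbrev SingChain (k : Type*) [Field k] (E : Type*) [NormedAddCommGroup E] (m : ℕ) : Type _ :=
  Simp E m →₀ k

/-- The boundary map of singular chains. -/
def singBd (k : Type*) [Field k] (E : Type*) [NormedAddCommGroup E] (m : ℕ) :
    SingChain k E (m + 1) →ₗ[k] SingChain k E m :=
  Finsupp.linearCombination k fun σ =>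
    ∑ j : Fin (m + 1), Finsupp.single (σ.comp (facet m j)) ((-1 : k) ^ (j : ℕ))

theorem singBd_single {m : ℕ} (σ : Simp E (m + 1)) :
    singBd k E m (Finsupp.single σ 1) =
      ∑ j : Fin (m + 1), Finsupp.single (σ.comp (facet m j)) ((-1 : k) ^ (j : ℕ)) := by
  simp [singBd]

/-- The singular chain realizing a chain of tuples of points of a convex set `s` along a map
from `s`. -/
def realize (k : Type*) [Field k] (hs : Convex ℝ s) (g : C(s, E)) (m : ℕ) :
    TupleChain k s m →ₗ[k] SingChain k E m :=
  Finsupp.lmapDomain k k fun w => g.comp (aff hs w)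

@[simp] theorem realize_single (hs : Convex ℝ s) (g : C(s, E)) (m : ℕ) (w : Fin m → s) (a : k) :
    realize k hs g m (Finsupp.single w a) = Finsupp.single (g.comp (aff hs w)) a := by
  simp [realize]

theorem singBd_realize (hs : Convex ℝ s) (g : C(s, E)) (m : ℕ) (c : TupleChain k s (m + 1)) :
    singBd k E m (realize k hs g (m + 1) c) = realize k hs g m (tupleD k s m c) := by
  refine tupleChain_induction ((singBd k E m).comp (realize k hs g (m + 1)))
    ((realize k hs g m).comp (tupleD k s m)) (fun w => ?_) c
  simp only [LinearMap.comp_apply]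
  rw [realize_single, singBd_single, tupleD_single, map_sum]
  refine Finset.sum_congr rfl fun j _ => ?_
  rw [realize_single, ContinuousMap.comp_assoc, aff_comp_facet]

theorem realize_tupleMap (hs : Convex ℝ s) (hs' : Convex ℝ s') {f : C(s, s')} (hf : IsAff f)
    (g : C(s', E)) (m : ℕ) (c : TupleChain k s m) :
    realize k hs' g m (tupleMap k f m c) = realize k hs (g.comp f) m c := by
  refine tupleChain_induction ((realize k hs' g m).comp (tupleMap k f m))
    (realize k hs (g.comp f) m) (fun w => ?_) c
  simp only [LinearMap.comp_apply]
  rw [tupleMap_single, realize_single, realize_single, ContinuousMap.comp_assoc,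
    hf.map_aff hs hs']

theorem realize_vert {m : ℕ} (σ : Simp E m) :
    realize k (convex_stdSimplex ℝ (Fin m)) σ m (Finsupp.single (vert m) 1) =
      Finsupp.single σ 1 := by
  rw [realize_single, aff_vert, ContinuousMap.comp_id]

theorem singChain_induction {m : ℕ} {M : Type*} [AddCommGroup M] [Module k M]
    (f g : SingChain k E m →ₗ[k] M) (h : ∀ w, f (Finsupp.single w 1) = g (Finsupp.single w 1))
    (c : SingChain k E m) : f c = g c := by
  have : f = g := Finsupp.lhom_ext' fun w => LinearMap.ext_ring (by simpa using h w)
  rw [this]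

theorem singBd_singBd (m : ℕ) (c : SingChain k E (m + 2)) :
    singBd k E m (singBd k E (m + 1) c) = 0 := by
  refine singChain_induction ((singBd k E m).comp (singBd k E (m + 1))) 0 (fun σ => ?_) c
  simp only [LinearMap.comp_apply, LinearMap.zero_apply]
  rw [← realize_vert, singBd_realize, singBd_realize, tupleD_tupleD, map_zero]

/-- The operator `r_* ∘ Sd^N` on singular chains. -/
def pushSd (k : Type*) [Field k] (r : C(E, E)) (N m : ℕ) : SingChain k E m →ₗ[k] SingChain k E m :=
  Finsupp.linearCombination k fun σ => realize k (convex_stdSimplex ℝ (Fin m)) (r.comp σ) m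
    ((sd k (bary (convex_stdSimplex ℝ (Fin m))) m ^ N) (Finsupp.single (vert m) 1))

theorem pushSd_single (r : C(E, E)) (N m : ℕ) (σ : Simp E m) :
    pushSd k r N m (Finsupp.single σ 1) = realize k (convex_stdSimplex ℝ (Fin m)) (r.comp σ) m
    ((sd k (bary (convex_stdSimplex ℝ (Fin m))) m ^ N) (Finsupp.single (vert m) 1)) := by
  simp [pushSd]

/-- The chains whose simplices have their range in a family of sets. -/
def chainsIn (k : Type*) [Field k] (𝒜 : Set (Set E)) (m : ℕ) : Submodule k (SingChain k E m) :=
  Finsupp.supported k k {σ | Set.range σ ∈ 𝒜}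

theorem range_comp_facet_subset {m : ℕ} (σ : Simp E (m + 1)) (j : Fin (m + 1)) :
    Set.range (σ.comp (facet m j)) ⊆ Set.range σ := by
  rintro _ ⟨x, rfl⟩
  exact ⟨_, rfl⟩

theorem supported_induction {X : Type*} {S : Set X} {M : Type*} [AddCommGroup M]
    [Module k M] (f : (X →₀ k) →ₗ[k] M) {T : Submodule k M}
    (h : ∀ x ∈ S, f (Finsupp.single x 1) ∈ T) {c : X →₀ k}
    (hc : c ∈ Finsupp.supported k k S) : f c ∈ T := by
  rw [← Finsupp.sum_single c, Finsupp.sum, map_sum]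
  refine Submodule.sum_mem _ fun x hx => ?_
  rw [← Finsupp.smul_single_one, map_smul]
  exact Submodule.smul_mem _ _ (h x (((Finsupp.mem_supported _ _).1 hc) hx))

theorem singBd_mem_chainsIn {𝒜 : Set (Set E)} (h𝒜 : IsLowerSet 𝒜) {m : ℕ}
    {c : SingChain k E (m + 1)} (hc : c ∈ chainsIn k 𝒜 (m + 1)) :
    singBd k E m c ∈ chainsIn k 𝒜 m := by
  refine supported_induction _ (fun σ hσ => ?_) hc
  rw [singBd_single]
  refine Submodule.sum_mem _ fun j _ => Finsupp.single_mem_supported _ _ ?_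
  exact h𝒜 (range_comp_facet_subset σ j) hσ

theorem norm_vert_sub_le (m : ℕ) (i j : Fin m) :
    ‖(vert m i).1 - (vert m j).1‖ ≤ 1 := by
  refine (pi_norm_le_iff_of_nonneg zero_le_one).2 fun l => ?_
  have h1 := mem_Icc_of_mem_stdSimplex (vert m i).2 l
  have h2 := mem_Icc_of_mem_stdSimplex (vert m j).2 l
  rw [Pi.sub_apply, Real.norm_eq_abs, abs_le]
  constructor <;> linarith [h1.1, h1.2, h2.1, h2.2]

theorem dist_aff_le (hs : Convex ℝ s) {m : ℕ} (w : Fin m → s) {D : ℝ}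
    (hD : ∀ i j, ‖(w i : W) - w j‖ ≤ D) (x y : stdSimplex ℝ (Fin m)) :
    dist (aff hs w x) (aff hs w y) ≤ D := by
  have hmem : ∀ x, (aff hs w x : W) ∈ convexHull ℝ (Set.range fun i => (w i : W)) := fun x =>
    (convex_convexHull ℝ _).sum_mem (fun i _ => x.2.1 i) x.2.2
      fun i _ => subset_convexHull ℝ _ ⟨i, rfl⟩
  have h1 : ∀ i, convexHull ℝ (Set.range fun i => (w i : W)) ⊆ Metric.closedBall (w i : W) D :=
    fun i => convexHull_min (by
      rintro _ ⟨j, rfl⟩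
      rw [Metric.mem_closedBall, dist_eq_norm]
      exact hD j i) (convex_closedBall _ _)
  have h2 : convexHull ℝ (Set.range fun i => (w i : W)) ⊆ Metric.closedBall (aff hs w x : W) D :=
    convexHull_min (by
      rintro _ ⟨i, rfl⟩
      rw [Metric.mem_closedBall, dist_comm]
      exact h1 i (hmem x)) (convex_closedBall _ _)
  have := h2 (hmem y)
  rwa [Metric.mem_closedBall, dist_comm] at this

/-- After sufficiently many subdivisions, all simplices are small. -/
theorem exists_pushSd_single_small (r : C(E, E)) {m : ℕ} (σ : Simp E m) {ε : ℝ} (hε : 0 < ε) :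
    ∃ N₀, ∀ N ≥ N₀, pushSd k r N m (Finsupp.single σ 1) ∈ Finsupp.supported k k
      {τ | ∃ ρ : Simp E m, τ = r.comp ρ ∧ Set.range ρ ⊆ Set.range σ ∧
        ∀ x y, dist (ρ x) (ρ y) < ε} := by
  obtain ⟨δ, hδ, hσ⟩ := Metric.uniformContinuous_iff.1
    (CompactSpace.uniformContinuous_of_continuous σ.continuous) ε hε
  have hlt : (m : ℝ) / (m + 1) < 1 := by
    rw [div_lt_one (by positivity)]; linarith
  obtain ⟨N₀, hN₀⟩ := exists_pow_lt_of_lt_one hδ hlt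
  refine ⟨N₀, fun N hN => ?_⟩
  rw [pushSd_single]
  refine supported_induction _ (fun w hw => ?_) (sd_pow_mem_supported
    (convex_stdSimplex ℝ (Fin m)) m (vert m) zero_le_one (norm_vert_sub_le m) N)
  rw [realize_single]
  refine Finsupp.single_mem_supported _ _ ⟨σ.comp (aff _ w), by rw [ContinuousMap.comp_assoc],
    ?_, fun x y => ?_⟩
  · rintro _ ⟨x, rfl⟩
    exact ⟨_, rfl⟩
  · refine hσ ((dist_aff_le _ w hw x y).trans_lt ?_)
    rw [mul_one]
    exact (pow_le_pow_of_le_one (by positivity) hlt.le hN).trans_lt hN₀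

/-- A family `ℬ` of sets is a deformation retract of a family `𝒜`, in the sense of homology, if
cycles of `𝒜` relative to `ℬ` bound. -/
def AcyclicPair (k : Type*) [Field k] (𝒜 ℬ : Set (Set E)) : Prop :=
  ∀ (m : ℕ), ∀ c ∈ chainsIn k 𝒜 (m + 1), singBd k E m c ∈ chainsIn k ℬ m →
    ∃ e ∈ chainsIn k 𝒜 (m + 2), c - singBd k E (m + 1) e ∈ chainsIn k ℬ (m + 1)

variable [NormedSpace ℝ E]

/-- The straight-line homotopy from a singular simplex to its image under `r`. -/
def track (r : C(E, E)) {m : ℕ} (σ : Simp E m) : C(cyl m, E) where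
  toFun z := (1 - z.1.2) • σ ⟨z.1.1, z.2.1⟩ + z.1.2 • r (σ ⟨z.1.1, z.2.1⟩)
  continuous_toFun := by
    have h : Continuous fun z : cyl m => σ ⟨z.1.1, z.2.1⟩ :=
      σ.continuous.comp (Continuous.subtype_mk (by fun_prop) _)
    have h2 := r.continuous.comp h
    exact ((continuous_const.sub (by fun_prop)).smul h).add
      (Continuous.smul (by fun_prop) h2)

/-- The chain homotopy between the identity and `r_* ∘ Sd^N`. -/
def pushHomotopy (k : Type*) [Field k] (r : C(E, E)) (N m : ℕ) :
    SingChain k E m →ₗ[k] SingChain k E (m + 1) :=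
  Finsupp.linearCombination k fun σ => realize k (convex_cyl m) (track r σ) (m + 1)
    (sdHomotopy k (bary (convex_stdSimplex ℝ (Fin m))) (cylIncl m 0) (cylIncl m 1) N m
      (Finsupp.single (vert m) 1))

theorem pushHomotopy_single (r : C(E, E)) (N m : ℕ) (σ : Simp E m) :
    pushHomotopy k r N m (Finsupp.single σ 1) = realize k (convex_cyl m) (track r σ) (m + 1)
    (sdHomotopy k (bary (convex_stdSimplex ℝ (Fin m))) (cylIncl m 0) (cylIncl m 1) N m
      (Finsupp.single (vert m) 1)) := by
  simp [pushHomotopy]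

theorem singBd_pushHomotopy (r : C(E, E)) (N m : ℕ) (c : SingChain k E (m + 1)) :
    singBd k E (m + 1) (pushHomotopy k r N (m + 1) c) + pushHomotopy k r N m (singBd k E m c) =
      c - pushSd k r N (m + 1) c := by
  refine singChain_induction ((singBd k E (m + 1)).comp (pushHomotopy k r N (m + 1)) +
    (pushHomotopy k r N m).comp (singBd k E m)) (LinearMap.id - pushSd k r N (m + 1))
    (fun σ => ?_) c
  simp only [LinearMap.comp_apply, LinearMap.add_apply, LinearMap.sub_apply, LinearMap.id_apply]
  have key : ∀ j : Fin (m + 1), pushHomotopy k r N m (Finsupp.single (σ.comp (facet m j)) 1) =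
      realize k (convex_cyl (m + 1)) (track r σ) (m + 1)
        (sdHomotopy k (bary (convex_stdSimplex ℝ (Fin (m + 1)))) (cylIncl (m + 1) 0)
          (cylIncl (m + 1) 1) N m (Finsupp.single (vert (m + 1) ∘ j.succAbove) 1)) := by
    intro j
    rw [pushHomotopy_single, vert_comp_succAbove, ← tupleMap_single, ← tupleMap_sdHomotopy
      (β := bary (convex_stdSimplex ℝ (Fin m))) (i₀ := cylIncl m 0) (i₁ := cylIncl m 1)
      (f' := cylFacet m j)
      (fun q w => (isAff_facet j).map_bary _ _ q w) rfl rfl,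
      realize_tupleMap (convex_cyl m) (convex_cyl (m + 1)) (isAff_cylFacet m j)]
    rfl
  have h0 : (track r σ).comp (cylIncl (m + 1) 0) = σ := by
    refine ContinuousMap.ext fun x => ?_
    change (1 - (0 : ℝ)) • σ x + (0 : ℝ) • r (σ x) = σ x
    simp
  have h1 : (track r σ).comp (cylIncl (m + 1) 1) = r.comp σ := by
    refine ContinuousMap.ext fun x => ?_
    change (1 - (1 : ℝ)) • σ x + (1 : ℝ) • r (σ x) = r (σ x)
    simp
  have h2 : pushHomotopy k r N m (singBd k E m (Finsupp.single σ 1)) =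
      realize k (convex_cyl (m + 1)) (track r σ) (m + 1)
        (sdHomotopy k (bary (convex_stdSimplex ℝ (Fin (m + 1)))) (cylIncl (m + 1) 0)
          (cylIncl (m + 1) 1) N m (tupleD k _ m (Finsupp.single (vert (m + 1)) 1))) := by
    rw [singBd_single, tupleD_single, map_sum, map_sum, map_sum]
    refine Finset.sum_congr rfl fun j _ => ?_
    rw [← Finsupp.smul_single_one, map_smul, key, ← Finsupp.smul_single_one _ ((-1 : k) ^ (j : ℕ)),
      map_smul, map_smul]
  rw [h2, pushHomotopy_single, singBd_realize, ← map_add, tupleD_sdHomotopy, map_sub,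
    realize_tupleMap (convex_stdSimplex ℝ _) _ (isAff_cylIncl _ _),
    realize_tupleMap (convex_stdSimplex ℝ _) _ (isAff_cylIncl _ _), h0, h1,
    realize_vert, pushSd_single]

/-- The set swept out by `R` under the straight-line homotopy to `r`. -/
def sweep (r : C(E, E)) (R : Set E) : Set E :=
  {z | ∃ y ∈ R, ∃ t ∈ Set.Icc (0 : ℝ) 1, (1 - t) • y + t • r y = z}

theorem pushHomotopy_mem_chainsIn {𝒜 : Set (Set E)} (h𝒜 : IsLowerSet 𝒜) {r : C(E, E)}
    (hr : ∀ R ∈ 𝒜, sweep r R ∈ 𝒜) {N m : ℕ} {c : SingChain k E m} (hc : c ∈ chainsIn k 𝒜 m) :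
    pushHomotopy k r N m c ∈ chainsIn k 𝒜 (m + 1) := by
  refine supported_induction _ (fun σ hσ => ?_) hc
  rw [pushHomotopy_single]
  refine supported_induction (S := Set.univ) _ (fun w _ => ?_) (by simp)
  rw [realize_single]
  refine Finsupp.single_mem_supported _ _ (h𝒜 ?_ (hr _ hσ))
  rintro _ ⟨x, rfl⟩
  exact ⟨_, ⟨_, rfl⟩, _, (aff (convex_cyl m) w x).2.2, rfl⟩

/-- If the straight-line homotopy to `r` preserves two families of sets, and `r` maps all
sufficiently small subsets of compact sets of the large family into the small family, then the pair
is acyclic. -/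
theorem acyclicPair_of_push {𝒜 ℬ : Set (Set E)} (h𝒜 : IsLowerSet 𝒜) (hℬ : IsLowerSet ℬ)
    (r : C(E, E)) (hr𝒜 : ∀ R ∈ 𝒜, sweep r R ∈ 𝒜) (hrℬ : ∀ R ∈ ℬ, sweep r R ∈ ℬ)
    (hsmall : ∀ R ∈ 𝒜, IsCompact R → ∃ ε > 0, ∀ R' ⊆ R, (∀ x ∈ R', ∀ y ∈ R', dist x y < ε) →
      r '' R' ∈ ℬ) : AcyclicPair k 𝒜 ℬ := by
  intro m c hc hbc
  have h1 : ∀ σ : Simp E (m + 1), Set.range σ ∈ 𝒜 → ∃ N₀, ∀ N ≥ N₀,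
      pushSd k r N (m + 1) (Finsupp.single σ 1) ∈ chainsIn k ℬ (m + 1) := by
    intro σ hσ
    obtain ⟨ε, hε, h⟩ := hsmall _ hσ (isCompact_range σ.continuous)
    obtain ⟨N₀, hN₀⟩ := exists_pushSd_single_small (k := k) r σ hε
    refine ⟨N₀, fun N hN => Finsupp.supported_mono ?_ (hN₀ N hN)⟩
    rintro _ ⟨ρ, rfl, hρ, hd⟩
    have := h _ hρ (by rintro _ ⟨x, rfl⟩ _ ⟨y, rfl⟩; exact hd x y)
    rwa [← Set.range_comp] at this
  choose! N₀ hN₀ using h1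
  set N := c.support.sup N₀
  refine ⟨pushHomotopy k r N (m + 1) c, pushHomotopy_mem_chainsIn h𝒜 hr𝒜 hc, ?_⟩
  have h2 : c - singBd k E (m + 1) (pushHomotopy k r N (m + 1) c) =
      pushSd k r N (m + 1) c + pushHomotopy k r N m (singBd k E m c) := by
    rw [sub_eq_iff_eq_add, add_assoc, add_comm (pushHomotopy k r N m _), singBd_pushHomotopy]
    abel
  rw [h2]
  refine Submodule.add_mem _ ?_ (pushHomotopy_mem_chainsIn hℬ hrℬ hbc)
  refine supported_induction (S := (c.support : Set _)) _ (fun σ hσ => ?_)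
    ((Finsupp.mem_supported _ _).2 le_rfl)
  exact hN₀ σ (((Finsupp.mem_supported _ _).1 hc) hσ) N (Finset.le_sup (f := N₀) hσ)

end SingularChains

/-! ### Singular cochains and duality -/

section Cochains

variable {k : Type*} [Field k] {E : Type*} [NormedAddCommGroup E]

/-- The coboundary of a singular cochain. -/
def cobd {m : ℕ} (φ : Simp E m → k) (σ : Simp E (m + 1)) : k :=
  ∑ j : Fin (m + 1), (-1 : k) ^ (j : ℕ) * φ (σ.comp (facet m j))

theorem linearCombination_singBd {m : ℕ} (φ : Simp E m → k) (c : SingChain k E (m + 1)) :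
    Finsupp.linearCombination k φ (singBd k E m c) = Finsupp.linearCombination k (cobd φ) c := by
  refine singChain_induction ((Finsupp.linearCombination k φ).comp (singBd k E m))
    (Finsupp.linearCombination k (cobd φ)) (fun σ => ?_) c
  simp only [LinearMap.comp_apply]
  rw [singBd_single, map_sum, Finsupp.linearCombination_single, one_smul]
  exact Finset.sum_congr rfl fun j _ => Finsupp.linearCombination_single _ _ _

theorem cobd_cobd {m : ℕ} (φ : Simp E m → k) (σ : Simp E (m + 2)) : cobd (cobd φ) σ = 0 := by
  have h : cobd (cobd φ) σ = Finsupp.linearCombination k (cobd (cobd φ)) (Finsupp.single σ 1) := by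
    rw [Finsupp.linearCombination_single, one_smul]
  rw [h, ← linearCombination_singBd, ← linearCombination_singBd, singBd_singBd, map_zero]

theorem cobd_add {m : ℕ} (φ ψ : Simp E m → k) (σ : Simp E (m + 1)) :
    cobd (φ + ψ) σ = cobd φ σ + cobd ψ σ := by
  simp [cobd, mul_add, Finset.sum_add_distrib]

theorem cobd_sub {m : ℕ} (φ ψ : Simp E m → k) (σ : Simp E (m + 1)) :
    cobd (φ - ψ) σ = cobd φ σ - cobd ψ σ := by
  simp [cobd, mul_sub, Finset.sum_sub_distrib]

theorem cobd_zero {m : ℕ} (σ : Simp E (m + 1)) : cobd (0 : Simp E m → k) σ = 0 := by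
  simp [cobd]

theorem cobd_congr {𝒜 : Set (Set E)} (h𝒜 : IsLowerSet 𝒜) {m : ℕ} {φ ψ : Simp E m → k}
    (h : ∀ σ : Simp E m, Set.range σ ∈ 𝒜 → φ σ = ψ σ) {σ : Simp E (m + 1)} (hσ : Set.range σ ∈ 𝒜) :
    cobd φ σ = cobd ψ σ :=
  Finset.sum_congr rfl fun j _ => by rw [h _ (h𝒜 (range_comp_facet_subset σ j) hσ)]

theorem cobd_eq_zero {𝒜 : Set (Set E)} (h𝒜 : IsLowerSet 𝒜) {m : ℕ} {φ : Simp E m → k}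
    (h : ∀ σ : Simp E m, Set.range σ ∈ 𝒜 → φ σ = 0) {σ : Simp E (m + 1)} (hσ : Set.range σ ∈ 𝒜) :
    cobd φ σ = 0 := by
  rw [cobd_congr (ψ := 0) h𝒜 h hσ, cobd_zero]

theorem exists_dual_factor {V₁ V₂ : Type*} [AddCommGroup V₁] [Module k V₁] [AddCommGroup V₂]
    [Module k V₂] (g : V₁ →ₗ[k] V₂) (f : V₁ →ₗ[k] k) (h : ∀ x, g x = 0 → f x = 0) :
    ∃ ψ : V₂ →ₗ[k] k, ∀ x, ψ (g x) = f x := by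
  have hf : f ∈ (LinearMap.ker g).dualAnnihilator :=
    (Submodule.mem_dualAnnihilator f).2 fun x hx => h x hx
  rw [← LinearMap.range_dualMap_eq_dualAnnihilator_ker] at hf
  obtain ⟨ψ, hψ⟩ := hf
  exact ⟨ψ, fun x => LinearMap.congr_fun hψ x⟩

/-- Over a field, acyclicity of a pair in homology implies acyclicity in cohomology: a cochain that
vanishes on relative cycles factors through the boundary map. -/
theorem AcyclicPair.exists_cobd_eq {𝒜 ℬ : Set (Set E)} (h : AcyclicPair k 𝒜 ℬ) {m : ℕ}
    {φ : Simp E (m + 1) → k} (hφ : ∀ σ : Simp E (m + 1), Set.range σ ∈ ℬ → φ σ = 0)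
    (hd : ∀ σ : Simp E (m + 2), Set.range σ ∈ 𝒜 → cobd φ σ = 0) :
    ∃ ψ : Simp E m → k, (∀ σ : Simp E m, Set.range σ ∈ ℬ → ψ σ = 0) ∧
      ∀ σ : Simp E (m + 1), Set.range σ ∈ 𝒜 → cobd ψ σ = φ σ := by
  have hzero : ∀ {q : ℕ} {χ : Simp E q → k} {𝒞 : Set (Set E)},
      (∀ σ : Simp E q, Set.range σ ∈ 𝒞 → χ σ = 0) → ∀ c ∈ chainsIn k 𝒞 q,
        Finsupp.linearCombination k χ c = 0 := by
    intro q χ 𝒞 hχ c hc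
    refine (Submodule.mem_bot k).1 (supported_induction _ (fun σ hσ => ?_) hc)
    rw [Finsupp.linearCombination_single, one_smul, hχ σ hσ]
    exact Submodule.zero_mem _
  let g : chainsIn k 𝒜 (m + 1) →ₗ[k] SingChain k E m ⧸ chainsIn k ℬ m :=
    (chainsIn k ℬ m).mkQ ∘ₗ singBd k E m ∘ₗ (chainsIn k 𝒜 (m + 1)).subtype
  let f : chainsIn k 𝒜 (m + 1) →ₗ[k] k :=
    Finsupp.linearCombination k φ ∘ₗ (chainsIn k 𝒜 (m + 1)).subtype
  have hgf : ∀ x, g x = 0 → f x = 0 := by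
    rintro ⟨c, hc⟩ hg
    obtain ⟨e, he, hce⟩ := h m c hc ((Submodule.Quotient.mk_eq_zero _).1 hg)
    have h1 : Finsupp.linearCombination k φ (c - singBd k E (m + 1) e) = 0 := hzero hφ _ hce
    have h2 : Finsupp.linearCombination k φ (singBd k E (m + 1) e) = 0 := by
      rw [linearCombination_singBd]
      exact hzero hd _ he
    rw [map_sub, h2, sub_zero] at h1
    exact h1
  obtain ⟨ψ, hψ⟩ := exists_dual_factor (k := k) (V₁ := chainsIn k 𝒜 (m + 1))
    (V₂ := SingChain k E m ⧸ chainsIn k ℬ m) g f hgf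
  refine ⟨fun σ => ψ ((chainsIn k ℬ m).mkQ (Finsupp.single σ 1)), fun σ hσ => ?_, fun σ hσ => ?_⟩
  · have : (chainsIn k ℬ m).mkQ (Finsupp.single σ 1) = 0 :=
      (Submodule.Quotient.mk_eq_zero _).2 (Finsupp.single_mem_supported _ _ hσ)
    change ψ ((chainsIn k ℬ m).mkQ (Finsupp.single σ 1)) = 0
    rw [this, map_zero]
  · have h1 := hψ ⟨Finsupp.single σ 1, Finsupp.single_mem_supported _ _ hσ⟩
    simp only [g, f, LinearMap.comp_apply, Submodule.subtype_apply] at h1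
    rw [Finsupp.linearCombination_single, one_smul] at h1
    rw [← h1, singBd_single, map_sum, map_sum]
    refine Finset.sum_congr rfl fun j _ => ?_
    rw [← Finsupp.smul_single_one _ ((-1 : k) ^ (j : ℕ)), map_smul, map_smul, smul_eq_mul]

end Cochains

/-! ### Local structure of subspace arrangements -/

section Local

variable {n : ℕ}

/-- The closed orthant with apex `p` and signs `t`, of dimension the number of nonzero signs. -/
def orthant (p : Fin n → ℝ) (t : Fin n → SignType) : Set (Fin n → ℝ) :=
  {y | ∀ j, |y j - p j| = (t j : ℝ) * (y j - p j)}

theorem apex_mem_orthant (p : Fin n → ℝ) (t : Fin n → SignType) : p ∈ orthant p t := by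
  intro j; simp

theorem signType_abs_eq_iff {t : SignType} {a : ℝ} :
    |a| = (t : ℝ) * a ↔ a = 0 ∨ SignType.sign a = t := by
  rcases lt_trichotomy a 0 with h | h | h
  · rw [sign_neg h, abs_of_neg h]
    cases t <;> simp [h.ne]
    linarith
  · simp [h]
  · rw [sign_pos h, abs_of_pos h]
    cases t <;> simp [h.ne']
    linarith

theorem convex_orthant (p : Fin n → ℝ) (t : Fin n → SignType) : Convex ℝ (orthant p t) := by
  intro x hx y hy a b ha hb hab j
  have h1 := hx j
  have h2 := hy j
  have h3 : (a • x + b • y) j - p j = a * (x j - p j) + b * (y j - p j) := by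
    simp only [Pi.add_apply, Pi.smul_apply, smul_eq_mul]
    linear_combination (p j) * hab
  rw [h3]
  refine le_antisymm ?_ ?_
  · refine (abs_add_le _ _).trans ?_
    rw [abs_mul, abs_mul, abs_of_nonneg ha, abs_of_nonneg hb, h1, h2]
    exact le_of_eq (by ring)
  · refine (le_abs_self _).trans ?_
    rw [abs_mul]
    refine mul_le_of_le_one_left (abs_nonneg _) ?_
    cases t j <;> simp

/-- `z` arises from `y` by shrinking all coordinates towards those of `p`. -/
def Shrinks (p y z : Fin n → ℝ) : Prop :=
  ∀ j, ∃ a ∈ Set.Icc (0 : ℝ) 1, z j - p j = a * (y j - p j)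

theorem Shrinks.mem_orthant {p y z : Fin n → ℝ} (h : Shrinks p y z) {t : Fin n → SignType}
    (hy : y ∈ orthant p t) : z ∈ orthant p t := by
  intro j
  obtain ⟨a, ha, haz⟩ := h j
  rw [haz, abs_mul, abs_of_nonneg ha.1, hy j]
  ring

theorem Shrinks.mem_ball {p y z : Fin n → ℝ} (h : Shrinks p y z) {δ : ℝ}
    (hy : y ∈ Metric.ball p δ) : z ∈ Metric.ball p δ := by
  rw [Metric.mem_ball] at hy ⊢
  refine lt_of_le_of_lt ((dist_pi_le_iff dist_nonneg).2 fun j => ?_) hy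
  obtain ⟨a, ha, haz⟩ := h j
  refine le_trans ?_ (dist_le_pi_dist y p j)
  rw [Real.dist_eq, Real.dist_eq, haz, abs_mul, abs_of_nonneg ha.1]
  exact mul_le_of_le_one_left (abs_nonneg _) ha.2

/-- Soft thresholding: the real number `a` is moved towards zero by the amount `c`. -/
def softThreshold (c a : ℝ) : ℝ := max (a - c) 0 + min (a + c) 0

theorem softThreshold_of_abs_le {a c : ℝ} (h : |a| ≤ c) : softThreshold c a = 0 := by
  rw [abs_le] at h
  rw [softThreshold, max_eq_right (by linarith), min_eq_right (by linarith), add_zero]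

theorem softThreshold_of_lt {a c : ℝ} (hc : 0 ≤ c) (h : c < |a|) :
    softThreshold c a = (1 - c / |a|) * a := by
  rcases lt_or_ge a 0 with ha | ha
  · rw [abs_of_neg ha] at h ⊢
    rw [softThreshold, max_eq_right (by linarith), min_eq_left (by linarith)]
    have : a ≠ 0 := ha.ne
    field_simp
    ring
  · rw [abs_of_nonneg ha] at h ⊢
    rw [softThreshold, max_eq_left (by linarith), min_eq_right (by linarith)]
    have : a ≠ 0 := by rintro rfl; linarith
    field_simp
    ring

theorem exists_softThreshold_eq {a c : ℝ} (hc : 0 ≤ c) :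
    ∃ b ∈ Set.Icc (0 : ℝ) 1, softThreshold c a = b * a := by
  by_cases h : |a| ≤ c
  · exact ⟨0, by simp, by rw [softThreshold_of_abs_le h, zero_mul]⟩
  · have h' := not_le.1 h
    refine ⟨_, ⟨?_, ?_⟩, softThreshold_of_lt hc h'⟩
    · rw [sub_nonneg, div_le_one (hc.trans_lt h')]
      exact h'.le
    · rw [sub_le_self_iff]
      positivity

/-- The rounding map: coordinates (relative to `p`) are thresholded by half of the norm. It fixes
`p`, moves no other point to `p`, and kills the coordinates that are small compared with the
norm. -/
def rounding (p : Fin n → ℝ) : C(Fin n → ℝ, Fin n → ℝ) where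
  toFun y j := p j + softThreshold (‖y - p‖ / 2) (y j - p j)
  continuous_toFun := by
    refine continuous_pi fun j => continuous_const.add ?_
    unfold softThreshold
    fun_prop

theorem rounding_apply_sub (p y : Fin n → ℝ) (j : Fin n) :
    rounding p y j - p j = softThreshold (‖y - p‖ / 2) (y j - p j) :=
  add_sub_cancel_left _ _

theorem shrinks_homotopy {p y z : Fin n → ℝ} (h : Shrinks p y z) {t : ℝ}
    (ht : t ∈ Set.Icc (0 : ℝ) 1) : Shrinks p y ((1 - t) • y + t • z) := by
  intro j
  obtain ⟨b, hb, hbz⟩ := h j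
  refine ⟨1 - t + t * b, ⟨?_, ?_⟩, ?_⟩
  · nlinarith [ht.1, ht.2, hb.1, hb.2]
  · nlinarith [ht.1, ht.2, hb.1, hb.2]
  · simp only [Pi.add_apply, Pi.smul_apply, smul_eq_mul]
    linear_combination t * hbz

theorem shrinks_rounding (p y : Fin n → ℝ) : Shrinks p y (rounding p y) := by
  intro j
  rw [rounding_apply_sub]
  exact exists_softThreshold_eq (by positivity)

theorem rounding_homotopy_ne {p y : Fin n → ℝ} (hy : y ≠ p) {t : ℝ} (ht : t ∈ Set.Icc (0 : ℝ) 1) :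
    (1 - t) • y + t • rounding p y ≠ p := by
  intro h
  have hpos : 0 < ‖y - p‖ := norm_pos_iff.2 (sub_ne_zero.2 hy)
  have : Nonempty (Fin n) := by
    by_contra hne
    rw [not_nonempty_iff] at hne
    exact hy (Subsingleton.elim _ _)
  obtain ⟨j, hj⟩ := Finite.exists_max fun j => ‖(y - p) j‖
  have hj' : ‖y - p‖ = |y j - p j| :=
    le_antisymm ((pi_norm_le_iff_of_nonneg (norm_nonneg _)).2 hj) (norm_le_pi_norm (y - p) j)
  have h1 := congrFun h j
  have h2 := rounding_apply_sub p y j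
  rw [hj', softThreshold_of_lt (by positivity) (by rw [hj'] at hpos; linarith)] at h2
  rw [hj'] at hpos
  have h3 : |y j - p j| / 2 / |y j - p j| = 1 / 2 := by field_simp
  rw [h3] at h2
  simp only [Pi.add_apply, Pi.smul_apply, smul_eq_mul] at h1
  have h4 : (1 - t / 2) * (y j - p j) = 0 := by linear_combination h1 - t * h2
  rcases mul_eq_zero.1 h4 with h5 | h5
  · linarith [ht.2]
  · rw [h5] at hpos
    simp at hpos

/-- The family of the subsets of the orthants with signs in `Γ`, intersected with a ball around the
apex `p`. -/
def orthantFam (p : Fin n → ℝ) (δ : ℝ) (Γ : Set (Fin n → SignType)) : Set (Set (Fin n → ℝ)) :=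
  {R | ∃ t ∈ Γ, R ⊆ orthant p t ∩ Metric.ball p δ}

/-- The sets of a family that do not contain `p`. -/
def awayFrom (p : Fin n → ℝ) (𝒜 : Set (Set (Fin n → ℝ))) : Set (Set (Fin n → ℝ)) :=
  {R ∈ 𝒜 | p ∉ R}

theorem isLowerSet_orthantFam (p : Fin n → ℝ) (δ : ℝ) (Γ : Set (Fin n → SignType)) :
    IsLowerSet (orthantFam p δ Γ) := by
  rintro R R' h ⟨t, ht, hR⟩
  exact ⟨t, ht, h.trans hR⟩

theorem isLowerSet_awayFrom (p : Fin n → ℝ) {𝒜 : Set (Set (Fin n → ℝ))} (h𝒜 : IsLowerSet 𝒜) :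
    IsLowerSet (awayFrom p 𝒜) := by
  rintro R R' h ⟨hR, hp⟩
  exact ⟨h𝒜 h hR, fun hp' => hp (h hp')⟩

theorem isLowerSet_powerset (V : Set (Fin n → ℝ)) : IsLowerSet (𝒫 V) :=
  fun _ _ h hR => h.trans hR

/-- The set `V` agrees near `p`, in the ball of radius `δ`, with the union of the coordinate
subspaces `p + ℝ^A`, for `A` in the simplicial complex `S`. -/
structure LocalModel (V : Set (Fin n → ℝ)) (p : Fin n → ℝ) (δ : ℝ) (S : Set (Finset (Fin n))) :
    Prop where
  pos : 0 < δ
  mem_iff : ∀ q ∈ Metric.ball p δ, q ∈ V ↔ ∃ A ∈ S, ∀ j, j ∉ A → q j = p j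
  lower : IsLowerSet S
  nonempty : S.Nonempty

namespace LocalModel

variable {V : Set (Fin n → ℝ)} {p : Fin n → ℝ} {δ : ℝ} {S : Set (Finset (Fin n))}

theorem shrinks_mem (h : LocalModel V p δ S) {y z : Fin n → ℝ} (hyz : Shrinks p y z)
    (hy : y ∈ V ∩ Metric.ball p δ) : z ∈ V ∩ Metric.ball p δ := by
  have hz := hyz.mem_ball hy.2
  refine ⟨(h.mem_iff z hz).2 ?_, hz⟩
  obtain ⟨A, hA, hAy⟩ := (h.mem_iff y hy.2).1 hy.1
  refine ⟨A, hA, fun j hj => ?_⟩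
  obtain ⟨a, -, ha⟩ := hyz j
  rw [hAy j hj, sub_self, mul_zero] at ha
  exact sub_eq_zero.1 ha

theorem sign_mem (h : LocalModel V p δ S) {y : Fin n → ℝ} (hy : y ∈ V ∩ Metric.ball p δ) :
    signSupp (fun j => SignType.sign (y j - p j)) ∈ S := by
  obtain ⟨A, hA, hAy⟩ := (h.mem_iff y hy.2).1 hy.1
  refine h.lower (fun j hj => ?_) hA
  by_contra hjA
  rw [mem_signSupp, hAy j hjA, sub_self, sign_zero] at hj
  exact hj rfl

theorem orthant_subset (h : LocalModel V p δ S) {t : Fin n → SignType} (ht : signSupp t ∈ S) :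
    orthant p t ∩ Metric.ball p δ ⊆ V := by
  rintro y ⟨hy, hyB⟩
  refine (h.mem_iff y hyB).2 ⟨_, ht, fun j hj => ?_⟩
  rw [mem_signSupp, not_not] at hj
  have := hy j
  rw [hj, SignType.coe_zero, zero_mul, abs_eq_zero] at this
  exact sub_eq_zero.1 this

theorem signs_nonempty (h : LocalModel V p δ S) :
    {t : Fin n → SignType | signSupp t ∈ S}.Nonempty := by
  obtain ⟨A, hA⟩ := h.nonempty
  exact ⟨0, h.lower (fun j hj => by simp at hj) hA⟩

theorem empty_mem_orthantFam {Γ : Set (Fin n → SignType)} (hΓ : Γ.Nonempty) :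
    ∅ ∈ orthantFam p δ Γ := by
  obtain ⟨t, ht⟩ := hΓ
  exact ⟨t, ht, Set.empty_subset _⟩

variable (k : Type*) [Field k]

/-- Excision. -/
theorem acyclicPair_ball (h : LocalModel V p δ S) :
    AcyclicPair k (𝒫 V) (awayFrom p (𝒫 V) ∪ 𝒫 (V ∩ Metric.ball p δ)) := by
  have hsw : ∀ R : Set (Fin n → ℝ), sweep (ContinuousMap.id _) R ⊆ R := by
    rintro R _ ⟨y, hy, t, -, rfl⟩
    rwa [ContinuousMap.id_apply, ← add_smul, sub_add_cancel, one_smul]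
  have hlow := (isLowerSet_awayFrom p (isLowerSet_powerset V)).union
    (isLowerSet_powerset (V ∩ Metric.ball p δ))
  refine acyclicPair_of_push (isLowerSet_powerset V) hlow (ContinuousMap.id _)
    (fun R hR => (hsw R).trans hR) (fun R hR => hlow (hsw R) hR) fun R hR _ =>
    ⟨δ, h.pos, fun R' hR' hd => ?_⟩
  rw [ContinuousMap.coe_id, Set.image_id]
  by_cases hp : p ∈ R'
  · exact Or.inr fun y hy => ⟨hR (hR' hy), hd y hy p hp⟩
  · exact Or.inl ⟨hR'.trans hR, hp⟩

/-- Away from `p`, small simplices can be deformed into orthants by the rounding map. -/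
theorem acyclicPair_away (h : LocalModel V p δ S) :
    AcyclicPair k (awayFrom p (𝒫 (V ∩ Metric.ball p δ)))
      (awayFrom p (orthantFam p δ {t | signSupp t ∈ S})) := by
  have haway : ∀ R : Set (Fin n → ℝ), p ∉ R → p ∉ sweep (rounding p) R := by
    rintro R hp ⟨y, hy, t, ht, htp⟩
    exact rounding_homotopy_ne (by rintro rfl; exact hp hy) ht htp
  refine acyclicPair_of_push (isLowerSet_awayFrom p (isLowerSet_powerset _))
    (isLowerSet_awayFrom p (isLowerSet_orthantFam _ _ _)) (rounding p) ?_ ?_ ?_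
  · rintro R ⟨hR, hp⟩
    refine ⟨?_, haway R hp⟩
    rintro _ ⟨y, hy, t, ht, rfl⟩
    exact h.shrinks_mem (shrinks_homotopy (shrinks_rounding p y) ht) (hR hy)
  · rintro R ⟨⟨s, hs, hR⟩, hp⟩
    refine ⟨⟨s, hs, ?_⟩, haway R hp⟩
    rintro _ ⟨y, hy, t, ht, rfl⟩
    have := shrinks_homotopy (shrinks_rounding p y) ht
    exact ⟨this.mem_orthant (hR hy).1, this.mem_ball (hR hy).2⟩
  · rintro R ⟨hR, hp⟩ hc
    obtain ⟨μ, hμ, hμR⟩ : ∃ μ > 0, ∀ y ∈ R, μ ≤ ‖y - p‖ := by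
      rcases R.eq_empty_or_nonempty with rfl | hne
      · exact ⟨1, one_pos, by simp⟩
      · obtain ⟨y, hy, hmin⟩ := hc.exists_isMinOn hne
          (f := fun y => ‖y - p‖) (by fun_prop)
        exact ⟨‖y - p‖, norm_pos_iff.2 (sub_ne_zero.2 fun h' => hp (h' ▸ hy)), hmin⟩
    refine ⟨μ / 2, by positivity, fun R' hR' hd => ?_⟩
    rcases R'.eq_empty_or_nonempty with rfl | ⟨x, hx⟩
    · rw [Set.image_empty]
      exact ⟨empty_mem_orthantFam h.signs_nonempty, Set.notMem_empty p⟩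
    refine ⟨⟨fun j => SignType.sign (x j - p j), h.sign_mem (hR (hR' hx)), ?_⟩, ?_⟩
    · rintro _ ⟨y, hy, rfl⟩
      refine ⟨fun j => ?_, (shrinks_rounding p y).mem_ball (hR (hR' hy)).2⟩
      rw [rounding_apply_sub]
      by_cases hj : |y j - p j| ≤ ‖y - p‖ / 2
      · rw [softThreshold_of_abs_le hj]; simp
      · have hj' := not_le.1 hj
        have hpos : 0 < |y j - p j| := lt_of_le_of_lt (by positivity) hj'
        rw [softThreshold_of_lt (by positivity) hj', abs_mul, abs_of_nonneg
          (sub_nonneg.2 ((div_le_one hpos).2 hj'.le)), mul_left_comm]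
        congr 1
        rw [signType_abs_eq_iff]
        right
        have h1 : |x j - y j| < |y j - p j| := by
          have := (dist_le_pi_dist x y j).trans_lt (hd x hx y hy)
          rw [Real.dist_eq] at this
          linarith [hμR y (hR' hy)]
        rw [abs_lt] at h1
        rcases lt_or_ge (y j - p j) 0 with h2 | h2
        · rw [abs_of_neg h2] at h1
          rw [sign_neg h2]
          exact (sign_neg (by linarith [h1.2])).symm
        · rw [abs_of_nonneg h2] at h1 hpos
          rw [sign_pos hpos]
          exact (sign_pos (by linarith [h1.1])).symm
    · rintro ⟨y, hy, hyp⟩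
      have := rounding_homotopy_ne (p := p) (y := y) (t := 1)
        (by rintro rfl; exact hp (hR' hy)) (by simp)
      rw [sub_self, zero_smul, zero_add, one_smul] at this
      exact this hyp

/-- Both the ball in `V` and the union of the orthants contract to `p`. -/
theorem acyclicPair_orthants (h : LocalModel V p δ S) :
    AcyclicPair k (𝒫 (V ∩ Metric.ball p δ)) (orthantFam p δ {t | signSupp t ∈ S}) := by
  have hsh : ∀ y, Shrinks p y p := fun y j => ⟨0, by simp, by simp⟩
  refine acyclicPair_of_push (isLowerSet_powerset _) (isLowerSet_orthantFam _ _ _)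
    (ContinuousMap.const _ p) ?_ ?_ fun R hR _ => ⟨1, one_pos, fun R' hR' hd => ?_⟩
  · rintro R hR _ ⟨y, hy, t, ht, rfl⟩
    exact h.shrinks_mem (shrinks_homotopy (hsh y) ht) (hR hy)
  · rintro R ⟨s, hs, hR⟩
    refine ⟨s, hs, ?_⟩
    rintro _ ⟨y, hy, t, ht, rfl⟩
    have := shrinks_homotopy (hsh y) ht
    exact ⟨this.mem_orthant (hR hy).1, this.mem_ball (hR hy).2⟩
  · obtain ⟨t, ht⟩ := h.signs_nonempty
    refine ⟨t, ht, ?_⟩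
    rintro _ ⟨y, -, rfl⟩
    exact ⟨apex_mem_orthant p t, Metric.mem_ball_self h.pos⟩

/-- The local cohomology of `V` at `p` can be computed with the singular simplices contained in one
of the orthants of the local model. -/
theorem acyclicPair (h : LocalModel V p δ S) :
    AcyclicPair k (𝒫 V) (awayFrom p (𝒫 V) ∪ orthantFam p δ {t | signSupp t ∈ S}) := by
  set Γ := {t : Fin n → SignType | signSupp t ∈ S}
  have hOV : orthantFam p δ Γ ⊆ 𝒫 (V ∩ Metric.ball p δ) := by
    rintro R ⟨t, ht, hR⟩ y hy
    exact ⟨h.orthant_subset ht (hR hy), (hR hy).2⟩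
  have hunion : ∀ {𝒜 ℬ : Set (Set (Fin n → ℝ))} {m : ℕ} (c : SingChain k (Fin n → ℝ) m),
      c ∈ chainsIn k (𝒜 ∪ ℬ) m → ∃ a ∈ chainsIn k 𝒜 m, ∃ b ∈ chainsIn k ℬ m, a + b = c := by
    intro 𝒜 ℬ m c hc
    have : chainsIn k (𝒜 ∪ ℬ) m = chainsIn k 𝒜 m ⊔ chainsIn k ℬ m :=
      Finsupp.supported_union _ _
    rw [this] at hc
    exact Submodule.mem_sup.1 hc
  have hmono : ∀ {𝒜 ℬ : Set (Set (Fin n → ℝ))} (_ : 𝒜 ⊆ ℬ) {m : ℕ}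
      {c : SingChain k (Fin n → ℝ) m}, c ∈ chainsIn k 𝒜 m → c ∈ chainsIn k ℬ m :=
    fun hAB _ _ hc => Finsupp.supported_mono (Set.preimage_mono hAB) hc
  have hinter : ∀ {𝒜 ℬ : Set (Set (Fin n → ℝ))} {m : ℕ} {c : SingChain k (Fin n → ℝ) m},
      c ∈ chainsIn k 𝒜 m → c ∈ chainsIn k ℬ m → c ∈ chainsIn k (𝒜 ∩ ℬ) m := by
    intro 𝒜 ℬ m c h1 h2
    have : chainsIn k (𝒜 ∩ ℬ) m = chainsIn k 𝒜 m ⊓ chainsIn k ℬ m :=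
      Finsupp.supported_inter _ _
    rw [this]
    exact ⟨h1, h2⟩
  have hlowV := isLowerSet_awayFrom p (isLowerSet_powerset V)
  have hlowO := isLowerSet_orthantFam p δ Γ
  have hlowB := isLowerSet_powerset (V ∩ Metric.ball p δ)
  intro m c hc hbc
  obtain ⟨e₁, he₁, h₁⟩ := h.acyclicPair_ball k m c hc
    (hmono (Set.union_subset_union_right _ hOV) hbc)
  obtain ⟨a, ha, b, hb, hab⟩ := hunion _ h₁
  -- the boundary of the part `b` in the ball is a chain away from `p` plus a chain in the orthants
  have hbb : singBd k _ m b ∈ chainsIn k (awayFrom p (𝒫 (V ∩ Metric.ball p δ)) ∪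
      orthantFam p δ Γ) m := by
    have e : singBd k _ m b = singBd k _ m c - singBd k _ m a := by
      have := congrArg (singBd k _ m) hab
      rw [map_add, map_sub, singBd_singBd, sub_zero] at this
      rw [← this]; abel
    have h1 : singBd k _ m b ∈ chainsIn k (awayFrom p (𝒫 V) ∪ orthantFam p δ Γ) m := by
      rw [e]
      exact Submodule.sub_mem _ hbc (hmono Set.subset_union_left (singBd_mem_chainsIn hlowV ha))
    refine hmono ?_ (hinter h1 (singBd_mem_chainsIn hlowB hb))
    rintro R ⟨hR | hR, hRB⟩
    · exact Or.inl ⟨hRB, hR.2⟩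
    · exact Or.inr hR
  obtain ⟨x, hx, y, hy, hxy⟩ := hunion _ hbb
  have step : ∃ e₂ ∈ chainsIn k (awayFrom p (𝒫 (V ∩ Metric.ball p δ))) (m + 1),
      singBd k _ m (b - e₂) ∈ chainsIn k (orthantFam p δ Γ) m := by
    cases m with
    | zero =>
      refine ⟨0, Submodule.zero_mem _, ?_⟩
      rw [sub_zero]
      refine (Finsupp.mem_supported _ _).2 fun σ _ => ?_
      change Set.range σ ∈ orthantFam p δ Γ
      rw [Set.range_eq_empty_iff.2 ⟨fun x => by simpa using x.2.2⟩]
      exact empty_mem_orthantFam h.signs_nonempty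
    | succ m =>
      have hbx : singBd k _ m x ∈ chainsIn k (awayFrom p (orthantFam p δ Γ)) m := by
        have e : singBd k _ m x = -singBd k _ m y := by
          have := congrArg (singBd k _ m) hxy
          rw [map_add, singBd_singBd] at this
          exact eq_neg_of_add_eq_zero_left this
        have h1 := singBd_mem_chainsIn (isLowerSet_awayFrom p hlowB) hx
        have h2 : singBd k _ m x ∈ chainsIn k (orthantFam p δ Γ) m := by
          rw [e]
          exact Submodule.neg_mem _ (singBd_mem_chainsIn hlowO hy)
        refine hmono ?_ (hinter h1 h2)
        rintro R ⟨hR, hRO⟩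
        exact ⟨hRO, hR.2⟩
      obtain ⟨e₂, he₂, h₂⟩ := h.acyclicPair_away k m x hx hbx
      refine ⟨e₂, he₂, ?_⟩
      rw [map_sub, ← hxy, add_sub_right_comm]
      exact Submodule.add_mem _ (hmono (fun _ hR => hR.1) h₂) hy
  obtain ⟨e₂, he₂, h₂⟩ := step
  obtain ⟨g, hg, h₃⟩ := h.acyclicPair_orthants k m (b - e₂)
    (Submodule.sub_mem _ hb (hmono (fun _ hR => hR.1) he₂)) h₂
  refine ⟨e₁ + g, Submodule.add_mem _ he₁ (hmono (fun R hR => hR.trans Set.inter_subset_left) hg), ?_⟩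
  have e : c - singBd k _ (m + 1) (e₁ + g) =
      (a + e₂) + (b - e₂ - singBd k _ (m + 1) g) := by
    rw [map_add, ← sub_sub, ← hab]; abel
  rw [e]
  refine Submodule.add_mem _ (hmono Set.subset_union_left (Submodule.add_mem _ ha
    (hmono ?_ he₂))) (hmono Set.subset_union_right h₃)
  rintro R ⟨hR, hp⟩
  exact ⟨hR.trans Set.inter_subset_left, hp⟩

end LocalModel

end Local

/-! ### Cells of sign complexes -/

section Cells

variable {k : Type*} [Field k] {n : ℕ}

theorem faceSign_orderEmbOfFin {A : Finset (Fin n)} {m : ℕ} (h : A.card = m) (i : Fin m) :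
    faceSign k A (A.orderEmbOfFin h i) = (-1) ^ (i : ℕ) := by
  have : A.filter (· < A.orderEmbOfFin h i) =
      (Finset.Iio i).map (A.orderEmbOfFin h).toEmbedding := by
    conv_lhs => enter [2]; rw [← Finset.map_orderEmbOfFin_univ A h]
    rw [Finset.filter_map]
    congr 1
    ext l
    simp
  rw [faceSign, this, Finset.card_map, Fin.card_Iio]

theorem signD_eq_sum_fin {t : Fin n → SignType} {m : ℕ} (h : (signSupp t).card = m)
    (f : (Fin n → SignType) → k) :
    signD f t = ∑ i : Fin m, (-1) ^ (i : ℕ) *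
      f (Function.update t ((signSupp t).orderEmbOfFin h i) 0) := by
  have h1 : ∀ s : Finset (Fin n), s = signSupp t → signD f t =
      ∑ j ∈ s, faceSign k (signSupp t) j * f (Function.update t j 0) := by
    rintro s rfl; rfl
  rw [h1 _ (Finset.map_orderEmbOfFin_univ _ h), Finset.sum_map]
  refine Finset.sum_congr rfl fun i _ => ?_
  rw [RelEmbedding.coe_toEmbedding, faceSign_orderEmbOfFin]

/-- The affine singular simplex with given vertices. -/
def affSimp {E : Type*} [NormedAddCommGroup E] [NormedSpace ℝ E] {m : ℕ} (w : Fin m → E) :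
    Simp E m where
  toFun x := ∑ i, x i • w i
  continuous_toFun := continuous_finsetSum _ fun i _ =>
    ((continuous_apply i).comp continuous_subtype_val).smul continuous_const

theorem affSimp_comp_facet {E : Type*} [NormedAddCommGroup E] [NormedSpace ℝ E] {m : ℕ}
    (w : Fin (m + 1) → E) (j : Fin (m + 1)) :
    (affSimp w).comp (facet m j) = affSimp (w ∘ j.succAbove) :=
  ContinuousMap.ext fun x => sum_facet_smul j x w

/-- The simplex spanned by `p` and the points `p ± η e_j`, one for each nonzero sign of `t`. -/
def cell (p : Fin n → ℝ) (η : ℝ) (t : Fin n → SignType) (m : ℕ) (h : (signSupp t).card = m) :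
    Simp (Fin n → ℝ) (m + 1) :=
  affSimp (Fin.cons p fun i => p + Pi.single ((signSupp t).orderEmbOfFin h i)
    (η * (t ((signSupp t).orderEmbOfFin h i) : ℝ)))

variable {p : Fin n → ℝ} {η : ℝ}

theorem sum_smul_add_single {m : ℕ} (e : Fin m → Fin n) (a x : Fin m → ℝ) (hx : ∑ i, x i = 1) :
    ∑ i, x i • (p + Pi.single (e i) (a i)) = p + ∑ i, Pi.single (e i) (x i * a i) := by
  simp only [smul_add, Finset.sum_add_distrib]
  rw [← Finset.sum_smul, hx, one_smul]
  congr 1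
  refine Finset.sum_congr rfl fun i _ => ?_
  rw [← Pi.single_smul, smul_eq_mul]

theorem cell_apply (t : Fin n → SignType) (m : ℕ) (h : (signSupp t).card = m)
    (x : stdSimplex ℝ (Fin (m + 1))) : cell p η t m h x = p + ∑ i : Fin m,
      Pi.single ((signSupp t).orderEmbOfFin h i)
        (x i.succ * (η * (t ((signSupp t).orderEmbOfFin h i) : ℝ))) := by
  change ∑ i, x i • _ = _
  have hx : x 0 + ∑ i : Fin m, x i.succ = 1 := by
    rw [← Fin.sum_univ_succ]; exact x.2.2
  rw [Fin.sum_univ_succ, Fin.cons_zero]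
  simp only [Fin.cons_succ, smul_add, Finset.sum_add_distrib]
  rw [← Finset.sum_smul, ← add_assoc, ← add_smul, hx, one_smul]
  congr 1
  refine Finset.sum_congr rfl fun i _ => ?_
  rw [← Pi.single_smul, smul_eq_mul]

theorem sum_single_apply {m : ℕ} {e : Fin m → Fin n} (he : Function.Injective e) (a : Fin m → ℝ)
    (l : Fin m) : (∑ i, Pi.single (e i) (a i) : Fin n → ℝ) (e l) = a l := by
  rw [Finset.sum_apply, Finset.sum_eq_single l]
  · simp
  · intro b _ hb
    rw [Pi.single_eq_of_ne (fun h => hb (he h).symm)]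
  · simp

theorem cell_apply_coord (t : Fin n → SignType) (m : ℕ) (h : (signSupp t).card = m)
    (x : stdSimplex ℝ (Fin (m + 1))) (j : Fin n) :
    ∃ a ∈ Set.Icc (0 : ℝ) 1, cell p η t m h x j - p j = a * (η * (t j : ℝ)) := by
  rw [cell_apply, Pi.add_apply, add_sub_cancel_left]
  by_cases hj : j ∈ signSupp t
  · obtain ⟨l, rfl⟩ : ∃ l, (signSupp t).orderEmbOfFin h l = j := by
      have : j ∈ Set.range ((signSupp t).orderEmbOfFin h) := by simpa using hj
      exact this
    refine ⟨x l.succ, ⟨x.2.1 _, ?_⟩, ?_⟩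
    · exact (mem_Icc_of_mem_stdSimplex x.2 _).2
    · rw [sum_single_apply ((signSupp t).orderEmbOfFin h).injective
        fun i => x i.succ * (η * (t ((signSupp t).orderEmbOfFin h i) : ℝ))]
  · refine ⟨0, by simp, ?_⟩
    rw [Finset.sum_apply, zero_mul]
    refine Finset.sum_eq_zero fun i _ => Pi.single_eq_of_ne ?_ _
    rintro rfl
    exact hj (Finset.orderEmbOfFin_mem _ _ _)

theorem range_cell_subset {δ : ℝ} (hη : 0 < η) (hηδ : η < δ) (t : Fin n → SignType) (m : ℕ)
    (h : (signSupp t).card = m) :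
    Set.range (cell p η t m h) ⊆ orthant p t ∩ Metric.ball p δ := by
  rintro _ ⟨x, rfl⟩
  constructor
  · intro j
    obtain ⟨a, ha, hj⟩ := cell_apply_coord (p := p) (η := η) t m h x j
    rw [hj, abs_mul, abs_mul, abs_of_nonneg ha.1, abs_of_pos hη]
    cases t j <;> simp
  · rw [Metric.mem_ball]
    refine lt_of_le_of_lt ((dist_pi_le_iff hη.le).2 fun j => ?_) hηδ
    obtain ⟨a, ha, hj⟩ := cell_apply_coord (p := p) (η := η) t m h x j
    rw [Real.dist_eq, hj, abs_mul, abs_mul, abs_of_nonneg ha.1, abs_of_pos hη]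
    have : |(t j : ℝ)| ≤ 1 := by cases t j <;> simp
    calc a * (η * |(t j : ℝ)|) ≤ 1 * (η * 1) := by
          gcongr
          exact ha.2
      _ = η := by ring

theorem apex_mem_range_cell (t : Fin n → SignType) (m : ℕ) (h : (signSupp t).card = m) :
    p ∈ Set.range (cell p η t m h) := by
  refine ⟨vert _ 0, ?_⟩
  rw [cell_apply]
  have : ∀ i : Fin m, (vert (m + 1) 0) i.succ = 0 := fun i => by
    change (vert (m + 1) 0).1 i.succ = 0
    rw [coe_vert, Pi.single_eq_of_ne (Fin.succ_ne_zero i)]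
  simp [this]

theorem apex_notMem_range_facet_zero (hη : 0 < η) (t : Fin n → SignType) (m : ℕ)
    (h : (signSupp t).card = m) : p ∉ Set.range ((cell p η t m h).comp (facet m 0)) := by
  rintro ⟨x, hx⟩
  rw [cell, affSimp_comp_facet] at hx
  have h1 : (Fin.cons p (fun i => p + Pi.single ((signSupp t).orderEmbOfFin h i)
      (η * (t ((signSupp t).orderEmbOfFin h i) : ℝ))) : Fin (m + 1) → Fin n → ℝ) ∘
      (0 : Fin (m + 1)).succAbove = fun i => p + Pi.single ((signSupp t).orderEmbOfFin h i)
      (η * (t ((signSupp t).orderEmbOfFin h i) : ℝ)) := by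
    funext i; simp
  rw [h1] at hx
  have h2 : ∑ i, x i • (p + Pi.single ((signSupp t).orderEmbOfFin h i)
      (η * (t ((signSupp t).orderEmbOfFin h i) : ℝ))) = p := hx
  rw [sum_smul_add_single _ _ x x.2.2, add_eq_left] at h2
  obtain ⟨l, -, hl⟩ : ∃ l ∈ Finset.univ, x l ≠ 0 := by
    refine Finset.exists_ne_zero_of_sum_ne_zero (f := x) ?_
    have : ∑ i, x i = 1 := x.2.2
    rw [this]
    exact one_ne_zero
  have h3 := congrFun h2 ((signSupp t).orderEmbOfFin h l)
  rw [sum_single_apply ((signSupp t).orderEmbOfFin h).injective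
    fun i => x i * (η * (t ((signSupp t).orderEmbOfFin h i) : ℝ))] at h3
  have h4 : t ((signSupp t).orderEmbOfFin h l) ≠ 0 :=
    mem_signSupp.1 (Finset.orderEmbOfFin_mem _ _ _)
  have h5 : (t ((signSupp t).orderEmbOfFin h l) : ℝ) ≠ 0 := by
    revert h4
    cases t ((signSupp t).orderEmbOfFin h l) <;> simp
  exact mul_ne_zero hl (mul_ne_zero hη.ne' h5) h3

theorem card_signSupp_update {t : Fin n → SignType} {m : ℕ} (h : (signSupp t).card = m + 1)
    (i : Fin (m + 1)) :
    (signSupp (Function.update t ((signSupp t).orderEmbOfFin h i) 0)).card = m := by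
  rw [signSupp_update_zero, Finset.card_erase_of_mem (Finset.orderEmbOfFin_mem _ _ _), h]
  rfl

theorem cell_comp_facet_succ (t : Fin n → SignType) (m : ℕ) (h : (signSupp t).card = m + 1)
    (i : Fin (m + 1)) : (cell p η t (m + 1) h).comp (facet (m + 1) i.succ) =
      cell p η (Function.update t ((signSupp t).orderEmbOfFin h i) 0) m
        (card_signSupp_update h i) := by
  rw [cell, affSimp_comp_facet, cons_comp_succ_succAbove, cell]
  congr 2
  funext l
  have h1 : ∀ l, (signSupp (Function.update t ((signSupp t).orderEmbOfFin h i) 0)).orderEmbOfFin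
      (card_signSupp_update h i) l = (signSupp t).orderEmbOfFin h (i.succAbove l) := by
    intro l
    refine (congrFun (Finset.orderEmbOfFin_unique (card_signSupp_update h i)
      (f := fun l => (signSupp t).orderEmbOfFin h (i.succAbove l)) (fun l => ?_) ?_) l).symm
    · rw [signSupp_update_zero, Finset.mem_erase]
      exact ⟨fun h' => Fin.succAbove_ne i l (((signSupp t).orderEmbOfFin h).injective h'),
        Finset.orderEmbOfFin_mem _ _ _⟩
    · exact ((signSupp t).orderEmbOfFin h).strictMono.comp (Fin.strictMono_succAbove i)
  rw [h1, Function.comp_apply, Function.update_of_ne]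
  exact fun h' => Fin.succAbove_ne i l (((signSupp t).orderEmbOfFin h).injective h')

/-- The face relation on sign vectors. -/
def SignLE (s t : Fin n → SignType) : Prop := ∀ j, s j = 0 ∨ s j = t j

theorem SignLE.refl (s : Fin n → SignType) : SignLE s s := fun _ => Or.inr rfl

theorem SignLE.trans {s t u : Fin n → SignType} (h : SignLE s t) (h' : SignLE t u) :
    SignLE s u := by
  intro j
  rcases h j with h1 | h1
  · exact Or.inl h1
  · rcases h' j with h2 | h2
    · exact Or.inl (h1.trans h2)
    · exact Or.inr (h1.trans h2)

theorem SignLE.antisymm {s t : Fin n → SignType} (h : SignLE s t) (h' : SignLE t s) : s = t := by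
  funext j
  rcases h j with h1 | h1
  · rcases h' j with h2 | h2
    · rw [h1, h2]
    · exact h2.symm
  · exact h1

theorem signLE_update_zero (t : Fin n → SignType) (j : Fin n) :
    SignLE (Function.update t j 0) t := by
  intro l
  by_cases h : l = j
  · subst h; simp
  · simp [h]

theorem SignLE.eq_of_card_le {s t : Fin n → SignType} (h : SignLE s t)
    (hc : (signSupp t).card ≤ (signSupp s).card) : s = t := by
  have hsub : signSupp s ⊆ signSupp t := by
    intro j hj
    rw [mem_signSupp] at hj ⊢
    rwa [← (h j).resolve_left hj]
  have heq := Finset.eq_of_subset_of_card_le hsub hc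
  funext j
  rcases h j with h1 | h1
  · have : j ∉ signSupp t := by rw [← heq]; simp [h1]
    rw [mem_signSupp, not_not] at this
    rw [h1, this]
  · exact h1

theorem signLE_of_range_cell_subset (hη : 0 < η) {t s : Fin n → SignType} {m : ℕ}
    {h : (signSupp t).card = m} (hs : Set.range (cell p η t m h) ⊆ orthant p s) : SignLE t s := by
  intro j
  by_cases hj : j ∈ signSupp t
  · right
    obtain ⟨l, rfl⟩ : ∃ l, (signSupp t).orderEmbOfFin h l = j := by
      have : j ∈ Set.range ((signSupp t).orderEmbOfFin h) := by simpa using hj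
      exact this
    have h1 := hs ⟨vert _ l.succ, rfl⟩ ((signSupp t).orderEmbOfFin h l)
    rw [cell_apply, Pi.add_apply, add_sub_cancel_left,
      sum_single_apply ((signSupp t).orderEmbOfFin h).injective
      fun i => (vert (m + 1) l.succ) i.succ * (η * (t ((signSupp t).orderEmbOfFin h i) : ℝ))] at h1
    have h2 : (vert (m + 1) l.succ) l.succ = 1 := by
      change (vert (m + 1) l.succ).1 l.succ = 1
      rw [coe_vert, Pi.single_eq_same]
    rw [h2, one_mul] at h1
    rw [mem_signSupp] at hj
    rcases signType_abs_eq_iff.1 h1 with h3 | h3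
    · exfalso
      revert h3 hj
      cases t ((signSupp t).orderEmbOfFin h l) <;> simp [hη.ne']
    · rw [← h3]
      cases t ((signSupp t).orderEmbOfFin h l) <;> simp [hη]
  · left
    rwa [mem_signSupp, not_not] at hj

theorem cell_injective (hη : 0 < η) {t s : Fin n → SignType} {m : ℕ}
    {h : (signSupp t).card = m} {h' : (signSupp s).card = m}
    (heq : cell p η t m h = cell p η s m h') : t = s := by
  have h1 := (range_cell_subset (p := p) hη (lt_add_one η) t m h).trans Set.inter_subset_left
  have h2 := (range_cell_subset (p := p) hη (lt_add_one η) s m h').trans Set.inter_subset_left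
  refine SignLE.antisymm (signLE_of_range_cell_subset (p := p) hη (h := h) ?_)
    (signLE_of_range_cell_subset (p := p) hη (h := h') ?_)
  · rwa [heq]
  · rwa [← heq]

/-- The values of a singular cochain on the cells. -/
def cellVal (p : Fin n → ℝ) (η : ℝ) :
    ∀ m, (Simp (Fin n → ℝ) m → k) → (Fin n → SignType) → k
  | 0, _ => 0
  | m + 1, ψ => fun t => if h : (signSupp t).card = m then ψ (cell p η t m h) else 0

theorem cellVal_succ {m : ℕ} (ψ : Simp (Fin n → ℝ) (m + 1) → k) {t : Fin n → SignType}
    (h : (signSupp t).card = m) : cellVal p η (m + 1) ψ t = ψ (cell p η t m h) :=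
  dif_pos h

theorem cobd_cell {m : ℕ} {ψ : Simp (Fin n → ℝ) m → k} {t : Fin n → SignType}
    {h : (signSupp t).card = m} (h0 : ψ ((cell p η t m h).comp (facet m 0)) = 0) :
    cobd ψ (cell p η t m h) = -signD (cellVal p η m ψ) t := by
  rw [cobd, Fin.sum_univ_succ, h0, mul_zero, zero_add, signD_eq_sum_fin h, ← Finset.sum_neg_distrib]
  cases m with
  | zero => simp
  | succ m =>
    refine Finset.sum_congr rfl fun i _ => ?_
    rw [cell_comp_facet_succ, cellVal_succ ψ (card_signSupp_update h i), Fin.val_succ, pow_succ]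
    ring

/-- Every function on sign vectors extends to a singular cochain. -/
theorem exists_cochain_of_signs (hη : 0 < η) (m : ℕ) (μ : (Fin n → SignType) → k) :
    ∃ ψ : Simp (Fin n → ℝ) m → k, (∀ σ : Simp (Fin n → ℝ) m, p ∉ Set.range σ → ψ σ = 0) ∧
      ∀ t, (signSupp t).card + 1 = m → cellVal p η m ψ t = μ t := by
  cases m with
  | zero => exact ⟨0, fun _ _ => rfl, fun t ht => absurd ht (Nat.succ_ne_zero _)⟩
  | succ m =>
    classical
    refine ⟨fun σ => if h : ∃ t, ∃ h : (signSupp t).card = m, σ = cell p η t m h then μ h.choose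
      else 0, fun σ hσ => dif_neg ?_, fun t ht => ?_⟩
    · rintro ⟨t, h, rfl⟩
      exact hσ (apex_mem_range_cell t m h)
    · have ht' : (signSupp t).card = m := Nat.succ_injective ht
      rw [cellVal_succ _ ht']
      have hex : ∃ t', ∃ h : (signSupp t').card = m, cell p η t m ht' = cell p η t' m h :=
        ⟨t, ht', rfl⟩
      rw [dif_pos hex]
      obtain ⟨h, heq⟩ := hex.choose_spec
      rw [← cell_injective hη heq]

theorem signD_cellVal {m : ℕ} {ψ : Simp (Fin n → ℝ) m → k} {μ : (Fin n → SignType) → k}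
    {t : Fin n → SignType} (ht : (signSupp t).card = m)
    (h : ∀ s, SignLE s t → (signSupp s).card + 1 = m → cellVal p η m ψ s = μ s) :
    signD (cellVal p η m ψ) t = signD μ t := by
  refine Finset.sum_congr rfl fun j hj => ?_
  rw [h _ (signLE_update_zero t j)]
  rw [signSupp_update_zero, Finset.card_erase_add_one hj, ht]

/-- The faces of a sign vector `s ≠ 0` form a cone. -/
theorem signExact_down {s : Fin n → SignType} (hs : s ≠ 0) (i : ℕ) :
    SignExact k {t | SignLE t s} i := by
  obtain ⟨j, hj⟩ : ∃ j, s j ≠ 0 := by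
    by_contra hne
    exact hs (funext fun j => not_not.1 fun h => hne ⟨j, h⟩)
  let r : Finset (Fin n) → Fin n → SignType := fun A l => if l ∈ A then s l else 0
  have hr : ∀ t, SignLE t s → r (signSupp t) = t := by
    intro t ht
    funext l
    by_cases hl : l ∈ signSupp t
    · simp only [r, hl, if_true]
      rw [mem_signSupp] at hl
      exact ((ht l).resolve_left hl).symm
    · simp only [r, hl, if_false]
      rw [mem_signSupp, not_not] at hl
      exact hl.symm
  have hsr : ∀ A, A ⊆ signSupp s → signSupp (r A) = A := by
    intro A hA
    ext l
    rw [mem_signSupp]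
    by_cases hl : l ∈ A
    · simpa [r, hl] using hA hl
    · simp [r, hl]
  have hru : ∀ A l, Function.update (r A) l 0 = r (A.erase l) := by
    intro A l
    funext l'
    by_cases h : l' = l
    · subst h; simp [r]
    · simp [r, h]
  have hrle : ∀ A, SignLE (r A) s := fun A l => by
    by_cases hl : l ∈ A <;> simp [r, hl]
  have hsD : ∀ (f : (Fin n → SignType) → k) A, A ⊆ signSupp s →
      signD f (r A) = simplexD (fun B => f (r B)) A := by
    intro f A hA
    rw [signD, hsr A hA]
    exact Finset.sum_congr rfl fun l _ => by rw [hru]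
  intro f hf
  obtain ⟨g, -, hg⟩ := simplexExact_of_cone (k := k) (S := {A | A ⊆ signSupp s}) (F := ∅) (j := j)
    (Finset.notMem_empty j) (fun A hA _ => Finset.insert_subset (by simpa using hj) hA) i
    (fun A => f (r A)) (fun A hA => absurd (Finset.empty_subset A) hA) fun A hA hc => by
      rw [← hsD f A hA]
      exact hf _ (hrle A) (by rw [hsr A hA, hc])
  refine ⟨fun t => g (signSupp t), fun t ht hc => ?_⟩
  have hts : signSupp t ⊆ signSupp s := by
    intro l hl
    rw [mem_signSupp] at hl ⊢
    rwa [← (ht l).resolve_left hl]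
  have h1 := hg _ hts hc
  rw [hr t ht] at h1
  rw [← h1]
  exact Finset.sum_congr rfl fun l _ => by
    beta_reduce
    rw [signSupp_update_zero]

end Cells

/-! ### Comparison of singular and cellular cochains -/

section Comparison

variable {k : Type*} [Field k] {n : ℕ} {p : Fin n → ℝ} {δ η : ℝ}

theorem range_cell_mem (hη : 0 < η) (hηδ : η < δ) {Γ : Set (Fin n → SignType)}
    {t : Fin n → SignType} (ht : t ∈ Γ) {m : ℕ} (h : (signSupp t).card = m) :
    Set.range (cell p η t m h) ∈ orthantFam p δ Γ :=
  ⟨t, ht, range_cell_subset hη hηδ t m h⟩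

theorem range_facet_zero_mem (hη : 0 < η) (hηδ : η < δ) {Γ : Set (Fin n → SignType)}
    {t : Fin n → SignType} (ht : t ∈ Γ) {m : ℕ} (h : (signSupp t).card = m) :
    Set.range ((cell p η t m h).comp (facet m 0)) ∈ awayFrom p (orthantFam p δ Γ) := by
  exact ⟨isLowerSet_orthantFam p δ Γ (range_comp_facet_subset (cell p η t m h) 0)
    (range_cell_mem hη hηδ ht h), apex_notMem_range_facet_zero hη t m h⟩

theorem orthantFam_mono {Γ Γ' : Set (Fin n → SignType)} (h : Γ ⊆ Γ') :
    orthantFam p δ Γ ⊆ orthantFam p δ Γ' := by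
  rintro R ⟨t, ht, hR⟩
  exact ⟨t, h ht, hR⟩

/-- The singular cochains on the orthants of `Γ`, relative to the complement of `p`, that vanish on
the cells form an acyclic complex. Since restriction to the cells is surjective, this says that the
singular and the cellular cochains have the same cohomology. -/
def CellAcyclic (k : Type*) [Field k] (p : Fin n → ℝ) (δ η : ℝ) (Γ : Set (Fin n → SignType)) :
    Prop :=
  ∀ (m : ℕ) (φ : Simp (Fin n → ℝ) (m + 1) → k),
    (∀ σ : Simp (Fin n → ℝ) (m + 1), Set.range σ ∈ awayFrom p (orthantFam p δ Γ) → φ σ = 0) →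
    (∀ t ∈ Γ, cellVal p η (m + 1) φ t = 0) →
    (∀ σ : Simp (Fin n → ℝ) (m + 2), Set.range σ ∈ orthantFam p δ Γ → cobd φ σ = 0) →
    ∃ ψ : Simp (Fin n → ℝ) m → k,
      (∀ σ : Simp (Fin n → ℝ) m, Set.range σ ∈ awayFrom p (orthantFam p δ Γ) → ψ σ = 0) ∧
      (∀ t ∈ Γ, cellVal p η m ψ t = 0) ∧
      ∀ σ : Simp (Fin n → ℝ) (m + 1), Set.range σ ∈ orthantFam p δ Γ → cobd ψ σ = φ σ

theorem cellVal_cobd (hη : 0 < η) (hηδ : η < δ) {Γ : Set (Fin n → SignType)} {m : ℕ}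
    {ψ : Simp (Fin n → ℝ) m → k}
    (hψ : ∀ σ : Simp (Fin n → ℝ) m, Set.range σ ∈ awayFrom p (orthantFam p δ Γ) → ψ σ = 0)
    {t : Fin n → SignType} (ht : t ∈ Γ) (h : (signSupp t).card = m) :
    cellVal p η (m + 1) (cobd ψ) t = -signD (cellVal p η m ψ) t := by
  rw [cellVal_succ _ h, cobd_cell (hψ _ (range_facet_zero_mem hη hηδ ht h))]

theorem cellVal_cobd_eq_zero (hη : 0 < η) (hηδ : η < δ) {Γ : Set (Fin n → SignType)}
    (hΓ : ∀ t ∈ Γ, ∀ s, SignLE s t → s ∈ Γ) {m : ℕ} {ψ : Simp (Fin n → ℝ) m → k}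
    (hψ : ∀ σ : Simp (Fin n → ℝ) m, Set.range σ ∈ awayFrom p (orthantFam p δ Γ) → ψ σ = 0)
    (hc : ∀ t ∈ Γ, cellVal p η m ψ t = 0) {t : Fin n → SignType} (ht : t ∈ Γ) :
    cellVal p η (m + 1) (cobd ψ) t = 0 := by
  by_cases h : (signSupp t).card = m
  · rw [cellVal_cobd hη hηδ hψ ht h, neg_eq_zero]
    refine Finset.sum_eq_zero fun j _ => ?_
    rw [hc _ (hΓ t ht _ (signLE_update_zero t j)), mul_zero]
  · exact dif_neg h

theorem cellVal_add {m : ℕ} (φ ψ : Simp (Fin n → ℝ) m → k) (t : Fin n → SignType) :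
    cellVal p η m (φ + ψ) t = cellVal p η m φ t + cellVal p η m ψ t := by
  cases m with
  | zero => simp [cellVal]
  | succ m =>
    by_cases h : (signSupp t).card = m
    · simp [cellVal_succ _ h]
    · simp [cellVal, h]

theorem cellVal_neg {m : ℕ} (φ : Simp (Fin n → ℝ) m → k) (t : Fin n → SignType) :
    cellVal p η m (-φ) t = -cellVal p η m φ t := by
  cases m with
  | zero => simp [cellVal]
  | succ m =>
    by_cases h : (signSupp t).card = m
    · simp [cellVal_succ _ h]
    · simp [cellVal, h]

theorem cellVal_sub {m : ℕ} (φ ψ : Simp (Fin n → ℝ) m → k) (t : Fin n → SignType) :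
    cellVal p η m (φ - ψ) t = cellVal p η m φ t - cellVal p η m ψ t := by
  rw [sub_eq_add_neg, cellVal_add, cellVal_neg, sub_eq_add_neg]

theorem orthant_zero (p : Fin n → ℝ) : orthant p 0 = {p} := by
  ext y
  constructor
  · intro hy
    funext j
    have := hy j
    rw [Pi.zero_apply, SignType.coe_zero, zero_mul, abs_eq_zero] at this
    exact sub_eq_zero.1 this
  · rintro rfl
    exact apex_mem_orthant _ _

theorem range_simp_zero {E : Type*} [NormedAddCommGroup E] (σ : Simp E 0) : Set.range σ = ∅ :=
  Set.range_eq_empty_iff.2 ⟨fun x => by simpa using x.2.2⟩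

theorem sum_neg_one_pow_fin (m : ℕ) :
    ∑ j : Fin (m + 1), (-1 : k) ^ (j : ℕ) = if Even m then 1 else 0 := by
  rw [Fin.sum_univ_eq_sum_range (fun j => (-1 : k) ^ j), neg_one_geom_sum]
  by_cases h : Even m
  · rw [if_neg (by simpa [Nat.even_add_one] using h), if_pos h]
  · rw [if_pos (by simpa [Nat.even_add_one] using h), if_neg h]

/-- The origin: the cochain complex of a point. -/
theorem cellAcyclic_zero (hδ : 0 < δ) : CellAcyclic k p δ η {t | SignLE t 0} := by
  have h0 : ∀ t : Fin n → SignType, SignLE t 0 → t = 0 := fun t ht =>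
    funext fun j => (ht j).elim id id
  have hfam : ∀ {m : ℕ} (σ : Simp (Fin n → ℝ) m),
      Set.range σ ∈ orthantFam p δ {t | SignLE t 0} → σ = ContinuousMap.const _ p := by
    rintro m σ ⟨t, ht, hR⟩
    rw [h0 t ht, orthant_zero] at hR
    exact ContinuousMap.ext fun x => (hR ⟨x, rfl⟩).1
  have hconst : ∀ m, Set.range (ContinuousMap.const _ p : Simp (Fin n → ℝ) m) ∈
      orthantFam p δ {t | SignLE t 0} := by
    intro m
    refine ⟨0, SignLE.refl _, ?_⟩
    rintro _ ⟨x, rfl⟩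
    exact ⟨apex_mem_orthant p 0, Metric.mem_ball_self hδ⟩
  have hcell : ∀ h, cell p η 0 0 h = ContinuousMap.const _ p := fun h => by
    refine ContinuousMap.ext fun x => ?_
    rw [cell_apply]
    simp
  have hcobd : ∀ {m : ℕ} (φ : Simp (Fin n → ℝ) m → k),
      cobd φ (ContinuousMap.const _ p) = (if Even m then 1 else 0) * φ (ContinuousMap.const _ p) := by
    intro m φ
    rw [← sum_neg_one_pow_fin, Finset.sum_mul]
    rfl
  classical
  intro m φ _ hc hd
  rcases Nat.even_or_odd m with hm | hm
  · cases m with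
    | zero =>
      refine ⟨0, fun _ _ => rfl, fun t ht => rfl, fun σ hσ => ?_⟩
      have h1 := hc 0 (SignLE.refl _)
      rw [cellVal_succ φ (by simp [signSupp]), hcell] at h1
      rw [cobd_zero, hfam σ hσ, h1]
    | succ m =>
      refine ⟨fun σ => if Set.range σ ∈ awayFrom p (orthantFam p δ {t | SignLE t 0}) then 0
        else φ (ContinuousMap.const _ p), fun σ hσ => if_pos hσ, fun t ht => ?_, fun σ hσ => ?_⟩
      · have : (signSupp t).card ≠ m := by
          rw [h0 t ht]
          rintro h
          simp only [signSupp, Pi.zero_apply, ne_eq, not_true_eq_false, Finset.filter_false,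
            Finset.card_empty] at h
          rw [← h] at hm
          simp at hm
        exact dif_neg this
      · rw [hfam σ hσ, hcobd, if_pos hm, one_mul]
        refine if_neg fun h => h.2 ⟨vert _ 0, rfl⟩
  · refine ⟨0, fun _ _ => rfl, fun t ht => ?_, fun σ hσ => ?_⟩
    · have := cellVal_sub (p := p) (η := η) (0 : Simp (Fin n → ℝ) m → k) 0 t
      rwa [sub_zero, sub_self] at this
    · have h1 := hd _ (hconst (m + 2))
      rw [hcobd, if_pos (by simpa [Nat.even_add_one] using hm), one_mul] at h1
      rw [cobd_zero, hfam σ hσ, h1]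

/-- A closed orthant of positive dimension: both the orthant and its complement of the apex are
contractible, and its faces form a cone. -/
theorem cellAcyclic_down (hη : 0 < η) (hηδ : η < δ) {s : Fin n → SignType} (hs : s ≠ 0) :
    CellAcyclic k p δ η {t | SignLE t s} := by
  have hδ := hη.trans hηδ
  set Γ := {t | SignLE t s}
  have hfam : ∀ R, R ∈ orthantFam p δ Γ ↔ R ⊆ orthant p s ∩ Metric.ball p δ := by
    intro R
    refine ⟨?_, fun h => ⟨s, SignLE.refl s, h⟩⟩
    rintro ⟨t, ht, hR⟩ y hy
    refine ⟨fun j => ?_, (hR hy).2⟩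
    have h1 := (hR hy).1 j
    rw [signType_abs_eq_iff] at h1 ⊢
    rcases h1 with h1 | h1
    · exact Or.inl h1
    · rcases ht j with h2 | h2
      · rw [h2, sign_eq_zero_iff] at h1
        exact Or.inl h1
      · exact Or.inr (h1.trans h2)
  -- an interior point of the orthant, to which the orthant contracts
  set b : Fin n → ℝ := fun j => p j + η * (s j : ℝ) with hb
  have hbj : ∀ j, b j - p j = η * (s j : ℝ) := fun j => add_sub_cancel_left _ _
  have hbo : b ∈ orthant p s ∩ Metric.ball p δ := by
    constructor
    · intro j
      rw [hbj, abs_mul, abs_of_pos hη]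
      cases s j <;> simp
    · rw [Metric.mem_ball]
      refine lt_of_le_of_lt ((dist_pi_le_iff hη.le).2 fun j => ?_) hηδ
      rw [Real.dist_eq, hbj, abs_mul, abs_of_pos hη]
      refine mul_le_of_le_one_right hη.le ?_
      cases s j <;> simp
  have hconv : ∀ R, R ⊆ orthant p s ∩ Metric.ball p δ →
      sweep (ContinuousMap.const _ b) R ⊆ orthant p s ∩ Metric.ball p δ := by
    rintro R hR _ ⟨y, hy, t, ht, rfl⟩
    exact ((convex_orthant p s).inter (convex_ball p δ)) (hR hy) hbo (sub_nonneg.2 ht.2) ht.1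
      (sub_add_cancel _ _)
  have hne : ∀ y ∈ orthant p s, y ≠ p → ∀ t ∈ Set.Icc (0 : ℝ) 1, (1 - t) • y + t • b ≠ p := by
    intro y hy hyp t ht h
    obtain ⟨j, hj⟩ : ∃ j, y j ≠ p j := by
      by_contra hne
      exact hyp (funext fun j => not_not.1 fun h => hne ⟨j, h⟩)
    have h1 := hy j
    have h2 := congrFun h j
    simp only [Pi.add_apply, Pi.smul_apply, smul_eq_mul] at h2
    have hpos : 0 < |y j - p j| := abs_pos.2 (sub_ne_zero.2 hj)
    have h3 : (1 - t) * (y j - p j) + t * (η * (s j : ℝ)) = 0 := by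
      rw [← hbj]; linear_combination h2
    have hs2 : (s j : ℝ) * (s j : ℝ) = 1 := by
      have hs0 : s j ≠ 0 := by
        intro h0
        rw [h0, SignType.coe_zero, zero_mul] at h1
        exact hpos.ne' h1
      revert hs0
      cases s j <;> simp
    have h4 : (1 - t) * |y j - p j| + t * η = 0 := by
      rw [h1]; linear_combination (s j : ℝ) * h3 - t * η * hs2
    rcases eq_or_lt_of_le ht.1 with h0 | h0
    · rw [← h0] at h4; simp at h4; exact hpos.ne' (by simpa using h4)
    · have := mul_nonneg (sub_nonneg.2 ht.2) hpos.le
      have := mul_pos h0 hη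
      linarith
  have hbp : b ≠ p := by
    intro h
    refine hs (funext fun j => ?_)
    have h1 := hbj j
    rw [h, sub_self] at h1
    have := (mul_eq_zero.1 h1.symm).resolve_left hη.ne'
    revert this
    cases s j <;> simp
  have hpair : AcyclicPair k (orthantFam p δ Γ) (awayFrom p (orthantFam p δ Γ)) := by
    refine acyclicPair_of_push (isLowerSet_orthantFam _ _ _)
      (isLowerSet_awayFrom p (isLowerSet_orthantFam _ _ _)) (ContinuousMap.const _ b)
      (fun R hR => ?_) ?_ fun R _ _ => ⟨1, one_pos, fun R' _ _ => ?_⟩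
    · rw [hfam] at hR ⊢
      exact hconv R hR
    · rintro R ⟨hR, hp⟩
      rw [hfam] at hR
      refine ⟨(hfam _).2 (hconv R hR), ?_⟩
      rintro ⟨y, hy, t, ht, htp⟩
      exact hne y (hR hy).1 (by rintro rfl; exact hp hy) t ht htp
    · refine ⟨(hfam _).2 ?_, ?_⟩
      · rintro _ ⟨y, -, rfl⟩; exact hbo
      · rintro ⟨y, -, hy⟩; exact hbp hy
  intro m φ hφ hc hd
  obtain ⟨ψ, hψ, hψd⟩ := hpair.exists_cobd_eq hφ hd
  have hΓ : ∀ t ∈ Γ, ∀ u, SignLE u t → u ∈ Γ := fun t ht u hu => hu.trans ht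
  cases m with
  | zero => exact ⟨ψ, hψ, fun t _ => rfl, hψd⟩
  | succ m =>
    -- correct `ψ` by a coboundary, so that it vanishes on the cells
    obtain ⟨μ, hμ⟩ := signExact_down (k := k) hs m (cellVal p η (m + 1) ψ) fun t ht h => by
      have h1 := cellVal_cobd hη hηδ hψ ht h
      rw [cellVal_succ _ h, hψd _ (range_cell_mem hη hηδ ht h), ← cellVal_succ φ h, hc t ht] at h1
      exact neg_eq_zero.1 h1.symm
    obtain ⟨ν, hν, hνμ⟩ := exists_cochain_of_signs (p := p) hη m μ
    have hν' : ∀ σ : Simp (Fin n → ℝ) m, Set.range σ ∈ awayFrom p (orthantFam p δ Γ) → ν σ = 0 :=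
      fun σ hσ => hν σ hσ.2
    refine ⟨ψ + cobd ν, fun σ hσ => ?_, fun t ht => ?_, fun σ hσ => ?_⟩
    · rw [Pi.add_apply, hψ σ hσ, zero_add]
      exact cobd_eq_zero (isLowerSet_awayFrom p (isLowerSet_orthantFam p δ Γ)) hν' hσ
    · rw [cellVal_add]
      by_cases h : (signSupp t).card = m
      · rw [cellVal_cobd hη hηδ hν' ht h, signD_cellVal h fun u _ hu' => hνμ u hu', hμ t ht h,
          add_neg_cancel]
      · have h1 : ∀ χ : Simp (Fin n → ℝ) (m + 1) → k, cellVal p η (m + 1) χ t = 0 :=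
          fun χ => dif_neg h
        rw [h1, h1, add_zero]
    · rw [cobd_add, cobd_cobd, add_zero, hψd σ hσ]

/-- The Mayer–Vietoris step. -/
theorem CellAcyclic.union (hη : 0 < η) (hηδ : η < δ) {Γ₁ Γ₂ : Set (Fin n → SignType)}
    (hΓ₁ : ∀ t ∈ Γ₁, ∀ s, SignLE s t → s ∈ Γ₁) (hΓ₂ : ∀ t ∈ Γ₂, ∀ s, SignLE s t → s ∈ Γ₂)
    (h₁ : CellAcyclic k p δ η Γ₁) (h₂ : CellAcyclic k p δ η Γ₂)
    (h₁₂ : CellAcyclic k p δ η (Γ₁ ∩ Γ₂)) : CellAcyclic k p δ η (Γ₁ ∪ Γ₂) := by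
  have hfu : ∀ R, R ∈ orthantFam p δ (Γ₁ ∪ Γ₂) ↔ R ∈ orthantFam p δ Γ₁ ∨ R ∈ orthantFam p δ Γ₂ := by
    intro R
    constructor
    · rintro ⟨t, ht | ht, hR⟩
      · exact Or.inl ⟨t, ht, hR⟩
      · exact Or.inr ⟨t, ht, hR⟩
    · rintro (h | h)
      · exact orthantFam_mono Set.subset_union_left h
      · exact orthantFam_mono Set.subset_union_right h
  have hfi : ∀ R, R ∈ orthantFam p δ Γ₁ → R ∈ orthantFam p δ Γ₂ →
      R ∈ orthantFam p δ (Γ₁ ∩ Γ₂) := by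
    rintro R ⟨t, ht, hR⟩ ⟨s, hs, hR'⟩
    refine ⟨fun j => if t j = s j then t j else 0, ⟨hΓ₁ t ht _ fun j => ?_, hΓ₂ s hs _ fun j => ?_⟩,
      fun y hy => ⟨fun j => ?_, (hR hy).2⟩⟩
    · by_cases h : t j = s j <;> simp [h]
    · by_cases h : t j = s j <;> simp [h]
    · have h1 := (hR hy).1 j
      have h2 := (hR' hy).1 j
      rw [signType_abs_eq_iff] at h1 h2 ⊢
      rcases h1 with h1 | h1
      · exact Or.inl h1
      · rcases h2 with h2 | h2
        · exact Or.inl h2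
        · beta_reduce
          rw [if_pos (h1.symm.trans h2)]
          exact Or.inr h1
  have hcellU : ∀ {Γ : Set (Fin n → SignType)}, (∀ t ∈ Γ, ∀ s, SignLE s t → s ∈ Γ) →
      ∀ {t : Fin n → SignType} {m : ℕ} {h : (signSupp t).card = m},
        Set.range (cell p η t m h) ∈ orthantFam p δ Γ → t ∈ Γ := by
    rintro Γ hΓ t m h ⟨s, hs, hR⟩
    exact hΓ s hs t (signLE_of_range_cell_subset hη (hR.trans Set.inter_subset_left))
  have hΓ₁₂ : ∀ t ∈ Γ₁ ∩ Γ₂, ∀ s, SignLE s t → s ∈ Γ₁ ∩ Γ₂ :=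
    fun t ht s hs => ⟨hΓ₁ t ht.1 s hs, hΓ₂ t ht.2 s hs⟩
  have hlow := fun Γ : Set (Fin n → SignType) => isLowerSet_orthantFam p δ Γ
  intro m φ hφ hc hd
  obtain ⟨a₁, ha₁, hc₁, hd₁⟩ := h₁ m φ (fun σ hσ => hφ σ ⟨(hfu _).2 (Or.inl hσ.1), hσ.2⟩)
    (fun t ht => hc t (Or.inl ht)) fun σ hσ => hd σ ((hfu _).2 (Or.inl hσ))
  obtain ⟨a₂, ha₂, hc₂, hd₂⟩ := h₂ m φ (fun σ hσ => hφ σ ⟨(hfu _).2 (Or.inr hσ.1), hσ.2⟩)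
    (fun t ht => hc t (Or.inr ht)) fun σ hσ => hd σ ((hfu _).2 (Or.inr hσ))
  -- change `a₁` by a coboundary, so that it agrees with `a₂` on the intersection
  obtain ⟨a, ha, hca, hda, hag⟩ : ∃ a : Simp (Fin n → ℝ) m → k,
      (∀ σ : Simp (Fin n → ℝ) m, Set.range σ ∈ awayFrom p (orthantFam p δ Γ₁) → a σ = 0) ∧
      (∀ t ∈ Γ₁, cellVal p η m a t = 0) ∧
      (∀ σ : Simp (Fin n → ℝ) (m + 1), Set.range σ ∈ orthantFam p δ Γ₁ → cobd a σ = φ σ) ∧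
      ∀ σ : Simp (Fin n → ℝ) m, Set.range σ ∈ orthantFam p δ (Γ₁ ∩ Γ₂) → a σ = a₂ σ := by
    cases m with
    | zero =>
      refine ⟨a₁, ha₁, hc₁, hd₁, fun σ hσ => ?_⟩
      have hp : p ∉ Set.range σ := by rw [range_simp_zero]; exact Set.notMem_empty p
      rw [ha₁ σ ⟨orthantFam_mono Set.inter_subset_left hσ, hp⟩,
        ha₂ σ ⟨orthantFam_mono Set.inter_subset_right hσ, hp⟩]
    | succ m =>
      obtain ⟨b, hb, hcb, hdb⟩ := h₁₂ m (a₁ - a₂)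
        (fun σ hσ => by
          rw [Pi.sub_apply, ha₁ σ ⟨orthantFam_mono Set.inter_subset_left hσ.1, hσ.2⟩,
            ha₂ σ ⟨orthantFam_mono Set.inter_subset_right hσ.1, hσ.2⟩, sub_self])
        (fun t ht => by rw [cellVal_sub, hc₁ t ht.1, hc₂ t ht.2, sub_self])
        (fun σ hσ => by
          rw [cobd_sub, hd₁ σ (orthantFam_mono Set.inter_subset_left hσ),
            hd₂ σ (orthantFam_mono Set.inter_subset_right hσ), sub_self])
      classical
      set b' : Simp (Fin n → ℝ) m → k :=
        fun σ => if Set.range σ ∈ orthantFam p δ (Γ₁ ∩ Γ₂) then b σ else 0 with hb'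
      have hb'0 : ∀ σ : Simp (Fin n → ℝ) m,
          Set.range σ ∈ awayFrom p (orthantFam p δ Γ₁) → b' σ = 0 := by
        intro σ hσ
        by_cases h : Set.range σ ∈ orthantFam p δ (Γ₁ ∩ Γ₂)
        · exact (if_pos h).trans (hb σ ⟨h, hσ.2⟩)
        · exact if_neg h
      have hb'c : ∀ t ∈ Γ₁, cellVal p η m b' t = 0 := by
        intro t ht
        cases m with
        | zero => rfl
        | succ m =>
          by_cases h : (signSupp t).card = m
          · rw [cellVal_succ _ h]
            by_cases h' : Set.range (cell p η t m h) ∈ orthantFam p δ (Γ₁ ∩ Γ₂)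
            · have ht' := hcellU hΓ₁₂ h'
              refine (if_pos h').trans ?_
              rw [← cellVal_succ b h]
              exact hcb t ht'
            · exact if_neg h'
          · exact dif_neg h
      refine ⟨a₁ - cobd b', fun σ hσ => ?_, fun t ht => ?_, fun σ hσ => ?_, fun σ hσ => ?_⟩
      · rw [Pi.sub_apply, ha₁ σ hσ, cobd_eq_zero (isLowerSet_awayFrom p (hlow Γ₁)) hb'0 hσ,
          sub_self]
      · rw [cellVal_sub, hc₁ t ht, cellVal_cobd_eq_zero hη hηδ hΓ₁ hb'0 hb'c ht, sub_self]
      · rw [cobd_sub, cobd_cobd, sub_zero, hd₁ σ hσ]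
      · rw [Pi.sub_apply, cobd_congr (hlow (Γ₁ ∩ Γ₂)) (fun σ hσ => if_pos hσ : ∀ σ, _ → b' σ = b σ)
          hσ, hdb σ hσ, Pi.sub_apply, sub_sub_cancel]
  classical
  refine ⟨fun σ => if Set.range σ ∈ orthantFam p δ Γ₁ then a σ else a₂ σ, fun σ hσ => ?_,
    fun t ht => ?_, fun σ hσ => ?_⟩
  · by_cases h : Set.range σ ∈ orthantFam p δ Γ₁
    · exact (if_pos h).trans (ha σ ⟨h, hσ.2⟩)
    · exact (if_neg h).trans (ha₂ σ ⟨((hfu _).1 hσ.1).resolve_left h, hσ.2⟩)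
  · cases m with
    | zero => rfl
    | succ m =>
      by_cases h : (signSupp t).card = m
      · rw [cellVal_succ _ h]
        by_cases h' : Set.range (cell p η t m h) ∈ orthantFam p δ Γ₁
        · refine (if_pos h').trans ?_
          rw [← cellVal_succ a h]
          exact hca t (hcellU hΓ₁ h')
        · refine (if_neg h').trans ?_
          rw [← cellVal_succ a₂ h]
          exact hc₂ t (ht.resolve_left fun ht' => h' (range_cell_mem hη hηδ ht' h))
      · exact dif_neg h
  · rcases (hfu _).1 hσ with h | h
    · rw [← hda σ h]
      exact cobd_congr (hlow Γ₁) (fun τ hτ => if_pos hτ) h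
    · rw [← hd₂ σ h]
      refine cobd_congr (hlow Γ₂) (fun τ hτ => ?_) h
      by_cases h' : Set.range τ ∈ orthantFam p δ Γ₁
      · exact (if_pos h').trans (hag τ (hfi _ h' hτ))
      · exact if_neg h'

theorem cellAcyclic (hη : 0 < η) (hηδ : η < δ) (Γ : Set (Fin n → SignType))
    (hΓ : ∀ t ∈ Γ, ∀ s, SignLE s t → s ∈ Γ) : CellAcyclic k p δ η Γ := by
  induction hN : Γ.ncard using Nat.strong_induction_on generalizing Γ with
  | _ N ih =>
    subst hN
    rcases Γ.eq_empty_or_nonempty with rfl | hne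
    · have h0 : orthantFam p δ (∅ : Set (Fin n → SignType)) = ∅ := by
        ext R; simp [orthantFam]
      intro m φ _ _ _
      refine ⟨0, fun _ _ => rfl, fun t ht => absurd ht (Set.notMem_empty t), fun σ hσ => ?_⟩
      rw [h0] at hσ
      exact absurd hσ (Set.notMem_empty _)
    · obtain ⟨s, hs, hmax⟩ := Set.exists_max_image Γ (fun t => (signSupp t).card) Γ.toFinite hne
      have hdown : {t | SignLE t s} ⊆ Γ := fun t ht => hΓ s hs t ht
      by_cases heq : {t | SignLE t s} = Γ
      · rw [← heq]
        by_cases hs0 : s = 0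
        · rw [hs0]; exact cellAcyclic_zero (hη.trans hηδ)
        · exact cellAcyclic_down hη hηδ hs0
      · have hΓ₁ : ∀ t ∈ Γ \ {s}, ∀ u, SignLE u t → u ∈ Γ \ {s} := by
          rintro t ⟨ht, hts⟩ u hu
          refine ⟨hΓ t ht u hu, ?_⟩
          rintro rfl
          exact hts (hu.eq_of_card_le (hmax t ht)).symm
        have hΓ₂ : ∀ t ∈ {t | SignLE t s}, ∀ u, SignLE u t → u ∈ {t | SignLE t s} :=
          fun t ht u hu => hu.trans ht
        have hΓ₁₂ : ∀ t ∈ (Γ \ {s}) ∩ {t | SignLE t s}, ∀ u, SignLE u t →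
            u ∈ (Γ \ {s}) ∩ {t | SignLE t s} := fun t ht u hu => ⟨hΓ₁ t ht.1 u hu, hΓ₂ t ht.2 u hu⟩
        have hlt₂ : {t | SignLE t s}.ncard < Γ.ncard :=
          Set.ncard_lt_ncard (lt_of_le_of_ne hdown heq) Γ.toFinite
        have hlt₁ : (Γ \ {s}).ncard < Γ.ncard := Set.ncard_sdiff_singleton_lt_of_mem hs Γ.toFinite
        have hun : (Γ \ {s}) ∪ {t | SignLE t s} = Γ := by
          ext t
          constructor
          · rintro (h | h)
            · exact h.1
            · exact hdown h
          · intro h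
            by_cases hts : t = s
            · exact Or.inr (hts ▸ SignLE.refl s)
            · exact Or.inl ⟨h, hts⟩
        have hint : ((Γ \ {s}) ∩ {t | SignLE t s}).ncard < Γ.ncard :=
          (Set.ncard_le_ncard Set.inter_subset_left (Set.toFinite _)).trans_lt hlt₁
        have := CellAcyclic.union hη hηδ hΓ₁ hΓ₂ (ih _ hlt₁ _ hΓ₁ rfl) (ih _ hlt₂ _ hΓ₂ rfl)
          (ih _ hint _ hΓ₁₂ rfl)
        rwa [hun] at this

end Comparison

/-! ### The local cohomology of a local arrangement -/

theorem subsingleton_cohomology_iff {R : Type*} [CommRing R] {C : ℕ → Type*}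
    [∀ q, AddCommGroup (C q)] [∀ q, Module R (C q)] (d : ∀ q, C q →ₗ[R] C (q + 1)) (i : ℕ) :
    Subsingleton (Cohomology d i) ↔ ∀ x, d i x = 0 → x ∈ coboundaries d i := by
  rw [Submodule.Quotient.subsingleton_iff, Submodule.submoduleOf, Submodule.eq_top_iff']
  exact ⟨fun h x hx => h ⟨x, hx⟩, fun h x => h x.1 x.2⟩

section LocalCohomology

variable (k : Type*) [Field k] {n : ℕ}

/-- Vanishing of `H^i(V, V \ {p})`, phrased with functions on the singular simplices of the ambient
space. -/
def LocalExact (V : Set (Fin n → ℝ)) (p : Fin n → ℝ) (i : ℕ) : Prop :=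
  ∀ φ : Simp (Fin n → ℝ) (i + 1) → k,
    (∀ σ : Simp (Fin n → ℝ) (i + 1), Set.range σ ∈ awayFrom p (𝒫 V) → φ σ = 0) →
    (∀ σ : Simp (Fin n → ℝ) (i + 2), Set.range σ ∈ 𝒫 V → cobd φ σ = 0) →
    ∃ ψ : Simp (Fin n → ℝ) i → k,
      (∀ σ : Simp (Fin n → ℝ) i, Set.range σ ∈ awayFrom p (𝒫 V) → ψ σ = 0) ∧
      ∀ σ : Simp (Fin n → ℝ) (i + 1), Set.range σ ∈ 𝒫 V → cobd ψ σ = φ σ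

variable {V : Set (Fin n → ℝ)}

/-- A singular simplex of `V` as one of the ambient space. -/
def inclSimp {m : ℕ} (σ : C(stdSimplex ℝ (Fin m), V)) : Simp (Fin n → ℝ) m :=
  (⟨Subtype.val, continuous_subtype_val⟩ : C(V, Fin n → ℝ)).comp σ

/-- A singular simplex of the ambient space with range in `V`, as a simplex of `V`. -/
def restrSimp {m : ℕ} (σ : Simp (Fin n → ℝ) m) (h : Set.range σ ⊆ V) :
    C(stdSimplex ℝ (Fin m), V) :=
  ⟨fun x => ⟨σ x, h ⟨x, rfl⟩⟩, σ.continuous.subtype_mk _⟩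

variable {k}

/-- Extension by zero of a cochain of `V` to the ambient space. -/
def extCochain {m : ℕ} (φ : C(stdSimplex ℝ (Fin m), V) → k) (σ : Simp (Fin n → ℝ) m) : k :=
  open Classical in if h : Set.range σ ⊆ V then φ (restrSimp σ h) else 0

theorem range_inclSimp {m : ℕ} (σ : C(stdSimplex ℝ (Fin m), V)) : Set.range (inclSimp σ) ⊆ V := by
  rintro _ ⟨x, rfl⟩
  exact (σ x).2

theorem extCochain_inclSimp {m : ℕ} (φ : C(stdSimplex ℝ (Fin m), V) → k)
    (σ : C(stdSimplex ℝ (Fin m), V)) : extCochain φ (inclSimp σ) = φ σ :=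
  dif_pos (range_inclSimp σ)

theorem inclSimp_restrSimp {m : ℕ} (σ : Simp (Fin n → ℝ) m) (h : Set.range σ ⊆ V) :
    inclSimp (restrSimp σ h) = σ := rfl

theorem inclSimp_face {q : ℕ} (σ : C(stdSimplex ℝ (Fin (q + 2)), V)) (j : Fin (q + 2)) :
    inclSimp (face σ j) = (inclSimp σ).comp (facet (q + 1) j) := rfl

theorem range_inclSimp_mem_awayFrom {m : ℕ} {p : V} {σ : C(stdSimplex ℝ (Fin m), V)} :
    Set.range (inclSimp σ) ∈ awayFrom (p : Fin n → ℝ) (𝒫 V) ↔ Set.range σ ⊆ {p}ᶜ := by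
  constructor
  · rintro ⟨-, h⟩ _ ⟨x, rfl⟩ hx
    exact h ⟨x, congrArg Subtype.val hx⟩
  · refine fun h => ⟨range_inclSimp σ, ?_⟩
    rintro ⟨x, hx⟩
    exact h ⟨x, rfl⟩ (Subtype.ext hx)

theorem subsingleton_relCohomology_iff (p : V) (i : ℕ) :
    Subsingleton (RelCohomology k ({p}ᶜ : Set V) i) ↔ LocalExact k V (p : Fin n → ℝ) i := by
  rw [RelCohomology, subsingleton_cohomology_iff]
  have hext : ∀ {m : ℕ} {φ : C(stdSimplex ℝ (Fin m), V) → k},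
      (∀ σ : C(stdSimplex ℝ (Fin m), V), Set.range σ ⊆ {p}ᶜ → φ σ = 0) →
      ∀ σ : Simp (Fin n → ℝ) m, Set.range σ ∈ awayFrom (p : Fin n → ℝ) (𝒫 V) →
        extCochain φ σ = 0 := by
    intro m φ hφ σ hσ
    rw [← inclSimp_restrSimp σ hσ.1] at hσ ⊢
    rw [extCochain_inclSimp]
    exact hφ _ (range_inclSimp_mem_awayFrom.1 hσ)
  have hD : ∀ (q : ℕ) (φ : relCochain k ({p}ᶜ : Set V) q) (σ : C(stdSimplex ℝ (Fin (q + 2)), V)),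
      (singularD k ({p}ᶜ : Set V) q φ).1 σ = cobd (extCochain φ.1) (inclSimp σ) := by
    intro q φ σ
    change ∑ j : Fin (q + 2), (-1 : k) ^ (j : ℕ) * φ.1 (face σ j) = ∑ j : Fin (q + 2), _
    refine Finset.sum_congr rfl fun j _ => ?_
    rw [← inclSimp_face, extCochain_inclSimp]
  have hcob : ∀ {m : ℕ} (φ : Simp (Fin n → ℝ) m → k) {σ : Simp (Fin n → ℝ) (m + 1)},
      Set.range σ ∈ 𝒫 V → cobd (extCochain fun τ : C(stdSimplex ℝ (Fin m), V) =>
        φ (inclSimp τ)) σ = cobd φ σ := by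
    intro m φ σ hσ
    refine cobd_congr (isLowerSet_powerset V) (fun τ hτ => ?_) hσ
    exact dif_pos hτ
  constructor
  · intro h φ hφ hd
    let φ' : relCochain k ({p}ᶜ : Set V) i :=
      ⟨fun σ => φ (inclSimp σ), fun σ hσ => hφ _ (range_inclSimp_mem_awayFrom.2 hσ)⟩
    have h1 := h φ' (Subtype.ext (funext fun σ => by
      rw [hD]
      exact (hcob φ (range_inclSimp σ)).trans (hd _ (range_inclSimp σ))))
    cases i with
    | zero =>
      refine ⟨0, fun _ _ => rfl, fun σ hσ => ?_⟩
      rw [cobd_zero]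
      exact (congrFun (congrArg Subtype.val ((Submodule.mem_bot k).1 h1)) (restrSimp σ hσ)).symm
    | succ q =>
      obtain ⟨ψ, hψ⟩ := h1
      refine ⟨extCochain ψ.1, hext ψ.2, fun σ hσ => ?_⟩
      have h2 := hD q ψ (restrSimp σ hσ)
      change _ = cobd (extCochain ψ.1) σ at h2
      rw [← h2, hψ]
      rfl
  · intro h φ hφ
    obtain ⟨ψ, hψ, hd⟩ := h (extCochain φ.1) (hext φ.2) fun σ hσ => by
      rw [← inclSimp_restrSimp σ hσ, ← hD, hφ]
      rfl
    cases i with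
    | zero =>
      refine (Submodule.mem_bot k).2 (Subtype.ext (funext fun σ => ?_))
      rw [← extCochain_inclSimp φ.1 σ, ← hd _ (range_inclSimp σ)]
      refine cobd_eq_zero (𝒜 := Set.univ) (fun _ _ _ _ => trivial) (fun τ _ => hψ τ ?_) trivial
      rw [range_simp_zero]
      exact ⟨Set.empty_subset _, Set.notMem_empty _⟩
    | succ q =>
      refine ⟨⟨fun σ => ψ (inclSimp σ), fun σ hσ => hψ _ (range_inclSimp_mem_awayFrom.2 hσ)⟩,
        Subtype.ext (funext fun σ => ?_)⟩
      rw [hD]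
      refine (hcob ψ (range_inclSimp σ)).trans ?_
      rw [hd _ (range_inclSimp σ), extCochain_inclSimp]

namespace LocalModel

variable {p : Fin n → ℝ} {δ η : ℝ} {S : Set (Finset (Fin n))}

theorem signs_lower (h : LocalModel V p δ S) :
    ∀ t ∈ {t : Fin n → SignType | signSupp t ∈ S}, ∀ s, SignLE s t →
      s ∈ {t : Fin n → SignType | signSupp t ∈ S} := by
  intro t ht s hs
  refine h.lower (fun j hj => ?_) ht
  rw [mem_signSupp] at hj ⊢
  exact (hs j).resolve_left hj ▸ hj

theorem orthantFam_subset (h : LocalModel V p δ S) :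
    orthantFam p δ {t | signSupp t ∈ S} ⊆ 𝒫 V := by
  rintro R ⟨t, ht, hR⟩
  exact hR.trans (h.orthant_subset ht)

/-- The cochains of `V` relative to `V \ {p}` that vanish on the cells form an acyclic complex. -/
theorem exists_cobd_eq_of_cells (h : LocalModel V p δ S) (hη : 0 < η) (hηδ : η < δ) {m : ℕ}
    {φ : Simp (Fin n → ℝ) (m + 1) → k}
    (hφ : ∀ σ : Simp (Fin n → ℝ) (m + 1), Set.range σ ∈ awayFrom p (𝒫 V) → φ σ = 0)
    (hc : ∀ t, signSupp t ∈ S → cellVal p η (m + 1) φ t = 0)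
    (hd : ∀ σ : Simp (Fin n → ℝ) (m + 2), Set.range σ ∈ 𝒫 V → cobd φ σ = 0) :
    ∃ ψ : Simp (Fin n → ℝ) m → k,
      (∀ σ : Simp (Fin n → ℝ) m, Set.range σ ∈ awayFrom p (𝒫 V) → ψ σ = 0) ∧
      (∀ t, signSupp t ∈ S → cellVal p η m ψ t = 0) ∧
      ∀ σ : Simp (Fin n → ℝ) (m + 1), Set.range σ ∈ 𝒫 V → cobd ψ σ = φ σ := by
  classical
  set Γ := {t : Fin n → SignType | signSupp t ∈ S}
  obtain ⟨a, ha, hac, had⟩ := cellAcyclic (k := k) (p := p) hη hηδ Γ h.signs_lower m φ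
    (fun σ hσ => hφ σ ⟨h.orthantFam_subset hσ.1, hσ.2⟩) hc
    fun σ hσ => hd σ (h.orthantFam_subset hσ)
  let a' : Simp (Fin n → ℝ) m → k := fun σ => if Set.range σ ∈ orthantFam p δ Γ then a σ else 0
  have ha' : ∀ σ : Simp (Fin n → ℝ) m, p ∉ Set.range σ → a' σ = 0 := by
    intro σ hσ
    by_cases hσΓ : Set.range σ ∈ orthantFam p δ Γ
    · exact (if_pos hσΓ).trans (ha σ ⟨hσΓ, hσ⟩)
    · exact if_neg hσΓ
  have had' : ∀ σ : Simp (Fin n → ℝ) (m + 1), Set.range σ ∈ orthantFam p δ Γ →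
      cobd a' σ = φ σ := fun σ hσ =>
    (cobd_congr (isLowerSet_orthantFam p δ Γ) (fun τ hτ => if_pos hτ) hσ).trans (had σ hσ)
  have haway : ∀ σ : Simp (Fin n → ℝ) (m + 1), p ∉ Set.range σ → cobd a' σ = 0 := fun σ hσ =>
    cobd_eq_zero (𝒜 := {R | p ∉ R}) (fun _ _ hR h1 h2 => h1 (hR h2)) ha' hσ
  obtain ⟨b, hb, hbd⟩ := (h.acyclicPair k).exists_cobd_eq (φ := φ - cobd a')
    (fun σ hσ => by
      rw [Pi.sub_apply]
      rcases hσ with hσ | hσ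
      · rw [hφ σ hσ, haway σ hσ.2, sub_self]
      · rw [had' σ hσ, sub_self])
    fun σ hσ => by rw [cobd_sub, cobd_cobd, hd σ hσ, sub_self]
  refine ⟨b + a', fun σ hσ => ?_, fun t ht => ?_, fun σ hσ => ?_⟩
  · rw [Pi.add_apply, hb σ (Or.inl hσ), ha' σ hσ.2, add_zero]
  · cases m with
    | zero => rfl
    | succ m =>
      by_cases hcard : (signSupp t).card = m
      · have hmem := range_cell_mem (p := p) hη hηδ (Γ := Γ) ht hcard
        rw [cellVal_succ _ hcard, Pi.add_apply, hb _ (Or.inr hmem), zero_add]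
        refine (if_pos hmem).trans ?_
        rw [← cellVal_succ a hcard, hac t ht]
      · exact dif_neg hcard
  · rw [cobd_add, hbd σ hσ, Pi.sub_apply, sub_add_cancel]

theorem cellVal_cobd (h : LocalModel V p δ S) (hη : 0 < η) (hηδ : η < δ) {m : ℕ}
    {ψ : Simp (Fin n → ℝ) m → k}
    (hψ : ∀ σ : Simp (Fin n → ℝ) m, Set.range σ ∈ awayFrom p (𝒫 V) → ψ σ = 0)
    {t : Fin n → SignType} (ht : signSupp t ∈ S) (hcard : (signSupp t).card = m) :
    cellVal p η (m + 1) (cobd ψ) t = -signD (cellVal p η m ψ) t :=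
  MonomialArr.cellVal_cobd (Γ := {t | signSupp t ∈ S}) hη hηδ
    (fun σ hσ => hψ σ ⟨h.orthantFam_subset hσ.1, hσ.2⟩) ht hcard

theorem localExact_iff_signExact (h : LocalModel V p δ S) (i : ℕ) :
    LocalExact k V p i ↔ SignExact k {t : Fin n → SignType | signSupp t ∈ S} i := by
  obtain ⟨η, hη, hηδ⟩ := exists_between h.pos
  have haway : ∀ {m : ℕ} {ψ : Simp (Fin n → ℝ) m → k},
      (∀ σ : Simp (Fin n → ℝ) m, p ∉ Set.range σ → ψ σ = 0) →
      ∀ σ : Simp (Fin n → ℝ) m, Set.range σ ∈ awayFrom p (𝒫 V) → ψ σ = 0 :=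
    fun hψ σ hσ => hψ σ hσ.2
  have haway_d : ∀ {m : ℕ} {ψ : Simp (Fin n → ℝ) m → k},
      (∀ σ : Simp (Fin n → ℝ) m, Set.range σ ∈ awayFrom p (𝒫 V) → ψ σ = 0) →
      ∀ σ : Simp (Fin n → ℝ) (m + 1), Set.range σ ∈ awayFrom p (𝒫 V) → cobd ψ σ = 0 :=
    fun hψ σ hσ => cobd_eq_zero (isLowerSet_awayFrom p (isLowerSet_powerset V)) hψ hσ
  constructor
  · intro hV f hf
    -- extend `f` to a cochain, and correct it to a cocycle with the same values on the cells
    obtain ⟨χ, hχ, hχf⟩ := exists_cochain_of_signs (p := p) hη (i + 1) f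
    have hχ' := haway hχ
    obtain ⟨ν, hν, hνc, hνd⟩ := h.exists_cobd_eq_of_cells hη hηδ (haway_d hχ')
      (fun t ht => by
        by_cases hcard : (signSupp t).card = i + 1
        · rw [h.cellVal_cobd hη hηδ hχ' ht hcard,
            signD_cellVal hcard fun s _ hs => hχf s hs, hf t ht hcard, neg_zero]
        · exact dif_neg hcard)
      fun σ _ => cobd_cobd χ σ
    obtain ⟨ψ, hψ, hψd⟩ := hV (χ - ν)
      (fun σ hσ => by rw [Pi.sub_apply, hχ' σ hσ, hν σ hσ, sub_self])
      fun σ hσ => by rw [cobd_sub, hνd σ hσ, sub_self]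
    refine ⟨-cellVal p η i ψ, fun t ht hcard => ?_⟩
    have h1 := h.cellVal_cobd hη hηδ hψ ht hcard
    have h2 : cellVal p η (i + 1) (cobd ψ) t = cellVal p η (i + 1) (χ - ν) t := by
      rw [cellVal_succ _ hcard, cellVal_succ _ hcard]
      exact hψd _ (h.orthantFam_subset (range_cell_mem (Γ := {t | signSupp t ∈ S}) hη hηδ ht hcard))
    rw [h2, cellVal_sub, hνc t ht, sub_zero, hχf t (by rw [hcard])] at h1
    rw [h1, signD, signD, ← Finset.sum_neg_distrib]
    exact Finset.sum_congr rfl fun j _ => by rw [Pi.neg_apply, mul_neg]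
  · intro hS φ hφ hd
    obtain ⟨μ, hμ⟩ := hS (cellVal p η (i + 1) φ) fun t ht hcard => by
      have h1 := h.cellVal_cobd hη hηδ hφ ht hcard
      rw [cellVal_succ _ hcard, hd _ (h.orthantFam_subset
        (range_cell_mem (Γ := {t | signSupp t ∈ S}) hη hηδ ht hcard))] at h1
      exact neg_eq_zero.1 h1.symm
    obtain ⟨χ, hχ, hχμ⟩ := exists_cochain_of_signs (p := p) hη i μ
    have hχ' := haway hχ
    obtain ⟨ν, hν, -, hνd⟩ := h.exists_cobd_eq_of_cells hη hηδ (φ := φ + cobd χ)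
      (fun σ hσ => by rw [Pi.add_apply, hφ σ hσ, haway_d hχ' σ hσ, add_zero])
      (fun t ht => by
        by_cases hcard : (signSupp t).card = i
        · rw [cellVal_add, h.cellVal_cobd hη hηδ hχ' ht hcard,
            signD_cellVal hcard fun s _ hs => hχμ s hs, hμ t ht hcard, add_neg_cancel]
        · exact dif_neg hcard)
      fun σ hσ => by rw [cobd_add, cobd_cobd, hd σ hσ, add_zero]
    refine ⟨ν - χ, fun σ hσ => by rw [Pi.sub_apply, hν σ hσ, hχ' σ hσ, sub_self], fun σ hσ => ?_⟩
    rw [cobd_sub, hνd σ hσ, Pi.add_apply, add_sub_cancel_right]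

/-- The local cohomology of a union of coordinate subspaces at its apex. -/
theorem subsingleton_relCohomology_iff {p : V} (h : LocalModel V (p : Fin n → ℝ) δ S) (i : ℕ) :
    Subsingleton (RelCohomology k ({p}ᶜ : Set V) i) ↔ ∀ F, SimplexExact k S F i := by
  rw [MonomialArr.subsingleton_relCohomology_iff, h.localExact_iff_signExact, signExact_iff]

end LocalModel

end LocalCohomology

/-! ### The graded pieces of the Čech complex -/

section Cech

variable {k : Type*} [Field k] {n : ℕ} {I : Ideal (MvPolynomial (Fin n) k)}

/-- The monomial `x^u` in the localization `S_F / I S_F`. -/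
def locMon (I : Ideal (MvPolynomial (Fin n) k)) (F : Finset (Fin n)) (u : Fin n →₀ ℕ) : Loc I F :=
  algebraMap _ (Loc I F) (Ideal.Quotient.mk I (monomial u 1))

theorem locMon_add (F : Finset (Fin n)) (u v : Fin n →₀ ℕ) :
    locMon I F (u + v) = locMon I F u * locMon I F v := by
  have : (monomial (u + v) (1 : k)) = monomial u 1 * monomial v 1 := by
    rw [monomial_mul, one_mul]
  rw [locMon, this, map_mul, map_mul]; rfl

theorem monomial_mem_varMonoid {F : Finset (Fin n)} {w : Fin n →₀ ℕ} (hw : w.support ⊆ F) :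
    Ideal.Quotient.mk I (monomial w 1) ∈ varMonoid I F := by
  rw [monomial_eq, C_1, one_mul, Finsupp.prod, map_prod]
  refine Submonoid.prod_mem _ fun j hj => ?_
  rw [map_pow]
  exact Submonoid.pow_mem _ (Submonoid.subset_closure (Set.mem_image_of_mem _ (hw hj))) _

theorem exists_monomial_of_mem_varMonoid {F : Finset (Fin n)} {s : MvPolynomial (Fin n) k ⧸ I}
    (hs : s ∈ varMonoid I F) :
    ∃ w : Fin n →₀ ℕ, w.support ⊆ F ∧ s = Ideal.Quotient.mk I (monomial w 1) := by
  induction hs using Submonoid.closure_induction with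
  | mem x hx =>
    obtain ⟨j, hj, rfl⟩ := hx
    exact ⟨Finsupp.single j 1, Finsupp.support_single_subset.trans
      (Finset.singleton_subset_iff.2 hj), rfl⟩
  | one => exact ⟨0, by simp, rfl⟩
  | mul x y _ _ hx hy =>
    obtain ⟨u, hu, rfl⟩ := hx
    obtain ⟨v, hv, rfl⟩ := hy
    exact ⟨u + v, Finsupp.support_add.trans (Finset.union_subset hu hv), by
      rw [← map_mul, monomial_mul, one_mul]⟩

theorem isUnit_locMon {F : Finset (Fin n)} {w : Fin n →₀ ℕ} (hw : w.support ⊆ F) :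
    IsUnit (locMon I F w) :=
  IsLocalization.map_units (Loc I F) (⟨_, monomial_mem_varMonoid hw⟩ : varMonoid I F)

theorem locMon_eq_zero_iff {F : Finset (Fin n)} {u : Fin n →₀ ℕ} :
    locMon I F u = 0 ↔ ∃ w : Fin n →₀ ℕ, w.support ⊆ F ∧ monomial (w + u) (1 : k) ∈ I := by
  refine (IsLocalization.map_eq_zero_iff (varMonoid I F) (Loc I F) _).trans ?_
  constructor
  · rintro ⟨⟨s, hs⟩, h⟩
    obtain ⟨w, hw, rfl⟩ := exists_monomial_of_mem_varMonoid hs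
    refine ⟨w, hw, ?_⟩
    rw [← map_mul, Ideal.Quotient.eq_zero_iff_mem, monomial_mul, one_mul] at h
    exact h
  · rintro ⟨w, hw, h⟩
    refine ⟨⟨_, monomial_mem_varMonoid hw⟩, ?_⟩
    rw [← map_mul, Ideal.Quotient.eq_zero_iff_mem, monomial_mul, one_mul]
    exact h

theorem locMap_apply {F G : Finset (Fin n)} (h : F ⊆ G) (z : Loc I F) :
    locMap I h z = IsLocalization.map (Loc I G) (RingHom.id _) (varMonoid_mono I h) z := rfl

theorem locMap_locMon {F G : Finset (Fin n)} (h : F ⊆ G) (u : Fin n →₀ ℕ) :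
    locMap I h (locMon I F u) = locMon I G u := by
  rw [locMap_apply, locMon, IsLocalization.map_eq, RingHom.id_apply, locMon]

theorem locMap_mul {F G : Finset (Fin n)} (h : F ⊆ G) (x y : Loc I F) :
    locMap I h (x * y) = locMap I h x * locMap I h y := by
  rw [locMap_apply, RingHom.map_mul, ← locMap_apply, ← locMap_apply]

/-- The positions where `a` is negative. -/
def negSupp (a : Fin n → ℤ) : Finset (Fin n) := Finset.univ.filter (a · < 0)

@[simp] theorem mem_negSupp {a : Fin n → ℤ} {j : Fin n} : j ∈ negSupp a ↔ a j < 0 := by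
  simp [negSupp]

/-- The positive part of an integer vector. -/
def posExp (a : Fin n → ℤ) : Fin n →₀ ℕ := Finsupp.equivFunOnFinite.symm fun j => (a j).toNat

@[simp] theorem posExp_apply (a : Fin n → ℤ) (j : Fin n) : posExp a j = (a j).toNat := rfl

theorem support_posExp_neg (a : Fin n → ℤ) : (posExp (-a)).support = negSupp a := by
  ext j
  simp

/-- The Laurent monomial `x^a` in `S_F / I S_F`; zero if `x^a ∉ S_F`. -/
def laurent (I : Ideal (MvPolynomial (Fin n) k)) (a : Fin n → ℤ) (F : Finset (Fin n)) : Loc I F :=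
  if negSupp a ⊆ F then locMon I F (posExp a) * Ring.inverse (locMon I F (posExp (-a))) else 0

theorem laurent_mul {a : Fin n → ℤ} {F : Finset (Fin n)} (h : negSupp a ⊆ F) :
    laurent I a F * locMon I F (posExp (-a)) = locMon I F (posExp a) := by
  rw [laurent, if_pos h, mul_assoc,
    Ring.inverse_mul_cancel _ (isUnit_locMon (by rwa [support_posExp_neg])), mul_one]

theorem locMon_mul_posExp {a : Fin n → ℤ} {u v : Fin n →₀ ℕ} (h : ∀ j, (u j : ℤ) - v j = a j)
    (F : Finset (Fin n)) :
    locMon I F u * locMon I F (posExp (-a)) = locMon I F v * locMon I F (posExp a) := by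
  rw [← locMon_add, ← locMon_add]
  congr 1
  ext j
  have := h j
  simp only [Finsupp.add_apply, posExp_apply, Pi.neg_apply]
  omega

theorem eq_of_mul_eq {R : Type*} [CommRing R] {z l u v p q : R} (hv : IsUnit v) (hq : IsUnit q)
    (hz : z * v = u) (hl : l * q = p) (h : u * q = v * p) : z = l := by
  refine hv.mul_right_cancel (hq.mul_right_cancel ?_)
  rw [hz, h, ← hl]
  ring

theorem eq_laurent {a : Fin n → ℤ} {F : Finset (Fin n)} {u v : Fin n →₀ ℕ} {z : Loc I F}
    (hv : v.support ⊆ F) (h : ∀ j, (u j : ℤ) - v j = a j)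
    (hz : z * locMon I F v = locMon I F u) : z = laurent I a F := by
  have hF : negSupp a ⊆ F := by
    intro j hj
    refine hv (Finsupp.mem_support_iff.2 fun h0 => ?_)
    have := h j
    rw [mem_negSupp] at hj
    omega
  have h1 : IsUnit (locMon I F (posExp (-a))) := isUnit_locMon (by rwa [support_posExp_neg])
  exact eq_of_mul_eq (isUnit_locMon hv) h1 hz (laurent_mul hF) (locMon_mul_posExp h F)

theorem mem_locDegree_iff {a : Fin n → ℤ} {F : Finset (Fin n)} {z : Loc I F} :
    z ∈ locDegree I F a ↔ ∃ c : k, z = c • laurent I a F := by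
  constructor
  · intro hz
    refine Submodule.span_induction (p := fun z _ => ∃ c : k, z = c • laurent I a F)
      ?_ ⟨0, by rw [zero_smul]⟩ ?_ ?_ hz
    · rintro z ⟨u, v, hv, h, hz⟩
      exact ⟨1, by rw [one_smul]; exact eq_laurent hv h hz⟩
    · rintro x y _ _ ⟨c, rfl⟩ ⟨d, rfl⟩
      exact ⟨c + d, by rw [add_smul]⟩
    · rintro c x _ ⟨d, rfl⟩
      exact ⟨c * d, by rw [mul_smul]⟩
  · rintro ⟨c, rfl⟩
    refine Submodule.smul_mem _ c ?_
    by_cases h : negSupp a ⊆ F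
    · refine Submodule.subset_span ⟨posExp a, posExp (-a), by rwa [support_posExp_neg], fun j => ?_,
        laurent_mul h⟩
      simp only [posExp_apply, Pi.neg_apply]
      omega
    · rw [laurent, if_neg h]
      exact Submodule.zero_mem _

theorem locMap_laurent {a : Fin n → ℤ} {F G : Finset (Fin n)} (h : F ⊆ G) (ha : negSupp a ⊆ F) :
    locMap I h (laurent I a F) = laurent I a G := by
  refine eq_laurent (u := posExp a) (v := posExp (-a)) ?_ (fun j => ?_) ?_
  · rw [support_posExp_neg]; exact ha.trans h
  · simp only [posExp_apply, Pi.neg_apply]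
    omega
  · rw [← locMap_locMon h, ← locMap_mul, laurent_mul ha, locMap_locMon]

/-- For `p ∈ ℝⁿ`, the sets `A` such that the affine space `p + ℝ^A` lies in the distracting
arrangement: the coordinates of `p` outside of `A` are natural numbers, and no monomial of `I` has
these exponents. -/
def standardFaces (I : Ideal (MvPolynomial (Fin n) k)) (p : Fin n → ℝ) : Set (Finset (Fin n)) :=
  {A | (∀ j, j ∉ A → ∃ m : ℕ, p j = m) ∧
    ∀ u : Fin n →₀ ℕ, (∀ j, j ∉ A → (u j : ℝ) = p j) → monomial u (1 : k) ∉ I}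

/-- The Laurent monomial `x^a` is nonzero in `S_F / I S_F` exactly when `F` is a standard face. -/
theorem laurent_eq_zero_iff {a : Fin n → ℤ} {F : Finset (Fin n)} (h : negSupp a ⊆ F) :
    laurent I a F = 0 ↔ F ∉ standardFaces I fun j => (a j : ℝ) := by
  have hu : IsUnit (locMon I F (posExp (-a))) := isUnit_locMon (by rwa [support_posExp_neg])
  rw [← hu.mul_left_eq_zero, laurent_mul h, locMon_eq_zero_iff]
  have hnat : ∀ j, j ∉ F → ∃ m : ℕ, (a j : ℝ) = m := by
    intro j hj
    have h1 : 0 ≤ a j := by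
      by_contra h0
      exact hj (h (mem_negSupp.2 (not_le.1 h0)))
    obtain ⟨m, hm⟩ := Int.eq_ofNat_of_zero_le h1
    exact ⟨m, by rw [hm, Int.cast_natCast]⟩
  constructor
  · rintro ⟨w, hw, hI⟩ ⟨-, h2⟩
    refine h2 (w + posExp a) (fun j hj => ?_) hI
    obtain ⟨m, hm⟩ := hnat j hj
    have h3 : a j = m := by exact_mod_cast hm
    have h4 : w j = 0 := Finsupp.notMem_support_iff.1 fun h5 => hj (hw h5)
    beta_reduce
    rw [Finsupp.add_apply, posExp_apply, h4, zero_add, h3, Int.toNat_natCast, Int.cast_natCast]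
  · intro hF
    have h1 : ∃ u : Fin n →₀ ℕ, (∀ j, j ∉ F → (u j : ℝ) = a j) ∧ monomial u (1 : k) ∈ I := by
      by_contra hne
      exact hF ⟨hnat, fun u hu hI => hne ⟨u, hu, hI⟩⟩
    obtain ⟨u, hua, hI⟩ := h1
    refine ⟨u - posExp a, fun j hj => ?_, ?_⟩
    · by_contra hjF
      have h3 := hua j hjF
      have h4 : a j = u j := by exact_mod_cast h3.symm
      refine Finsupp.mem_support_iff.1 hj ?_
      rw [Finsupp.tsub_apply, posExp_apply, h4]
      simp
    · have h5 : u - posExp a + posExp a = u + (posExp a - u) := by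
        ext j
        simp only [Finsupp.add_apply, Finsupp.tsub_apply]
        omega
      rw [h5, ← one_mul (1 : k), ← monomial_mul]
      exact I.mul_mem_right _ hI

theorem laurent_ne_zero_iff {a : Fin n → ℤ} {F : Finset (Fin n)} :
    laurent I a F ≠ 0 ↔ negSupp a ⊆ F ∧ F ∈ standardFaces I fun j => (a j : ℝ) := by
  by_cases h : negSupp a ⊆ F
  · rw [ne_eq, laurent_eq_zero_iff h, not_not, and_iff_right h]
  · simp [laurent, h]

theorem algebraMap_monomial (F : Finset (Fin n)) (u : Fin n →₀ ℕ) (c : k) :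
    algebraMap _ (Loc I F) (Ideal.Quotient.mk I (monomial u c)) = c • locMon I F u := by
  have h2 : monomial u c = c • monomial u (1 : k) := by rw [smul_monomial, smul_eq_mul, mul_one]
  rw [h2]
  exact map_smul ((IsScalarTower.toAlgHom k (MvPolynomial (Fin n) k ⧸ I) (Loc I F)).comp
    (Ideal.Quotient.mkₐ k I)) c (monomial u 1)

/-! ### Homogeneous components -/

section Grading

variable {L : Type*} [CommRing L] [Algebra (MvPolynomial (Fin n) k ⧸ I) L]

/-- The `ℤⁿ`-grading of a localization `L` of `S/I`, as the ring homomorphism `x^u ↦ x^u t^u`. -/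
def polyGrading (I : Ideal (MvPolynomial (Fin n) k)) (L : Type*) [CommRing L]
    [Algebra (MvPolynomial (Fin n) k ⧸ I) L] :
    MvPolynomial (Fin n) k →+* AddMonoidAlgebra L (Fin n → ℤ) :=
  eval₂Hom (AddMonoidAlgebra.singleZeroRingHom.comp
      ((algebraMap (MvPolynomial (Fin n) k ⧸ I) L).comp ((Ideal.Quotient.mk I).comp C)))
    fun j => AddMonoidAlgebra.single (Pi.single j 1 : Fin n → ℤ)
      (algebraMap _ L (Ideal.Quotient.mk I (X j)))

theorem polyGrading_monomial (u : Fin n →₀ ℕ) (c : k) :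
    polyGrading I L (monomial u c) = AddMonoidAlgebra.single (fun j => (u j : ℤ))
      (algebraMap _ L (Ideal.Quotient.mk I (monomial u c))) := by
  have hmul : ∀ f g : MvPolynomial (Fin n) k,
      algebraMap _ L (Ideal.Quotient.mk I (f * g)) =
        algebraMap _ L (Ideal.Quotient.mk I f) * algebraMap _ L (Ideal.Quotient.mk I g) :=
    fun f g => by rw [map_mul, map_mul]
  induction u using Finsupp.induction_linear generalizing c with
  | zero => exact eval₂_C _ _ _
  | add u v hu hv =>
    rw [← one_mul c, ← monomial_mul, map_mul, hu, hv, AddMonoidAlgebra.single_mul_single, hmul]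
    congr 1
  | single j m =>
    have h0 : monomial (Finsupp.single j m) c = C c * X j ^ m := C_mul_X_pow_eq_monomial.symm
    have hX : polyGrading I L (X j) = AddMonoidAlgebra.single (Pi.single j 1 : Fin n → ℤ)
        (algebraMap _ L (Ideal.Quotient.mk I (X j))) := eval₂_X _ _ _
    have hC : polyGrading I L (C c) = AddMonoidAlgebra.single (0 : Fin n → ℤ)
        (algebraMap _ L (Ideal.Quotient.mk I (C c))) := eval₂_C _ _ _
    rw [h0, map_mul, map_pow, hX, hC, AddMonoidAlgebra.single_pow,
      AddMonoidAlgebra.single_mul_single, hmul, ← map_pow, ← map_pow]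
    congr 1
    funext l
    by_cases h : l = j
    · subst h; simp
    · simp [h]

theorem polyGrading_eq_zero (hI : IsMonomialIdeal I) : ∀ f ∈ I, polyGrading I L f = 0 := by
  obtain ⟨G, hG⟩ := hI
  have : I ≤ RingHom.ker (polyGrading I L) := by
    conv_lhs => rw [hG]
    rw [Ideal.span_le]
    rintro _ ⟨u, hu, rfl⟩
    have h1 : monomial u (1 : k) ∈ I := by
      rw [hG]
      exact Ideal.subset_span ⟨u, hu, rfl⟩
    rw [SetLike.mem_coe, RingHom.mem_ker, polyGrading_monomial,
      Ideal.Quotient.eq_zero_iff_mem.2 h1, map_zero, AddMonoidAlgebra.single_zero]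
  exact this

/-- The homogeneous components of the elements of a monomial localization of `S/I`. -/
theorem exists_component (hI : IsMonomialIdeal I) (F : Finset (Fin n))
    [IsLocalization (varMonoid I F) L] (a : Fin n → ℤ) : ∃ π : L →+ L,
      ∀ (z : L) (c : k) (u v : Fin n →₀ ℕ), v.support ⊆ F →
        z * algebraMap _ L (Ideal.Quotient.mk I (monomial v 1)) =
          algebraMap _ L (Ideal.Quotient.mk I (monomial u c)) →
        π z = if (fun j => (u j : ℤ) - v j) = a then z else 0 := by
  classical
  let g := Ideal.Quotient.lift I (polyGrading I L) (polyGrading_eq_zero hI)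
  have hunitL : ∀ {w : Fin n →₀ ℕ}, w.support ⊆ F →
      IsUnit (algebraMap _ L (Ideal.Quotient.mk I (monomial w (1 : k)))) := fun hw =>
    IsLocalization.map_units L (⟨_, monomial_mem_varMonoid hw⟩ : varMonoid I F)
  have hunit : ∀ y : varMonoid I F, IsUnit (g y) := by
    rintro ⟨s, hs⟩
    obtain ⟨w, hw, rfl⟩ := exists_monomial_of_mem_varMonoid hs
    change IsUnit (polyGrading I L (monomial w 1))
    rw [polyGrading_monomial]
    refine IsUnit.of_mul_eq_one (AddMonoidAlgebra.single (fun j => -(w j : ℤ))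
      (Ring.inverse (algebraMap _ L (Ideal.Quotient.mk I (monomial w (1 : k)))))) ?_
    rw [AddMonoidAlgebra.single_mul_single, Ring.mul_inverse_cancel _ (hunitL hw),
      AddMonoidAlgebra.one_def]
    congr 1
    funext j
    simp
  let ρ : L →+* AddMonoidAlgebra L (Fin n → ℤ) := IsLocalization.lift hunit
  have hρ : ∀ f : MvPolynomial (Fin n) k,
      ρ (algebraMap _ L (Ideal.Quotient.mk I f)) = polyGrading I L f := fun f =>
    IsLocalization.lift_eq hunit _
  refine ⟨AddMonoidHom.mk' (fun z => (ρ z).coeff a) fun x y => by rw [map_add]; rfl,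
    fun z c u v hv hz => ?_⟩
  have h1 : ρ z = AddMonoidAlgebra.single (fun j => (u j : ℤ) - v j) z := by
    refine ((hunitL hv).map ρ).mul_right_cancel ?_
    rw [← map_mul, hz, hρ, hρ, polyGrading_monomial, polyGrading_monomial,
      AddMonoidAlgebra.single_mul_single, hz]
    congr 1
    funext j
    simp
  change (ρ z).coeff a = _
  rw [h1, AddMonoidAlgebra.coeff_single, Finsupp.single_apply]

end Grading

/-- The homogeneous component of degree `a`. -/
def component (hI : IsMonomialIdeal I) (F : Finset (Fin n)) (a : Fin n → ℤ) : Loc I F →+ Loc I F :=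
  (exists_component (L := Loc I F) hI F a).choose

theorem component_of_mem (hI : IsMonomialIdeal I) {F : Finset (Fin n)} {b : Fin n → ℤ}
    {z : Loc I F} (hz : z ∈ locDegree I F b) (a : Fin n → ℤ) :
    component hI F a z = if b = a then z else 0 := by
  obtain ⟨c, rfl⟩ := mem_locDegree_iff.1 hz
  by_cases h : negSupp b ⊆ F
  · refine ((exists_component (L := Loc I F) hI F a).choose_spec (c • laurent I b F) c
      (posExp b) (posExp (-b)) (by rwa [support_posExp_neg]) ?_).trans ?_
    · have h3 : algebraMap _ (Loc I F) (Ideal.Quotient.mk I (monomial (posExp b) c)) =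
          c • locMon I F (posExp b) := algebraMap_monomial _ _ _
      rw [h3, ← laurent_mul h]
      exact smul_mul_assoc _ _ _
    · have h4 : (fun j => (posExp b j : ℤ) - posExp (-b) j) = b := by
        funext j
        simp only [posExp_apply, Pi.neg_apply]
        omega
      rw [h4]
  · rw [laurent, if_neg h, smul_zero, map_zero, ite_self]

theorem iSup_locDegree (F : Finset (Fin n)) : ⨆ a, locDegree I F a = ⊤ := by
  rw [Submodule.eq_top_iff']
  intro z
  obtain ⟨⟨s, y⟩, hz⟩ := IsLocalization.surj (varMonoid I F) z
  obtain ⟨y, hy⟩ := y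
  obtain ⟨w, hw, rfl⟩ := exists_monomial_of_mem_varMonoid hy
  obtain ⟨f, rfl⟩ := Ideal.Quotient.mk_surjective s
  have hunit := isUnit_locMon (I := I) hw
  have h1 : z = algebraMap _ (Loc I F) (Ideal.Quotient.mk I f) * Ring.inverse (locMon I F w) := by
    rw [← hz]
    exact (Ring.mul_inverse_cancel_right _ _ hunit).symm
  rw [h1]
  clear h1 hz
  induction f using MvPolynomial.induction_on' with
  | monomial u c =>
    rw [algebraMap_monomial, smul_mul_assoc]
    refine Submodule.smul_mem _ _ (Submodule.mem_iSup_of_mem (fun j => (u j : ℤ) - w j)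
      (Submodule.subset_span ⟨u, w, hw, fun _ => rfl, ?_⟩))
    exact Ring.inverse_mul_cancel_right _ _ hunit
  | add f g hf hg =>
    rw [map_add, map_add, add_mul]
    exact Submodule.add_mem _ hf hg

theorem loc_induction {F : Finset (Fin n)} {P : Loc I F → Prop} (z : Loc I F)
    (hmem : ∀ b, ∀ z ∈ locDegree I F b, P z) (hadd : ∀ x y, P x → P y → P (x + y)) : P z := by
  have hz : z ∈ ⨆ a, locDegree I F a := by rw [iSup_locDegree]; trivial
  exact Submodule.iSup_induction (motive := P) _ hz hmem (hmem 0 0 (Submodule.zero_mem _)) hadd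

theorem component_mem (hI : IsMonomialIdeal I) {F : Finset (Fin n)} (a : Fin n → ℤ) (z : Loc I F) :
    component hI F a z ∈ locDegree I F a := by
  induction z using loc_induction with
  | hmem b z hz =>
    rw [component_of_mem hI hz]
    split_ifs with h
    · rwa [← h]
    · exact Submodule.zero_mem _
  | hadd x y hx hy =>
    rw [map_add]
    exact Submodule.add_mem _ hx hy

theorem locMap_smul {F G : Finset (Fin n)} (h : F ⊆ G) (c : k) (z : Loc I F) :
    locMap I h (c • z) = c • locMap I h z :=
  LinearMap.map_smul_of_tower _ _ _

theorem locMap_mem {F G : Finset (Fin n)} (h : F ⊆ G) {a : Fin n → ℤ} {z : Loc I F}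
    (hz : z ∈ locDegree I F a) : locMap I h z ∈ locDegree I G a := by
  obtain ⟨c, rfl⟩ := mem_locDegree_iff.1 hz
  rw [locMap_smul]
  refine Submodule.smul_mem _ _ ?_
  by_cases hF : negSupp a ⊆ F
  · rw [locMap_laurent h hF]
    exact mem_locDegree_iff.2 ⟨1, (one_smul _ _).symm⟩
  · rw [laurent, if_neg hF, map_zero]
    exact Submodule.zero_mem _

theorem component_locMap (hI : IsMonomialIdeal I) {F G : Finset (Fin n)} (h : F ⊆ G)
    (a : Fin n → ℤ) (z : Loc I F) :
    component hI G a (locMap I h z) = locMap I h (component hI F a z) := by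
  induction z using loc_induction with
  | hmem b z hz =>
    rw [component_of_mem hI hz, component_of_mem hI (locMap_mem h hz)]
    split_ifs
    · rfl
    · rw [map_zero]
  | hadd x y hx hy => rw [map_add, map_add, map_add, map_add, hx, hy]

theorem cechD_apply (i : ℕ) (y : CechCochain I i) (G : {G : Finset (Fin n) // G.card = i + 1}) :
    cechD I i y G = ∑ j : G.1, faceSign k G.1 j.1 • locMap I (G.1.erase_subset j.1)
      (y ⟨G.1.erase j.1, by rw [Finset.card_erase_of_mem j.2, G.2]; rfl⟩) := by
  rw [cechD, LinearMap.pi_apply, LinearMap.sum_apply]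
  refine Finset.sum_congr rfl fun j _ => ?_
  rw [faceSign]
  rcases neg_one_pow_eq_or ℤ (G.1.filter (· < j.1)).card with h | h
  · have h' : (-1 : k) ^ (G.1.filter (· < j.1)).card = 1 := by
      exact_mod_cast congrArg (Int.cast : ℤ → k) h
    rw [h, h', one_smul, one_smul]
    rfl
  · have h' : (-1 : k) ^ (G.1.filter (· < j.1)).card = -1 := by
      exact_mod_cast congrArg (Int.cast : ℤ → k) h
    rw [h, h', neg_one_smul, neg_one_smul]
    rfl

theorem component_smul (hI : IsMonomialIdeal I) {F : Finset (Fin n)} (a : Fin n → ℤ) (c : k)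
    (z : Loc I F) : component hI F a (c • z) = c • component hI F a z := by
  induction z using loc_induction with
  | hmem b z hz =>
    rw [component_of_mem hI hz, component_of_mem hI (Submodule.smul_mem _ c hz)]
    split_ifs
    · rfl
    · rw [smul_zero]
  | hadd x y hx hy => rw [smul_add, map_add, map_add, hx, hy, smul_add]

/-- A homogeneous coboundary is the coboundary of a homogeneous cochain. -/
theorem cechD_component (hI : IsMonomialIdeal I) (i : ℕ) (a : Fin n → ℤ) (y : CechCochain I i)
    (G : {G : Finset (Fin n) // G.card = i + 1}) :
    cechD I i (fun F => component hI F.1 a (y F)) G = component hI G.1 a (cechD I i y G) := by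
  rw [cechD_apply, cechD_apply, map_sum]
  exact Finset.sum_congr rfl fun j _ => by rw [component_smul, component_locMap]

/-- The Čech cochain of degree `a` with coefficients `f`. -/
def laurentCochain (I : Ideal (MvPolynomial (Fin n) k)) (a : Fin n → ℤ) (f : Finset (Fin n) → k)
    (i : ℕ) : CechCochain I i :=
  fun F => f F.1 • laurent I a F.1

theorem exists_laurentCochain_eq {i : ℕ} {a : Fin n → ℤ} {z : CechCochain I i}
    (hz : ∀ F, z F ∈ locDegree I F.1 a) : ∃ f : Finset (Fin n) → k,
      (∀ A, ¬ negSupp a ⊆ A → f A = 0) ∧ laurentCochain I a f i = z := by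
  classical
  have h : ∀ F : {F : Finset (Fin n) // F.card = i}, ∃ c : k, z F = c • laurent I a F.1 :=
    fun F => mem_locDegree_iff.1 (hz F)
  choose c hc using h
  refine ⟨fun A => if hA : negSupp a ⊆ A ∧ A.card = i then c ⟨A, hA.2⟩ else 0,
    fun A hA => dif_neg fun h => hA h.1, ?_⟩
  funext F
  rw [hc F, laurentCochain]
  by_cases hF : negSupp a ⊆ F.1
  · rw [dif_pos ⟨hF, F.2⟩]
  · rw [laurent, if_neg hF, smul_zero, smul_zero]

theorem cechD_laurentCochain (i : ℕ) {a : Fin n → ℤ} {g : Finset (Fin n) → k}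
    (hg : ∀ A, ¬ negSupp a ⊆ A → g A = 0) :
    cechD I i (laurentCochain I a g i) = laurentCochain I a (simplexD g) (i + 1) := by
  funext G
  rw [cechD_apply, laurentCochain, simplexD, Finset.sum_smul, ← Finset.sum_coe_sort G.1]
  refine Finset.sum_congr rfl fun j _ => ?_
  rw [laurentCochain, locMap_smul, mul_smul]
  by_cases h : negSupp a ⊆ G.1.erase j.1
  · rw [locMap_laurent _ h]
  · rw [hg _ h, zero_smul, zero_smul]

theorem laurentCochain_eq_iff {i : ℕ} {a : Fin n → ℤ} {f g : Finset (Fin n) → k}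
    (hf : ∀ A, ¬ negSupp a ⊆ A → f A = 0) (hg : ∀ A, ¬ negSupp a ⊆ A → g A = 0) :
    laurentCochain I a f i = laurentCochain I a g i ↔
      ∀ A ∈ standardFaces I fun j => (a j : ℝ), A.card = i → f A = g A := by
  constructor
  · intro h A hA hcard
    by_cases hF : negSupp a ⊆ A
    · have h1 : f A • laurent I a A = g A • laurent I a A := congrFun h ⟨A, hcard⟩
      rw [← sub_eq_zero, ← sub_smul] at h1
      exact sub_eq_zero.1 ((smul_eq_zero.1 h1).resolve_right (laurent_ne_zero_iff.2 ⟨hF, hA⟩))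
    · rw [hf A hF, hg A hF]
  · intro h
    funext F
    rw [laurentCochain, laurentCochain]
    by_cases hF : F.1 ∈ standardFaces I fun j => (a j : ℝ)
    · rw [h F.1 hF F.2]
    · have h1 : laurent I a F.1 = 0 := not_not.1 fun h => hF (laurent_ne_zero_iff.1 h).2
      rw [h1, smul_zero, smul_zero]

theorem localCohomologyDegree_eq_bot_iff (i : ℕ) (a : Fin n → ℤ) :
    localCohomologyDegree I i a = ⊥ ↔ ∀ z : CechCochain I i, cechD I i z = 0 →
      (∀ F, z F ∈ locDegree I F.1 a) → z ∈ coboundaries (cechD I) i := by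
  rw [localCohomologyDegree, Submodule.eq_bot_iff]
  constructor
  · intro h z hz hd
    have h1 := h _ (Submodule.mem_map_of_mem
      (show (⟨z, hz⟩ : LinearMap.ker (cechD I i)) ∈ _ from fun F _ => hd F))
    exact (Submodule.Quotient.mk_eq_zero
      ((coboundaries (cechD I) i).submoduleOf (LinearMap.ker (cechD I i)))).1 h1
  · rintro h _ ⟨z, hz, rfl⟩
    exact (Submodule.Quotient.mk_eq_zero
      ((coboundaries (cechD I) i).submoduleOf (LinearMap.ker (cechD I i)))).2
        (h z.1 z.2 fun F => hz F trivial)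

/-- The degree `a` piece of local cohomology, as the cohomology of a simplicial complex. -/
theorem localCohomologyDegree_eq_bot_iff_simplexExact (hI : IsMonomialIdeal I) (i : ℕ)
    (a : Fin n → ℤ) : localCohomologyDegree I i a = ⊥ ↔
      SimplexExact k (standardFaces I fun j => (a j : ℝ)) (negSupp a) i := by
  rw [localCohomologyDegree_eq_bot_iff]
  have hD : ∀ {f : Finset (Fin n) → k}, (∀ A, ¬ negSupp a ⊆ A → f A = 0) →
      ∀ A, ¬ negSupp a ⊆ A → simplexD f A = 0 := fun hf A => simplexD_eq_zero_of_not_subset hf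
  have hzero : ∀ i, laurentCochain I a 0 i = 0 := fun i => funext fun F => zero_smul _ _
  have hempty : ∀ g : Finset (Fin n) → k, ∀ A, A.card = 0 → simplexD g A = 0 := by
    intro g A hA
    rw [Finset.card_eq_zero.1 hA]
    simp [simplexD]
  constructor
  · intro h f hf hfd
    have hz := h (laurentCochain I a f i)
      (by
        rw [cechD_laurentCochain i hf, ← hzero]
        exact (laurentCochain_eq_iff (hD hf) fun _ _ => rfl).2 hfd)
      fun F => mem_locDegree_iff.2 ⟨_, rfl⟩
    cases i with
    | zero =>
      refine ⟨0, fun _ _ => rfl, fun A hA hc => ?_⟩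
      have h1 := (Submodule.mem_bot _).1 hz
      rw [← hzero] at h1
      rw [hempty 0 A hc, (laurentCochain_eq_iff hf fun _ _ => rfl).1 h1 A hA hc]
    | succ q =>
      obtain ⟨y, hy⟩ := hz
      obtain ⟨g, hg, hgy⟩ := exists_laurentCochain_eq (z := fun F => component hI F.1 a (y F))
        fun F => component_mem hI a (y F)
      refine ⟨g, hg, (laurentCochain_eq_iff (hD hg) hf).1 ?_⟩
      rw [← cechD_laurentCochain q hg, hgy]
      funext G
      rw [cechD_component, hy, laurentCochain, component_of_mem hI (mem_locDegree_iff.2 ⟨_, rfl⟩),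
        if_pos rfl]
  · intro h z hz hd
    obtain ⟨f, hf, rfl⟩ := exists_laurentCochain_eq hd
    rw [cechD_laurentCochain i hf, ← hzero] at hz
    obtain ⟨g, hg, hgd⟩ := h f hf ((laurentCochain_eq_iff (hD hf) fun _ _ => rfl).1 hz)
    rw [← (laurentCochain_eq_iff (hD hg) hf).2 hgd]
    cases i with
    | zero =>
      rw [(laurentCochain_eq_iff (g := 0) (hD hg) fun _ _ => rfl).2 fun A _ hA => hempty g A hA,
        hzero]
      exact Submodule.zero_mem _
    | succ q => exact ⟨laurentCochain I a g q, cechD_laurentCochain q hg⟩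

end Cech

/-! ### Zariski closures of sets of lattice points -/

section Zariski

variable {n : ℕ} {T : Set (Fin n → ℤ)}

theorem mem_realPoints_zariskiClosure_iff {p : Fin n → ℝ} :
    p ∈ realPoints (zariskiClosure T) ↔ ∀ f : MvPolynomial (Fin n) ℂ,
      (∀ a ∈ T, eval (fun j => (a j : ℂ)) f = 0) → eval (fun j => (p j : ℂ)) f = 0 := by
  have hev : ∀ (x : Fin n → ℂ) f, aeval x f = eval x f := fun x f =>
    RingHom.congr_fun (coe_aeval_eq_eval x) f
  refine forall_congr' fun f => imp_congr ⟨fun h a ha => ?_, fun h x hx => ?_⟩ ?_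
  · rw [← hev]
    exact h _ ⟨a, ha, rfl⟩
  · obtain ⟨a, ha, rfl⟩ := hx
    rw [hev]
    exact h a ha
  · rw [hev]

theorem isClosed_realPoints_zariskiClosure (T : Set (Fin n → ℤ)) :
    IsClosed (realPoints (zariskiClosure T)) := by
  have : realPoints (zariskiClosure T) = ⋂ f : MvPolynomial (Fin n) ℂ,
      ⋂ _ : ∀ a ∈ T, eval (fun j => (a j : ℂ)) f = 0,
        (fun p : Fin n → ℝ => eval (fun j => (p j : ℂ)) f) ⁻¹' {0} := by
    ext p
    simp only [mem_realPoints_zariskiClosure_iff, Set.mem_iInter]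
    rfl
  rw [this]
  refine isClosed_iInter fun f => isClosed_iInter fun _ => isClosed_singleton.preimage ?_
  exact (MvPolynomial.continuous_eval f).comp
    (continuous_pi fun j => Complex.continuous_ofReal.comp (continuous_apply j))

/-- The closure of a lattice box with infinite sides. -/
theorem mem_realPoints_zariskiClosure_of_box {p : Fin n → ℝ} (F : Finset (Fin n)) {s : Set ℤ}
    (hs : s.Infinite)
    (hT : ∀ a : Fin n → ℤ, (∀ j ∈ F, a j ∈ s) → (∀ j, j ∉ F → (a j : ℝ) = p j) → a ∈ T)
    (hp : ∀ j, j ∉ F → ∃ m : ℤ, p j = m) : p ∈ realPoints (zariskiClosure T) := by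
  classical
  rw [mem_realPoints_zariskiClosure_iff]
  intro f hf
  -- substitute the fixed coordinates; the resulting polynomial vanishes on an infinite box
  set g : MvPolynomial (Fin n) ℂ :=
    bind₁ (fun j => if j ∈ F then X j else C (p j : ℂ)) f with hg
  have hgx : ∀ x : Fin n → ℂ, eval x g = eval (fun j => if j ∈ F then x j else (p j : ℂ)) f := by
    intro x
    rw [hg, eval, eval₂Hom_bind₁]
    congr 2
    funext j
    split_ifs <;> simp
  have h0 : g = 0 := by
    refine funext_set (fun _ => (Int.cast : ℤ → ℂ) '' s)
      (fun _ => hs.image Int.cast_injective.injOn) fun x hx => ?_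
    rw [map_zero, hgx]
    choose a has hax using fun j => hx j trivial
    choose m hm using hp
    have := hf (fun j => if h : j ∈ F then a j else m j h)
      (hT _ (fun j hj => by rw [dif_pos hj]; exact has j) fun j hj => by rw [dif_neg hj, hm j hj])
    rw [← this]
    congr 2
    funext j
    split_ifs with h
    · rw [hax j]
    · rw [hm j h, Complex.ofReal_intCast]
  have h1 := hgx fun j => (p j : ℂ)
  rw [h0, map_zero] at h1
  rw [h1]
  congr 2
  funext j
  rw [ite_self]

/-- The closure of a set covered by finitely many translates of coordinate subspaces. -/
theorem exists_of_mem_realPoints_zariskiClosure {p : Fin n → ℝ}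
    {Q : Set (Finset (Fin n) × (Fin n → ℤ))} (hQ : Q.Finite)
    (hT : ∀ a ∈ T, ∃ q ∈ Q, ∀ j, j ∉ q.1 → a j = q.2 j)
    (hp : p ∈ realPoints (zariskiClosure T)) : ∃ q ∈ Q, ∀ j, j ∉ q.1 → p j = q.2 j := by
  by_contra hne
  push Not at hne
  choose r hr hpr using hne
  have hmem : ∀ q : {q // q ∈ hQ.toFinset}, q.1 ∈ Q := fun q => hQ.mem_toFinset.1 q.2
  rw [mem_realPoints_zariskiClosure_iff] at hp
  have h1 := hp (∏ q ∈ hQ.toFinset.attach, (X (r q.1 (hmem q)) - C (q.1.2 (r q.1 (hmem q)) : ℂ)))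
    fun a ha => by
      obtain ⟨q, hq, haq⟩ := hT a ha
      rw [map_prod]
      refine Finset.prod_eq_zero (Finset.mem_attach _ ⟨q, hQ.mem_toFinset.2 hq⟩) ?_
      rw [map_sub, eval_X, eval_C, haq _ (hr q hq), sub_self]
  rw [map_prod, Finset.prod_eq_zero_iff] at h1
  obtain ⟨q, -, h2⟩ := h1
  rw [map_sub, eval_X, eval_C, sub_eq_zero] at h2
  exact hpr q.1 (hmem q) (by exact_mod_cast h2)

end Zariski

/-! ### The standard faces of a point -/

section Faces

variable {k : Type*} [Field k] {n : ℕ} {I : Ideal (MvPolynomial (Fin n) k)}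

theorem monomial_mem_of_le {u v : Fin n →₀ ℕ} (h : u ≤ v) (hu : monomial u (1 : k) ∈ I) :
    monomial v (1 : k) ∈ I := by
  rw [← tsub_add_cancel_of_le h, ← one_mul (1 : k), ← monomial_mul]
  exact I.mul_mem_left _ hu

/-- Since `I` is finitely generated, membership in `I` does not depend on the precise size of large
exponents. -/
theorem exists_exponent_bound (hI : IsMonomialIdeal I) : ∃ M : ℕ, ∀ u v : Fin n →₀ ℕ,
    (∀ j, u j = v j ∨ M ≤ v j) → monomial u (1 : k) ∈ I → monomial v (1 : k) ∈ I := by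
  classical
  obtain ⟨G, hG⟩ := hI
  have hfg : (Ideal.span ((fun u : Fin n →₀ ℕ => monomial u (1 : k)) '' G)).FG :=
    IsNoetherian.noetherian _
  obtain ⟨s, hs, hspan⟩ := Submodule.fg_span_iff_fg_span_finset_subset _ |>.1 hfg
  obtain ⟨t, ht, rfl⟩ := Finset.subset_set_image_iff.1 hs
  have hmem : ∀ u, monomial u (1 : k) ∈ I ↔ ∃ g ∈ t, g ≤ u := by
    intro u
    have h1 : I = Ideal.span ((fun u : Fin n →₀ ℕ => monomial u (1 : k)) '' (t : Set _)) := by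
      rw [hG]
      refine hspan.trans ?_
      rw [Finset.coe_image]
    rw [h1, mem_ideal_span_monomial_image, support_monomial, if_neg one_ne_zero]
    simp
  refine ⟨t.sup fun g => Finset.univ.sup g, fun u v huv hu => ?_⟩
  obtain ⟨g, hg, hgu⟩ := (hmem u).1 hu
  refine (hmem v).2 ⟨g, hg, fun j => ?_⟩
  rcases huv j with h | h
  · exact h ▸ hgu j
  · have h1 : g j ≤ Finset.univ.sup g := Finset.le_sup (f := g) (Finset.mem_univ j)
    have h2 : Finset.univ.sup g ≤ t.sup fun g => Finset.univ.sup g :=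
      Finset.le_sup (f := fun g : Fin n →₀ ℕ => Finset.univ.sup g) hg
    exact h1.trans (h2.trans h)

theorem standardFaces_congr {p q : Fin n → ℝ} {A : Finset (Fin n)} (h : ∀ j, j ∉ A → p j = q j) :
    A ∈ standardFaces I p ↔ A ∈ standardFaces I q := by
  refine and_congr (forall₂_congr fun j hj => by rw [h j hj]) (forall_congr' fun u => ?_)
  exact imp_congr_left (forall₂_congr fun j hj => by rw [h j hj])

theorem mem_standardFaces_of_subset {p : Fin n → ℝ} {A B : Finset (Fin n)} (hAB : A ⊆ B)
    (hB : B ∈ standardFaces I p) (hp : ∀ j, j ∉ A → ∃ m : ℕ, p j = m) : A ∈ standardFaces I p :=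
  ⟨hp, fun u hu => hB.2 u fun j hj => hu j fun h => hj (hAB h)⟩

theorem mem_standardFaces_zero {p : Fin n → ℝ} {A : Finset (Fin n)} (h : A ∈ standardFaces I p) :
    A ∈ standardFaces I 0 := by
  classical
  refine ⟨fun j _ => ⟨0, by simp⟩, fun u hu hI => ?_⟩
  choose m hm using h.1
  refine h.2 (u + Finsupp.equivFunOnFinite.symm fun j => if hj : j ∈ A then 0 else m j hj)
    (fun j hj => ?_) (monomial_mem_of_le le_self_add hI)
  have h0 : u j = 0 := by simpa using hu j hj
  rw [Finsupp.add_apply, h0, zero_add, Finsupp.equivFunOnFinite_symm_apply_apply, dif_neg hj,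
    hm j hj]

/-- The real distracting arrangement. -/
theorem mem_distractingArrangement_iff (hI : IsMonomialIdeal I) {p : Fin n → ℝ} :
    p ∈ realPoints (distractingArrangement I) ↔ (standardFaces I p).Nonempty := by
  constructor
  · intro hp
    obtain ⟨M, hM⟩ := exists_exponent_bound hI
    let r : (Fin n → ℤ) → Finset (Fin n) × (Fin n → ℤ) := fun a =>
      (Finset.univ.filter fun j => (M : ℤ) ≤ a j, fun j => min (a j) M)
    have hfin : (r '' standardExponents I).Finite := by
      refine ((Set.finite_univ (α := Finset (Fin n))).prod
        (Set.finite_Icc (0 : Fin n → ℤ) fun _ => M)).subset ?_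
      rintro _ ⟨a, ⟨u, -, hu⟩, rfl⟩
      refine ⟨trivial, fun j => ?_, fun j => min_le_right _ _⟩
      have := hu j
      simp only [r, Pi.zero_apply]
      omega
    obtain ⟨_, ⟨a, ⟨u, hu, hau⟩, rfl⟩, hpa⟩ := exists_of_mem_realPoints_zariskiClosure hfin
      (fun a ha => ⟨r a, ⟨a, ha, rfl⟩, fun j hj => by
        have h1 : ¬ (M : ℤ) ≤ a j := fun h => hj (Finset.mem_filter.2 ⟨Finset.mem_univ j, h⟩)
        simp only [r]
        omega⟩) hp
    have key : ∀ j, j ∉ (r a).1 → p j = u j := by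
      intro j hj
      have h1 : ¬ (M : ℤ) ≤ a j := fun h => hj (Finset.mem_filter.2 ⟨Finset.mem_univ j, h⟩)
      have h2 : min (a j) M = u j := by
        have := hau j
        omega
      rw [hpa j hj]
      simp only [r]
      rw [h2, Int.cast_natCast]
    refine ⟨(r a).1, fun j hj => ⟨u j, key j hj⟩, fun v hv hvI => hu (hM v u (fun j => ?_) hvI)⟩
    by_cases hj : j ∈ (r a).1
    · right
      have := (Finset.mem_filter.1 hj).2
      have := hau j
      omega
    · left
      have := hv j hj
      rw [key j hj] at this
      exact_mod_cast this
  · rintro ⟨A, hA⟩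
    refine mem_realPoints_zariskiClosure_of_box A (Set.Ici_infinite (0 : ℤ)) (fun a ha hap => ?_)
      fun j hj => ?_
    · have hnn : ∀ j, 0 ≤ a j := by
        intro j
        by_cases hj : j ∈ A
        · exact ha j hj
        · obtain ⟨m, hm⟩ := hA.1 j hj
          have h1 := hap j hj
          rw [hm] at h1
          have h2 : a j = m := by exact_mod_cast h1
          omega
      refine ⟨posExp a, hA.2 _ fun j hj => ?_, fun j => ?_⟩
      · rw [← hap j hj, posExp_apply]
        exact_mod_cast congrArg (Int.cast : ℤ → ℝ) (Int.toNat_of_nonneg (hnn j))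
      · exact (Int.toNat_of_nonneg (hnn j)).symm
    · obtain ⟨m, hm⟩ := hA.1 j hj
      exact ⟨m, by rw [hm, Int.cast_natCast]⟩

theorem SimplexExact.congr_standardFaces {p q : Fin n → ℝ} {F : Finset (Fin n)} {i : ℕ}
    (h : ∀ j, j ∉ F → p j = q j) (hp : SimplexExact k (standardFaces I p) F i) :
    SimplexExact k (standardFaces I q) F i :=
  hp.congr fun _ hF => standardFaces_congr fun j hj => h j fun hjF => hj (hF hjF)

/-- The real quasidegrees of local cohomology. -/
theorem mem_realQuasidegrees_iff (hI : IsMonomialIdeal I) {i : ℕ} {p : Fin n → ℝ} :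
    p ∈ realQuasidegrees (localCohomologyDegree I i) ↔ ∃ F : Finset (Fin n),
      (∀ j, j ∉ F → ∃ m : ℕ, p j = m) ∧ ¬ SimplexExact k (standardFaces I p) F i := by
  have hT : ∀ a, a ∈ trueDegrees (localCohomologyDegree I i) ↔
      ¬ SimplexExact k (standardFaces I fun j => (a j : ℝ)) (negSupp a) i := fun a =>
    not_congr (localCohomologyDegree_eq_bot_iff_simplexExact hI i a)
  constructor
  · intro hp
    obtain ⟨M, hM⟩ := exists_exponent_bound hI
    -- the nonnegative coordinates of a true degree are bounded, as otherwise the complex is a cone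
    have hbound : ∀ a ∈ trueDegrees (localCohomologyDegree I i), ∀ j, a j < M := by
      intro a ha j
      by_contra hj
      rw [not_lt] at hj
      refine (hT a).1 ha (simplexExact_of_cone (j := j) ?_ ?_ i)
      · rw [mem_negSupp]
        omega
      · intro A hA _
        refine ⟨fun l hl => ?_, ?_⟩
        · exact hA.1 l fun h => hl (Finset.mem_insert_of_mem h)
        · intro u hu huI
          refine hA.2 (u.update j (a j).toNat) (fun l hl => ?_) (hM u _ (fun l => ?_) huI)
          · by_cases hlj : l = j
            · subst hlj
              rw [Finsupp.update_apply, if_pos rfl]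
              have h1 : ((a l).toNat : ℤ) = a l := Int.toNat_of_nonneg (by omega)
              have h2 : ((a l).toNat : ℝ) = a l := by
                rw [← Int.cast_natCast, h1]
              exact h2
            · rw [Finsupp.update_apply, if_neg hlj]
              exact hu l fun h => (Finset.mem_insert.1 h).elim hlj hl
          · by_cases hlj : l = j
            · subst hlj
              right
              rw [Finsupp.update_apply, if_pos rfl]
              omega
            · left
              rw [Finsupp.update_apply, if_neg hlj]
    let r : (Fin n → ℤ) → Finset (Fin n) × (Fin n → ℤ) := fun a => (negSupp a, fun j => max (a j) 0)
    have hfin : (r '' trueDegrees (localCohomologyDegree I i)).Finite := by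
      refine ((Set.finite_univ (α := Finset (Fin n))).prod
        (Set.finite_Icc (0 : Fin n → ℤ) fun _ => M)).subset ?_
      rintro _ ⟨a, ha, rfl⟩
      refine ⟨trivial, fun j => le_max_right _ _, fun j => max_le (hbound a ha j).le
        (Int.natCast_nonneg M)⟩
    have hr : ∀ a : Fin n → ℤ, ∀ j, j ∉ (r a).1 → 0 ≤ a j ∧ a j = (r a).2 j := by
      intro a j hj
      have h1 : ¬ a j < 0 := fun h => hj (mem_negSupp.2 h)
      simp only [r]
      omega
    obtain ⟨_, ⟨a, ha, rfl⟩, hpa⟩ := exists_of_mem_realPoints_zariskiClosure hfin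
      (fun a ha => ⟨r a, ⟨a, ha, rfl⟩, fun j hj => (hr a j hj).2⟩) hp
    have hpa' : ∀ j, j ∉ negSupp a → p j = a j := fun j hj => by
      rw [hpa j hj, ← (hr a j hj).2]
    refine ⟨negSupp a, fun j hj => ⟨(a j).toNat, ?_⟩, fun h =>
      (hT a).1 ha (h.congr_standardFaces hpa')⟩
    rw [hpa' j hj]
    exact_mod_cast congrArg (Int.cast : ℤ → ℝ) (Int.toNat_of_nonneg (hr a j hj).1).symm
  · rintro ⟨F, hF, hex⟩
    refine mem_realPoints_zariskiClosure_of_box F (Set.Iio_infinite (0 : ℤ)) (fun a ha hap => ?_)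
      fun j hj => ?_
    · have hneg : negSupp a = F := by
        ext j
        rw [mem_negSupp]
        refine ⟨fun h => ?_, ha j⟩
        by_contra hj
        obtain ⟨m, hm⟩ := hF j hj
        have h1 := hap j hj
        rw [hm] at h1
        have h2 : a j = m := by exact_mod_cast h1
        omega
      rw [hT, hneg]
      exact fun h => hex (h.congr_standardFaces hap)
    · obtain ⟨m, hm⟩ := hF j hj
      exact ⟨m, by rw [hm, Int.cast_natCast]⟩

/-- The faces of the standard faces at `p`. -/
def localFaces (I : Ideal (MvPolynomial (Fin n) k)) (p : Fin n → ℝ) : Set (Finset (Fin n)) :=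
  {A | ∃ B ∈ standardFaces I p, A ⊆ B}

theorem mem_localFaces_iff {p : Fin n → ℝ} {A : Finset (Fin n)}
    (hA : ∀ j, j ∉ A → ∃ m : ℕ, p j = m) : A ∈ localFaces I p ↔ A ∈ standardFaces I p :=
  ⟨fun ⟨_, hB, hAB⟩ => mem_standardFaces_of_subset hAB hB hA, fun h => ⟨A, h, Finset.Subset.rfl⟩⟩

theorem eventually_eq_of_natCast (p : Fin n → ℝ) :
    ∀ᶠ q : Fin n → ℝ in 𝓝 p, ∀ j, ∀ m : ℕ, q j = (m : ℝ) → p j = q j := by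
  refine Filter.eventually_all.2 fun j => ?_
  have hclosed : IsClosed ((Nat.cast : ℕ → ℝ) '' {m | p j ≠ m}) :=
    Nat.isClosedEmbedding_coe_real.isClosedMap _ (isClosed_discrete _)
  have hp : p j ∈ ((Nat.cast : ℕ → ℝ) '' {m | p j ≠ m})ᶜ := by
    rintro ⟨m, hm, h⟩
    exact hm h.symm
  filter_upwards [(continuous_apply j).continuousAt.eventually (hclosed.isOpen_compl.mem_nhds hp)]
    with q hq m hm
  by_contra h
  exact hq ⟨m, fun h' => h (h'.trans hm.symm), hm.symm⟩

/-- Near each of its points, the arrangement is the union of the coordinate subspaces indexed by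
the standard faces. -/
theorem exists_localModel (hI : IsMonomialIdeal I) {p : Fin n → ℝ}
    (hp : p ∈ realPoints (distractingArrangement I)) :
    ∃ δ, LocalModel (realPoints (distractingArrangement I)) p δ (localFaces I p) := by
  obtain ⟨δ, hδ, h⟩ := Metric.eventually_nhds_iff_ball.1 (eventually_eq_of_natCast p)
  refine ⟨δ, hδ, fun q hq => ?_, ?_, ?_⟩
  · rw [mem_distractingArrangement_iff hI]
    constructor
    · rintro ⟨A, hA⟩
      have hAq : ∀ j, j ∉ A → p j = q j := fun j hj => by
        obtain ⟨m, hm⟩ := hA.1 j hj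
        exact h q hq j m hm
      exact ⟨A, ⟨A, (standardFaces_congr hAq).2 hA, Finset.Subset.rfl⟩, fun j hj => (hAq j hj).symm⟩
    · rintro ⟨A, ⟨B, hB, hAB⟩, hq⟩
      exact ⟨B, (standardFaces_congr fun j hj => hq j fun hjA => hj (hAB hjA)).2 hB⟩
  · rintro A A' hA ⟨B, hB, hAB⟩
    exact ⟨B, hB, hA.trans hAB⟩
  · obtain ⟨A, hA⟩ := (mem_distractingArrangement_iff hI).1 hp
    exact ⟨A, A, hA, Finset.Subset.rfl⟩

/-- If `F` misses a coordinate of `p` that is not a natural number, the complex at `F` is a cone. -/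
theorem natCast_of_not_simplexExact {p : Fin n → ℝ} {F : Finset (Fin n)} {i : ℕ}
    (h : ¬ SimplexExact k (localFaces I p) F i) : ∀ j, j ∉ F → ∃ m : ℕ, p j = m := by
  intro j hj
  by_contra hne
  refine h (simplexExact_of_cone hj ?_ i)
  rintro A ⟨B, hB, hAB⟩ -
  have hjB : j ∈ B := by
    by_contra hjB
    exact hne (hB.1 j hjB)
  exact ⟨B, hB, Finset.insert_subset hjB hAB⟩

theorem simplexExact_localFaces_iff {p : Fin n → ℝ} {F : Finset (Fin n)} {i : ℕ}
    (hF : ∀ j, j ∉ F → ∃ m : ℕ, p j = m) :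
    SimplexExact k (localFaces I p) F i ↔ SimplexExact k (standardFaces I p) F i := by
  have h : ∀ A, F ⊆ A → (A ∈ localFaces I p ↔ A ∈ standardFaces I p) := fun A hA =>
    mem_localFaces_iff fun j hj => hF j fun h => hj (hA h)
  exact ⟨SimplexExact.congr h, SimplexExact.congr fun A hA => (h A hA).symm⟩

end Faces

/-! ### Dimensions -/

section Dimension

variable {k : Type*} [Field k] {n : ℕ} {I : Ideal (MvPolynomial (Fin n) k)}

theorem mem_standardFaces_zero_iff {A : Finset (Fin n)} : A ∈ standardFaces I 0 ↔
    ∀ u : Fin n →₀ ℕ, (∀ j, j ∉ A → u j = 0) → monomial u (1 : k) ∉ I := by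
  refine ⟨fun h u hu => h.2 u fun j hj => by rw [hu j hj]; simp, fun h =>
    ⟨fun j _ => ⟨0, by simp⟩, fun u hu => h u fun j hj => by simpa using hu j hj⟩⟩

/-- The ring `S/I` surjects onto the polynomial ring in the variables of a standard face. -/
theorem card_le_ringKrullDim (hI : IsMonomialIdeal I) {A : Finset (Fin n)}
    (hA : A ∈ standardFaces I 0) :
    (A.card : WithBot ℕ∞) ≤ ringKrullDim (MvPolynomial (Fin n) k ⧸ I) := by
  classical
  let φ : MvPolynomial (Fin n) k →ₐ[k] MvPolynomial A k :=
    aeval fun j => if h : j ∈ A then X ⟨j, h⟩ else 0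
  have hφ : ∀ f ∈ I, φ f = 0 := by
    obtain ⟨G, hG⟩ := hI
    have : I ≤ RingHom.ker φ := by
      conv_lhs => rw [hG]
      rw [Ideal.span_le]
      rintro _ ⟨u, hu, rfl⟩
      have h1 : monomial u (1 : k) ∈ I := by
        rw [hG]
        exact Ideal.subset_span ⟨u, hu, rfl⟩
      obtain ⟨j, hj, huj⟩ : ∃ j, j ∉ A ∧ u j ≠ 0 := by
        by_contra hne
        push Not at hne
        exact mem_standardFaces_zero_iff.1 hA u hne h1
      rw [SetLike.mem_coe, RingHom.mem_ker]
      change aeval _ _ = _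
      rw [aeval_monomial, Finsupp.prod]
      refine mul_eq_zero_of_right _ (Finset.prod_eq_zero (Finsupp.mem_support_iff.2 huj) ?_)
      rw [dif_neg hj, zero_pow huj]
    exact this
  have hsurj : Function.Surjective (Ideal.Quotient.lift I (φ : _ →+* MvPolynomial A k) hφ) := by
    intro g
    refine ⟨Ideal.Quotient.mk I (rename Subtype.val g), ?_⟩
    change φ (rename Subtype.val g) = g
    change aeval _ _ = _
    rw [aeval_rename]
    conv_rhs => rw [← aeval_X_left_apply g]
    congr 2
    funext j
    simp
  have h1 := ringKrullDim_le_of_surjective _ hsurj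
  rwa [ringKrullDim_of_isNoetherianRing, ringKrullDim_eq_zero_of_field, zero_add,
    Nat.card_eq_fintype_card, Fintype.card_coe] at h1

theorem ringKrullDim_quotient_span_X_le (F : Finset (Fin n)) :
    ringKrullDim (MvPolynomial (Fin n) k ⧸ Ideal.span (X '' {j | j ∉ F} :
      Set (MvPolynomial (Fin n) k))) ≤ F.card := by
  set J := Ideal.span (X '' {j | j ∉ F} : Set (MvPolynomial (Fin n) k))
  have hsurj : Function.Surjective ((Ideal.Quotient.mk J).comp
      (rename Subtype.val : MvPolynomial F k →ₐ[k] MvPolynomial (Fin n) k).toRingHom) := by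
    intro g
    obtain ⟨f, rfl⟩ := Ideal.Quotient.mk_surjective g
    induction f using MvPolynomial.induction_on with
    | C c => exact ⟨C c, by simp⟩
    | add f g hf hg =>
      obtain ⟨f', hf⟩ := hf
      obtain ⟨g', hg⟩ := hg
      exact ⟨f' + g', by rw [map_add, hf, hg, map_add]⟩
    | mul_X f j hf =>
      obtain ⟨f', hf⟩ := hf
      by_cases hj : j ∈ F
      · exact ⟨f' * X ⟨j, hj⟩, by rw [map_mul, hf, map_mul]; simp⟩
      · refine ⟨0, ?_⟩
        rw [map_zero, map_mul, Ideal.Quotient.eq_zero_iff_mem.2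
          (Ideal.subset_span (Set.mem_image_of_mem X hj)), mul_zero]
  have h1 := ringKrullDim_le_of_surjective _ hsurj
  rwa [ringKrullDim_of_isNoetherianRing, ringKrullDim_eq_zero_of_field, zero_add,
    Nat.card_eq_fintype_card, Fintype.card_coe] at h1

/-- The variables outside of a prime ideal containing `I` form a standard face. -/
theorem exists_le_card_of_le_ringKrullDim {d : ℕ}
    (hd : (d : WithBot ℕ∞) ≤ ringKrullDim (MvPolynomial (Fin n) k ⧸ I)) :
    ∃ F ∈ standardFaces I 0, d ≤ F.card := by
  classical
  rw [ringKrullDim_quotient] at hd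
  obtain ⟨l, hl⟩ := Order.le_krullDim_iff.1 hd
  set P := l.head.1.asIdeal with hP
  have hPprime : P.IsPrime := l.head.1.isPrime
  have hIP : I ≤ P := l.head.2
  refine ⟨Finset.univ.filter fun j => X j ∉ P, mem_standardFaces_zero_iff.2 fun u hu huI => ?_, ?_⟩
  · have h1 := hIP huI
    rw [monomial_eq, C_1, one_mul, Finsupp.prod, hPprime.prod_mem_iff] at h1
    obtain ⟨j, hj, hjP⟩ := h1
    refine Finsupp.mem_support_iff.1 hj (hu j fun h => ?_)
    exact (Finset.mem_filter.1 h).2 (hPprime.mem_of_pow_mem _ hjP)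
  · set F := Finset.univ.filter fun j => X j ∉ P with hF
    have h1 := ringKrullDim_quotient_span_X_le (k := k) F
    rw [ringKrullDim_quotient] at h1
    have hmem : ∀ i, (l i).1 ∈ PrimeSpectrum.zeroLocus
        (Ideal.span (X '' {j | j ∉ F} : Set (MvPolynomial (Fin n) k)) : Set (MvPolynomial _ k)) := by
      intro i
      rw [PrimeSpectrum.zeroLocus_span]
      rintro _ ⟨j, hj, rfl⟩
      have h2 : X j ∈ P := by
        by_contra h
        exact hj (Finset.mem_filter.2 ⟨Finset.mem_univ j, h⟩)
      have h3 : l.head ≤ l i := LTSeries.head_le l i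
      exact h3 h2
    have h2 : ((d : ℕ) : WithBot ℕ∞) ≤ Order.krullDim
        (PrimeSpectrum.zeroLocus (Ideal.span (X '' {j | j ∉ F} : Set (MvPolynomial (Fin n) k)) :
          Set (MvPolynomial _ k))) :=
      Order.le_krullDim_iff.2 ⟨⟨l.length, fun i => ⟨(l i).1, hmem i⟩, fun i => l.step i⟩, hl⟩
    exact_mod_cast h2.trans h1

theorem card_le_of_mem_standardFaces (hI : IsMonomialIdeal I) {d : ℕ}
    (hd : ringKrullDim (MvPolynomial (Fin n) k ⧸ I) = d) {p : Fin n → ℝ} {A : Finset (Fin n)}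
    (hA : A ∈ standardFaces I p) : A.card ≤ d := by
  have := card_le_ringKrullDim hI (mem_standardFaces_zero hA)
  rw [hd] at this
  exact_mod_cast this

/-- The coordinate subspace of `ℝⁿ` in the directions of `A`. -/
def coordSubspace (A : Finset (Fin n)) : Submodule ℝ (Fin n → ℝ) :=
  ⨅ j ∈ {j | j ∉ A}, LinearMap.ker (LinearMap.proj j : (Fin n → ℝ) →ₗ[ℝ] ℝ)

theorem mem_coordSubspace {A : Finset (Fin n)} {x : Fin n → ℝ} :
    x ∈ coordSubspace A ↔ ∀ j, j ∉ A → x j = 0 := by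
  simp [coordSubspace, Submodule.mem_iInf]

theorem finrank_coordSubspace (A : Finset (Fin n)) :
    Module.finrank ℝ (coordSubspace A) = A.card := by
  classical
  have e := LinearMap.iInfKerProjEquiv ℝ (fun _ : Fin n => ℝ) (I := {j | j ∈ A})
    (J := {j | j ∉ A}) (Set.disjoint_left.2 fun j h h' => h' h) fun j _ => em (j ∈ A)
  have h1 := e.finrank_eq
  rw [Module.finrank_fintype_fun_eq_card] at h1
  refine h1.trans ?_
  simp

/-- A generic point of an affine subspace of the arrangement has no natural coordinate among those
that are not constant on the subspace; hence the subspace lies in the directions of a standard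
face. -/
theorem finrank_direction_le (hI : IsMonomialIdeal I) {W : AffineSubspace ℝ (Fin n → ℝ)}
    (hW : (W : Set (Fin n → ℝ)).Nonempty)
    (hWV : (W : Set (Fin n → ℝ)) ⊆ realPoints (distractingArrangement I)) :
    ∃ A ∈ standardFaces I 0, Module.finrank ℝ W.direction ≤ A.card := by
  obtain ⟨w, hw⟩ := hW
  let J := {j : Fin n // ∃ v ∈ W.direction, v j ≠ 0}
  obtain ⟨v, hv, hvJ⟩ := Module.Dual.exists_forall_mem_ne_zero_of_forall_exists W.direction
    (fun j : J => (LinearMap.proj j.1 : (Fin n → ℝ) →ₗ[ℝ] ℝ)) fun j => j.2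
  -- all but countably many points of the line `w + ℝ v` are generic
  have hcount : (⋃ j : J, ⋃ m : ℕ, {t : ℝ | w j.1 + t * v j.1 = m}).Countable := by
    refine Set.countable_iUnion fun j => Set.countable_iUnion fun m => ?_
    refine Set.Subsingleton.countable fun t ht s hs => ?_
    have h1 : t * v j.1 = s * v j.1 := add_left_cancel (ht.trans hs.symm)
    exact mul_right_cancel₀ (hvJ j) h1
  obtain ⟨t, ht⟩ := (hcount.dense_compl ℝ).nonempty
  have hq : w + t • v ∈ W := by
    have := AffineSubspace.vadd_mem_of_mem_direction (W.direction.smul_mem t hv) hw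
    rwa [vadd_eq_add, add_comm] at this
  obtain ⟨A, hA⟩ := (mem_distractingArrangement_iff hI).1 (hWV hq)
  refine ⟨A, mem_standardFaces_zero hA, ?_⟩
  rw [← finrank_coordSubspace A]
  refine Submodule.finrank_mono fun x hx => mem_coordSubspace.2 fun j hj => ?_
  by_contra hxj
  obtain ⟨m, hm⟩ := hA.1 j hj
  exact ht (Set.mem_iUnion.2 ⟨⟨j, x, hx, hxj⟩, Set.mem_iUnion.2 ⟨m, hm⟩⟩)

theorem arrDim_eq (hI : IsMonomialIdeal I) {d : ℕ}
    (hd : ringKrullDim (MvPolynomial (Fin n) k ⧸ I) = d) :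
    arrDim (realPoints (distractingArrangement I)) = d := by
  refine IsGreatest.csSup_eq ⟨?_, ?_⟩
  · obtain ⟨A, hA, hAd⟩ := exists_le_card_of_le_ringKrullDim hd.ge
    refine ⟨(coordSubspace A).toAffineSubspace, ⟨0, Submodule.zero_mem _⟩, fun p hp => ?_, ?_⟩
    · refine (mem_distractingArrangement_iff hI).2 ⟨A, ?_⟩
      exact (standardFaces_congr fun j hj => (mem_coordSubspace.1 hp j hj).symm).1 hA
    · rw [Submodule.toAffineSubspace_direction, finrank_coordSubspace]
      exact le_antisymm (card_le_of_mem_standardFaces hI hd hA) hAd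
  · rintro m ⟨W, hW, hWV, rfl⟩
    obtain ⟨A, hA, h⟩ := finrank_direction_le hI hW hWV
    exact h.trans (card_le_of_mem_standardFaces hI hd hA)

end Dimension

/-! ### The non-Cohen–Macaulay locus -/

section Locus

variable {k : Type*} [Field k] {n : ℕ} {I : Ideal (MvPolynomial (Fin n) k)}

/-- The real quasidegrees of `H^i_𝔪(S/I)` are the points at which the arrangement has nonzero local
cohomology in degree `i`. -/
theorem mem_realQuasidegrees_iff_relCohomology (hI : IsMonomialIdeal I) (i : ℕ)
    (p : Fin n → ℝ) : p ∈ realQuasidegrees (localCohomologyDegree I i) ↔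
      ∃ hp : p ∈ realPoints (distractingArrangement I),
        ¬ Subsingleton (RelCohomology k
          ({⟨p, hp⟩}ᶜ : Set (realPoints (distractingArrangement I))) i) := by
  rw [mem_realQuasidegrees_iff hI]
  constructor
  · rintro ⟨F, hF, hex⟩
    obtain ⟨A, hA, -, -⟩ := exists_card_of_not_simplexExact hex
    have hp := (mem_distractingArrangement_iff hI).2 ⟨A, hA⟩
    obtain ⟨δ, hδ⟩ := exists_localModel hI hp
    refine ⟨hp, fun h => hex ?_⟩
    exact (simplexExact_localFaces_iff hF).1
      ((hδ.subsingleton_relCohomology_iff (p := ⟨p, hp⟩) i).1 h F)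
  · rintro ⟨hp, h⟩
    obtain ⟨δ, hδ⟩ := exists_localModel hI hp
    rw [hδ.subsingleton_relCohomology_iff (p := ⟨p, hp⟩), not_forall] at h
    obtain ⟨F, hF⟩ := h
    have hF' := natCast_of_not_simplexExact hF
    exact ⟨F, hF', fun h => hF ((simplexExact_localFaces_iff hF').2 h)⟩

theorem le_of_mem_realQuasidegrees (hI : IsMonomialIdeal I) {d : ℕ}
    (hd : ringKrullDim (MvPolynomial (Fin n) k ⧸ I) = d) {i : ℕ} {p : Fin n → ℝ}
    (hp : p ∈ realQuasidegrees (localCohomologyDegree I i)) : i ≤ d := by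
  obtain ⟨F, -, hex⟩ := (mem_realQuasidegrees_iff hI).1 hp
  obtain ⟨A, hA, -, rfl⟩ := exists_card_of_not_simplexExact hex
  exact card_le_of_mem_standardFaces hI hd hA

end Locus

end MonomialArr

end

theorem theoremt {k : Type*} [Field k] {n : ℕ} (I : Ideal (MvPolynomial (Fin n) k))
    (hI : MonomialArr.IsMonomialIdeal I) (d : ℕ)
    (hd : ringKrullDim (MvPolynomial (Fin n) k ⧸ I) = d) (α : Fin n → ℝ) :
    ¬ MonomialArr.IsCohenMacaulayNear k
        (MonomialArr.realPoints (MonomialArr.distractingArrangement I)) α ↔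
      ∃ i : ℕ, i < d ∧
        α ∈ MonomialArr.realQuasidegrees (MonomialArr.localCohomologyDegree I i) := by
  open MonomialArr in
  rw [IsCohenMacaulayNear, arrDim_eq hI hd]
  constructor
  · intro h
    have hclosed : IsClosed (⋃ i ∈ Set.Iio d, realQuasidegrees (localCohomologyDegree I i)) :=
      (Set.finite_Iio d).isClosed_biUnion fun i _ => isClosed_realPoints_zariskiClosure _
    have hα : α ∈ ⋃ i ∈ Set.Iio d, realQuasidegrees (localCohomologyDegree I i) := by
      by_contra hα
      refine h ⟨_, hclosed.isOpen_compl.mem_nhds hα, fun p hp i hi => ?_⟩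
      by_contra hne
      have hpi := (mem_realQuasidegrees_iff_relCohomology hI i p).2 ⟨p.2, hne⟩
      exact hp (Set.mem_biUnion (lt_of_le_of_ne (le_of_mem_realQuasidegrees hI hd hpi) hi) hpi)
    obtain ⟨i, hi, hαi⟩ := Set.mem_iUnion₂.1 hα
    exact ⟨i, hi, hαi⟩
  · rintro ⟨i, hi, hα⟩ ⟨U, hU, hCM⟩
    obtain ⟨hαV, hne⟩ := (mem_realQuasidegrees_iff_relCohomology hI i α).1 hα
    exact hne (hCM ⟨α, hαV⟩ (mem_of_mem_nhds hU) i hi.ne)
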